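/- **Definitions.** A *restriction category* is a category with an operation $(f\colon A\to B)\mapsto(\bar f\colon A\to A)$ such that $f\bar f=f$, $\bar f\,\bar g=\bar g\,\bar f$, $\overline{g\bar f}=\bar g\,\bar f$ and $\bar g f=f\,\overline{gf}$ whenever these make sense. A map $f$ is *total* if $\bar f=1$, a *restriction idempotent* if $\bar f=f$; $\mathcal O(A)$ is the set of restriction idempotents on $A$. Parallel maps are ordered by $f\le g\iff f=g\bar f$, and $f,g$ are *compatible* if $f\bar g=g\bar f$. Maps $s\colon A\to B$, $t\colon B\to A$ are *partial inverses* if $ts=\bar s$ and $st=\bar t$; then $s$ is a *partial isomorphism*. A *join restriction category* is a restriction category in which every pairwise compatible family of parallel maps has a join (least upper bound), these joins being preserved by precomposition. A map is *étale* if it is a join of partial isomorphisms, and a *local homeomorphism* if it is total and étale; a join restriction category is *étale* if all its maps are étale. A *partial section* of $p\colon A\to X$ is a map $s\colon X\to A$ with $ps=\bar s$. A *local atlas* on $X$ is a family $(\varphi_{ij}\in\mathcal O(X))_{i,j\in K}$ with $\varphi_{ij}=\varphi_{ji}$ and $\varphi_{jk}\varphi_{ij}\le\varphi_{ik}$. It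 is *induced by* a local homeomorphism $q=\bigvee_i p_i\colon A\to X$, where each $p_i$ has a partial inverse $s_i$, if $\varphi_{ij}=p_js_i$; then $q$ is a *glueing* of $\varphi$. A join restriction category *has local glueings* if every local atlas has a glueing. Let $\mathcal C$ be a join restriction category. An *$I$-partite internal category* $\mathbb A$ in $\mathcal C$ consists of objects $A_i$ and $A_{ij}$ ($i,j\in I$), total maps $\sigma_{ij}\colon A_{ij}\to A_i$ and $\tau_{ij}\colon A_{ij}\to A_j$ such that $\sigma_{ij}$ has a pullback along every total map, and maps $\eta_i\colon A_i\to A_{ii}$ and $\mu_{ijk}\colon A_{jk}\times_{A_j}A_{ij}\to A_{ik}$ compatible with sources and targets and satisfying the unit and associativity laws. It is *source-étale* if all $\sigma_{ij}$ are local homeomorphisms, and a *partite internal groupoid* if there are total maps $\iota_{ij}\colon A_{ij}\to A_{ji}$ with $\iota_{ji}\iota_{ij}=1$, $\sigma_{ji}\iota_{ij}=\tau_{ij}$ and $\mu_{iji}(\iota_{ij},1)=\eta_i\sigma_{ij}$. An *étale partite internal groupoid* is a source-étale partite internal groupoid. A *partite cofunctor* $F\colon\mathbb A\rightsquigarrow\mathbb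 B$ consists of a function $i\mapsto Fi$ on index sets and total maps $F_i\colon B_{Fi}\to A_i$ and $F_{ij}\colon A_{ij}\times_{A_i}B_{Fi}\to B_{Fi,Fj}$ such that $\sigma_{Fi,Fj}F_{ij}=\pi_2$, $F_j\tau_{Fi,Fj}F_{ij}=\tau_{ij}\pi_1$, $F_{ii}(\eta_iF_i,1)=\eta_{Fi}$ and, on generalised elements, $F_{ik}(\mu(y,x),b)=\mu\bigl(F_{jk}(y,\tau F_{ij}(x,b)),F_{ij}(x,b)\bigr)$. Let $\mathrm{peCat}_c(\mathcal C)$ be the category of source-étale partite internal categories and partite cofunctors, and $\mathrm{peGpd}_c(\mathcal C)$ its full subcategory on the étale partite internal groupoids. Let $\mathrm{rCat}/\!/\mathcal C$ be the category whose objects are restriction categories $\mathcal A$ with a restriction functor (one preserving $\overline{(\;)}$) $P\colon\mathcal A\to\mathcal C$, and whose maps $(\mathcal A,P)\to(\mathcal B,Q)$ are pairs of a restriction functor $F\colon\mathcal A\to\mathcal B$ and a natural transformation $\alpha\colon QF\Rightarrow P$ with total components, with composition $(G,\beta)(F,\alpha)=(GF,\alpha\circ\beta F)$. Let $\mathrm{jrCat}/\!/_h\mathcal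 C$ be its full subcategory on those $P$ for which $\mathcal A$ is a join restriction category and $P$ is *hyperconnected*, i.e. $\mathcal O(i)\to\mathcal O(Pi)$ is bijective for every $i\in\mathcal A$; let $\mathrm{ejrCat}/\!/_h\mathcal C$ be the full subcategory of the latter on those $P$ with $\mathcal A$ étale. The *externalisation* of $\mathbb A$ is $\pi_{\mathbb A}\colon\Phi\mathbb A\to\mathcal C$, where $\Phi\mathbb A$ has object set $I$, maps $i\to j$ the partial sections of $\sigma_{ij}$, identities $\eta_i$, composites $t\ast s=\mu_{ijk}\,\tau_{ij}^*(t)\,s$ (with $\tau_{ij}^*(t)=(t\tau_{ij},\overline{t\tau_{ij}})$), restriction of $s$ given by $\eta_i\bar s$, and $\pi_{\mathbb A}(i)=A_i$, $\pi_{\mathbb A}(s)=\tau_{ij}s$. A cofunctor $F$ is sent by $\Phi$ to $i\mapsto Fi$, $s\mapsto F_{ij}\,(sF_i,\overline{sF_i})$, with 2-cell components $F_i$. The *internalisation* $\Psi P$ of $P\colon\mathcal A\to\mathcal C$ has index set $\mathrm{ob}\,\mathcal A$, objects $Pi$, and $\sigma_{ij}=\bigvee_f p_f\colon\Psi P_{ij}\to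 Pi$ a glueing of the local atlas $\bigvee\{Pe: e\in\mathcal O(i),\ e\le\bar f\bar g,\ fe=ge\}$ indexed by $f,g\in\mathcal A(i,j)$, with $s_f$ the partial inverse of $p_f$; its structure is given by $\tau_{ij}s_f=Pf$, $\eta_i=s_{1_i}$ and $\mu_{ijk}\,\tau_{ij}^*(s_g)\,s_f=s_{gf}$. The unit map $P\to\Phi\Psi P$ is the identity on objects, sends $f$ to $s_f$, and has identity 2-cell; $\Psi$ acts on maps so as to make the units natural. **Theorem.** Let $\mathcal C$ be a join restriction category with local glueings. The functors $\Phi$ and $\Psi$ are well defined and give mutually inverse equivalences of categories $$\mathrm{peCat}_c(\mathcal C)\;\simeq\;\mathrm{jrCat}/\!/_h\mathcal C,$$ with every unit map $P\to\Phi\Psi P$ invertible, and these restrict to mutually inverse equivalences $$\mathrm{peGpd}_c(\mathcal C)\;\simeq\;\mathrm{ejrCat}/\!/_h\mathcal C$$ between the category of étale partite internal groupoids in $\mathcal C$ and the category of étale join restriction categories hyperconnected over $\mathcal C$. Moreover, for every partite internal groupoid $\mathbb A$ in $\mathcal C$ (étale or not), the functor $\pi_{\mathbb A}\colon\Phi\mathbb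 A\to\mathcal C$ reflects partial isomorphisms and étale maps: if $\pi_{\mathbb A}(f)$ is a partial isomorphism (respectively étale), then so is $f$. -/

import Mathlib

open CategoryTheory CategoryTheory.Limits

attribute [local instance 2000] CategoryStruct.toQuiver

universe w v u

namespace EtaleGpd

/-! ### Restriction categories -/

/-- A restriction category.  Composition is written in diagrammatic order, `f ≫ g`. -/
class RestrictionCategory (C : Type u) [Category.{v} C] where
  rest : ∀ {A B : C}, (A ⟶ B) → (A ⟶ A)
  rest_comp_self : ∀ {A B : C} (f : A ⟶ B), rest f ≫ f = f
  rest_comm : ∀ {A B B' : C} (f : A ⟶ B) (g : A ⟶ B'), rest f ≫ rest g = rest g ≫ rest f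
  rest_rest_comp : ∀ {A B B' : C} (f : A ⟶ B) (g : A ⟶ B'),
    rest (rest f ≫ g) = rest f ≫ rest g
  comp_rest : ∀ {A B B' : C} (f : A ⟶ B) (g : B ⟶ B'), f ≫ rest g = rest (f ≫ g) ≫ f


section Basic

variable {C : Type u} [Category.{v} C] [RestrictionCategory C]

/-- The restriction `f̄ : A ⟶ A` of `f : A ⟶ B`. -/
def rest {A B : C} (f : A ⟶ B) : A ⟶ A := RestrictionCategory.rest f

theorem rest_self {A B : C} (f : A ⟶ B) : rest f ≫ f = f :=
  RestrictionCategory.rest_comp_self f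

theorem rest_comm {A B B' : C} (f : A ⟶ B) (g : A ⟶ B') :
    rest f ≫ rest g = rest g ≫ rest f :=
  RestrictionCategory.rest_comm f g

theorem rest_rest_comp {A B B' : C} (f : A ⟶ B) (g : A ⟶ B') :
    rest (rest f ≫ g) = rest f ≫ rest g :=
  RestrictionCategory.rest_rest_comp f g

theorem comp_rest {A B B' : C} (f : A ⟶ B) (g : B ⟶ B') :
    f ≫ rest g = rest (f ≫ g) ≫ f :=
  RestrictionCategory.comp_rest f g

/-- Restriction idempotents. -/
def IsRestIdem {A : C} (e : A ⟶ A) : Prop := rest e = e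

/-- Total maps. -/
class IsTotal {A B : C} (f : A ⟶ B) : Prop where
  rest_eq : rest f = 𝟙 A

/-- The canonical partial order on hom-sets. -/
def RLe {A B : C} (f g : A ⟶ B) : Prop := f = rest f ≫ g

/-- The compatibility relation on hom-sets. -/
def Compatible {A B : C} (f g : A ⟶ B) : Prop := rest g ≫ f = rest f ≫ g

/-- `j` is the join (least upper bound) of `S` for the canonical partial order. -/
def IsJoin {A B : C} (S : Set (A ⟶ B)) (j : A ⟶ B) : Prop :=
  (∀ f ∈ S, RLe f j) ∧ ∀ k : A ⟶ B, (∀ f ∈ S, RLe f k) → RLe j k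

/-- `t` is partial inverse to `s`. -/
def IsPartialInverse {A B : C} (s : A ⟶ B) (t : B ⟶ A) : Prop :=
  s ≫ t = rest s ∧ t ≫ s = rest t

/-- Partial isomorphisms. -/
def IsPartialIso {A B : C} (s : A ⟶ B) : Prop := ∃ t : B ⟶ A, IsPartialInverse s t

/-- Étale maps: joins of partial isomorphisms. -/
def IsEtaleMap {A B : C} (f : A ⟶ B) : Prop :=
  ∃ S : Set (A ⟶ B), (∀ g ∈ S, IsPartialIso g) ∧ IsJoin S f

/-- Local homeomorphisms: total étale maps. -/
def IsLocalHomeo {A B : C} (f : A ⟶ B) : Prop := IsTotal f ∧ IsEtaleMap f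

/-- `s` is a partial section of `p`. -/
def IsPartialSection {A X : C} (p : A ⟶ X) (s : X ⟶ A) : Prop := s ≫ p = rest s

end Basic

/-- Join restriction categories: every pairwise compatible family of parallel maps has a join,
and these joins are preserved by precomposition. -/
class IsJoinRestriction (C : Type u) [Category.{v} C] [RestrictionCategory C] : Prop where
  exists_join : ∀ {A B : C} (S : Set (A ⟶ B)), (∀ f ∈ S, ∀ g ∈ S, Compatible f g) →
    ∃ j : A ⟶ B, IsJoin S j ∧
      ∀ {A' : C} (g : A' ⟶ A), IsJoin {h | ∃ f ∈ S, h = g ≫ f} (g ≫ j)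

/-- A local atlas on `X`, indexed by the set `K`. -/
structure LocalAtlas {C : Type u} [Category.{v} C] [RestrictionCategory C] (X : C)
    (K : Type v) where
  φ : K → K → (X ⟶ X)
  isRestIdem : ∀ i j, IsRestIdem (φ i j)
  symm : ∀ i j, φ i j = φ j i
  trans : ∀ i j k, RLe (φ i j ≫ φ j k) (φ i k)

/-- The total map `q : A ⟶ X`, written as the join of the partial isomorphisms `p i` with
partial inverses `s i`, induces the matrix `φ i j = p j ∘ s i`. -/
structure IsGlueing {C : Type u} [Category.{v} C] [RestrictionCategory C] {A X : C}
    {K : Type v} (φ : K → K → (X ⟶ X)) (q : A ⟶ X) (p : K → (A ⟶ X)) (s : K → (X ⟶ A)) :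
    Prop where
  total : IsTotal q
  inverse : ∀ i, IsPartialInverse (p i) (s i)
  join : IsJoin (Set.range p) q
  atlas : ∀ i j, s i ≫ p j = φ i j

/-- `C` has local glueings: every local atlas is induced by some local homeomorphism. -/
def HasLocalGlueings (C : Type u) [Category.{v} C] [RestrictionCategory C] : Prop :=
  ∀ (X : C) (K : Type v) (a : LocalAtlas X K),
    ∃ (A : C) (q : A ⟶ X) (p : K → (A ⟶ X)) (s : K → (X ⟶ A)), IsGlueing a.φ q p s

/-- Restriction functors. -/
def IsRestrictionFunctor {A : Type*} [Category A] [RestrictionCategory A] {B : Type*}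
    [Category B] [RestrictionCategory B] (F : A ⥤ B) : Prop :=
  ∀ {x y : A} (f : x ⟶ y), F.map (rest f) = rest (F.map f)

/-- A restriction functor is hyperconnected if it induces bijections between the
(semilattices of) restriction idempotents of `x` and of `F x`. -/
def IsHyperconnected {A : Type*} [Category A] [RestrictionCategory A] {B : Type*}
    [Category B] [RestrictionCategory B] (F : A ⥤ B) : Prop :=
  IsRestrictionFunctor F ∧
    ∀ x : A, Set.BijOn (fun e : x ⟶ x => F.map e) {e | IsRestIdem e} {e | IsRestIdem e}

/-! ### Elementary facts -/

section Basic

variable {C : Type u} [Category.{v} C] [RestrictionCategory C]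

theorem rest_self_assoc {A B B' : C} (f : A ⟶ B) (g : B ⟶ B') : rest f ≫ f ≫ g = f ≫ g := by
  rw [← Category.assoc, rest_self]

theorem rest_id (A : C) : rest (𝟙 A) = 𝟙 A := by
  simpa using rest_self (𝟙 A)

theorem rest_rest {A B : C} (f : A ⟶ B) : rest (rest f) = rest f := by
  have := rest_rest_comp f (𝟙 A)
  simpa [rest_id] using this

theorem rest_idem {A B : C} (f : A ⟶ B) : rest f ≫ rest f = rest f := by
  rw [← rest_rest_comp, rest_self]

theorem rest_comp_rest {A B B' : C} (f : A ⟶ B) (g : B ⟶ B') :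
    rest (f ≫ rest g) = rest (f ≫ g) := by
  rw [comp_rest, rest_rest_comp]
  have h : rest (f ≫ g) ≫ rest f = rest f ≫ rest (f ≫ g) := rest_comm _ _
  rw [h, ← rest_rest_comp, rest_self_assoc]

theorem rest_comp_le {A B B' : C} (f : A ⟶ B) (g : B ⟶ B') :
    rest f ≫ rest (f ≫ g) = rest (f ≫ g) := by
  rw [← rest_rest_comp, rest_self_assoc]

theorem rest_comp_total {A B B' : C} (f : A ⟶ B) (g : B ⟶ B') [IsTotal g] :
    rest (f ≫ g) = rest f := by
  rw [← rest_comp_rest, IsTotal.rest_eq (f := g), Category.comp_id]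

instance (A : C) : IsTotal (𝟙 A) := ⟨rest_id A⟩

instance {A B B' : C} (f : A ⟶ B) (g : B ⟶ B') [IsTotal f] [IsTotal g] : IsTotal (f ≫ g) :=
  ⟨by rw [rest_comp_total, IsTotal.rest_eq]⟩

theorem IsTotal.of_comp {A B B' : C} (f : A ⟶ B) (g : B ⟶ B') (h : IsTotal (f ≫ g)) :
    IsTotal f :=
  ⟨by
    have := rest_comp_le f g
    rw [h.rest_eq, Category.comp_id] at this
    exact this⟩

theorem isTotal_fst {A B X : C} (f : A ⟶ X) (g : B ⟶ X) [IsTotal f] [IsTotal g]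
    [HasPullback f g] : IsTotal (pullback.fst f g) :=
  ⟨by
    have h : rest (pullback.fst f g) = rest (pullback.snd f g) := by
      rw [← rest_comp_total (pullback.fst f g) f, pullback.condition, rest_comp_total]
    apply pullback.hom_ext
    · rw [rest_self, Category.id_comp]
    · rw [h, rest_self, Category.id_comp]⟩

theorem isTotal_snd {A B X : C} (f : A ⟶ X) (g : B ⟶ X) [IsTotal f] [IsTotal g]
    [HasPullback f g] : IsTotal (pullback.snd f g) :=
  ⟨by
    have h : rest (pullback.fst f g) = rest (pullback.snd f g) := by
      rw [← rest_comp_total (pullback.fst f g) f, pullback.condition, rest_comp_total]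
    rw [← h, (isTotal_fst f g).rest_eq]⟩

instance {A B X : C} (f : A ⟶ X) (g : B ⟶ X) [IsTotal f] [IsTotal g]
    [HasPullback f g] : IsTotal (pullback.fst f g) := isTotal_fst f g

instance {A B X : C} (f : A ⟶ X) (g : B ⟶ X) [IsTotal f] [IsTotal g]
    [HasPullback f g] : IsTotal (pullback.snd f g) := isTotal_snd f g

theorem RLe.refl {A B : C} (f : A ⟶ B) : RLe f f := (rest_self f).symm

theorem RLe.rest_eq {A B : C} {f g : A ⟶ B} (h : RLe f g) : rest f = rest f ≫ rest g := by
  rw [← rest_rest_comp]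
  exact congrArg rest h

theorem RLe.trans {A B : C} {f g h : A ⟶ B} (h₁ : RLe f g) (h₂ : RLe g h) : RLe f h := by
  have e := h₁.rest_eq
  unfold RLe at h₁ h₂ ⊢
  rw [e, Category.assoc, ← h₂]
  exact h₁

theorem RLe.antisymm {A B : C} {f g : A ⟶ B} (h₁ : RLe f g) (h₂ : RLe g f) : f = g := by
  have e : rest f = rest g := by rw [h₁.rest_eq, rest_comm, ← h₂.rest_eq]
  refine Eq.trans h₁ ?_
  rw [e, rest_self]

theorem RLe.rest {A B : C} {f g : A ⟶ B} (h : RLe f g) : RLe (rest f) (rest g) := by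
  unfold RLe
  rw [rest_rest]
  exact h.rest_eq

theorem RLe.comp_right {A B B' : C} {f g : A ⟶ B} (h : RLe f g) (k : B ⟶ B') :
    RLe (f ≫ k) (g ≫ k) := by
  unfold RLe at h ⊢
  have e : EtaleGpd.rest (f ≫ k) = EtaleGpd.rest f ≫ EtaleGpd.rest (g ≫ k) := by
    rw [← rest_rest_comp, ← Category.assoc, ← h]
  rw [e, Category.assoc, rest_self, ← Category.assoc, ← h]

theorem RLe.comp_left {A B B' : C} {f g : A ⟶ B} (h : RLe f g) (k : B' ⟶ A) :
    RLe (k ≫ f) (k ≫ g) := by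
  unfold RLe at h ⊢
  rw [← Category.assoc, ← comp_rest, Category.assoc, ← h]

theorem RLe.rest_of_le_id {A : C} {e : A ⟶ A} (h : RLe e (𝟙 A)) : EtaleGpd.rest e = e := by
  unfold RLe at h
  rw [Category.comp_id] at h
  exact h.symm

theorem rest_rle_id {A B : C} (f : A ⟶ B) : RLe (rest f) (𝟙 A) := by
  unfold RLe
  rw [rest_rest, Category.comp_id]

theorem IsJoin.unique {A B : C} {S : Set (A ⟶ B)} {j k : A ⟶ B} (hj : IsJoin S j)
    (hk : IsJoin S k) : j = k :=
  RLe.antisymm (hj.2 k hk.1) (hk.2 j hj.1)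

theorem isJoin_of_mem {A B : C} {S : Set (A ⟶ B)} {j : A ⟶ B} (hj : j ∈ S)
    (h : ∀ f ∈ S, RLe f j) : IsJoin S j :=
  ⟨h, fun _ hk => hk j hj⟩

theorem IsJoin.compatible {A B : C} {S : Set (A ⟶ B)} {j : A ⟶ B} (hj : ∀ f ∈ S, RLe f j)
    (f : A ⟶ B) (hf : f ∈ S) (g : A ⟶ B) (hg : g ∈ S) : Compatible f g := by
  have h₁ := hj f hf
  have h₂ := hj g hg
  unfold RLe at h₁ h₂
  unfold Compatible
  have e : rest g ≫ rest f ≫ j = rest f ≫ rest g ≫ j := by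
    rw [← Category.assoc, rest_comm, Category.assoc]
  rw [← h₁, ← h₂] at e
  exact e

theorem IsJoin.comp [IsJoinRestriction C] {A B A' : C} {S : Set (A ⟶ B)} {j : A ⟶ B}
    (hj : IsJoin S j) (g : A' ⟶ A) : IsJoin {h | ∃ f ∈ S, h = g ≫ f} (g ≫ j) := by
  obtain ⟨k, hk, hk'⟩ := IsJoinRestriction.exists_join S (IsJoin.compatible hj.1)
  rw [hj.unique hk]
  exact hk' g

theorem IsJoin.rest [IsJoinRestriction C] {A B : C} {S : Set (A ⟶ B)} {j : A ⟶ B}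
    (hj : IsJoin S j) : IsJoin {h | ∃ f ∈ S, h = EtaleGpd.rest f} (EtaleGpd.rest j) := by
  refine ⟨?_, ?_⟩
  · rintro _ ⟨f, hf, rfl⟩
    exact (hj.1 f hf).rest
  · intro k hk
    obtain ⟨e, he, -⟩ := IsJoinRestriction.exists_join {h | ∃ f ∈ S, h = EtaleGpd.rest f} (by
      refine IsJoin.compatible (j := 𝟙 A) ?_
      rintro _ ⟨f, hf, rfl⟩
      exact rest_rle_id f)
    have he1 : EtaleGpd.rest e = e := by
      refine RLe.rest_of_le_id (he.2 _ ?_)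
      rintro _ ⟨f, hf, rfl⟩
      exact rest_rle_id f
    have h : RLe j (e ≫ j) := by
      refine hj.2 _ (fun f hf => ?_)
      have h1 : RLe (EtaleGpd.rest f ≫ j) (e ≫ j) := (he.1 _ ⟨f, hf, rfl⟩).comp_right j
      have h2 := hj.1 f hf
      unfold RLe at h2
      rwa [← h2] at h1
    have h3 : RLe (EtaleGpd.rest j) e := by
      have h4 := h.rest_eq
      have h5 : EtaleGpd.rest (e ≫ j) = EtaleGpd.rest j ≫ e := by
        have h6 := rest_rest_comp e j
        rw [rest_comm, he1] at h6
        exact h6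
      rw [h5, ← Category.assoc, rest_idem] at h4
      unfold RLe
      rw [rest_rest]
      exact h4
    exact h3.trans (he.2 k hk)

theorem RLe.of_restrictions [IsJoinRestriction C] {A B : C} {m k : A ⟶ B} {D : Set (A ⟶ A)}
    (hD : IsJoin D (EtaleGpd.rest m)) (h : ∀ d ∈ D, RLe (d ≫ m) k) : RLe m k := by
  have hd : ∀ d ∈ D, EtaleGpd.rest d = d := fun d hd =>
    ((hD.1 d hd).trans (rest_rle_id m)).rest_of_le_id
  have hm : ∀ f ∈ {h | ∃ d ∈ D, h = d ≫ m}, RLe f m := by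
    rintro _ ⟨d, hd', rfl⟩
    have := ((hD.1 d hd').trans (rest_rle_id m)).comp_right m
    rwa [Category.id_comp] at this
  obtain ⟨n, hn, -⟩ := IsJoinRestriction.exists_join {h | ∃ d ∈ D, h = d ≫ m}
    (IsJoin.compatible hm)
  have hnm : RLe n m := hn.2 m hm
  have hnk : RLe n k := hn.2 k (by
    rintro _ ⟨d, hd', rfl⟩
    exact h d hd')
  have hmn : RLe (EtaleGpd.rest m) (EtaleGpd.rest n) := by
    refine hD.2 _ (fun d hd' => ?_)
    have h1 := (hn.1 _ ⟨d, hd', rfl⟩).rest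
    have h2 : EtaleGpd.rest (d ≫ m) = d := by
      have h3 := hD.1 d hd'
      unfold RLe at h3
      rw [hd d hd'] at h3
      have h4 := rest_rest_comp d m
      rw [hd d hd', ← h3] at h4
      exact h4
    rwa [h2] at h1
  have e : EtaleGpd.rest n = EtaleGpd.rest m := RLe.antisymm hnm.rest hmn
  have : n = m := by
    unfold RLe at hnm
    rw [e, rest_self] at hnm
    exact hnm
  rwa [← this]

end Basic

/-! ### Partite internal categories -/

section Partite

variable {C : Type u} [Category.{v} C] [RestrictionCategory C]

/-- The underlying graph of an `I`-partite internal category with objects of objects `A i`. -/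
structure PartiteGraph {I : Type w} (A : I → C) where
  arr : I → I → C
  src : ∀ i j, arr i j ⟶ A i
  tgt : ∀ i j, arr i j ⟶ A j
  src_total : ∀ i j, IsTotal (src i j)
  tgt_total : ∀ i j, IsTotal (tgt i j)
  src_hasPullback : ∀ i j {Y : C} (f : Y ⟶ A i), IsTotal f → HasPullback (src i j) f

attribute [instance] PartiteGraph.src_total PartiteGraph.tgt_total

instance {I : Type w} {A : I → C} (G : PartiteGraph A) (i j : I) {Y : C} (f : Y ⟶ A i)
    [h : IsTotal f] : HasPullback (G.src i j) f := G.src_hasPullback i j f h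

/-- An `I`-partite internal category with objects of objects `A i`.  The fibre product
`A_jk ×_{A_j} A_ij` is `pullback (src j k) (tgt i j)`, and the triple fibre product
`A_kl ×_{A_k} A_jk ×_{A_j} A_ij` is `pullback (src k l) (pullback.fst _ _ ≫ tgt j k)`. -/
structure PartiteCatOn {I : Type w} (A : I → C) where
  graph : PartiteGraph A
  one : ∀ i, A i ⟶ graph.arr i i
  one_src : ∀ i, one i ≫ graph.src i i = 𝟙 (A i)
  one_tgt : ∀ i, one i ≫ graph.tgt i i = 𝟙 (A i)
  mul : ∀ i j k, pullback (graph.src j k) (graph.tgt i j) ⟶ graph.arr i k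
  mul_src : ∀ i j k, mul i j k ≫ graph.src i k = pullback.snd _ _ ≫ graph.src i j
  mul_tgt : ∀ i j k, mul i j k ≫ graph.tgt i k = pullback.fst _ _ ≫ graph.tgt j k
  mul_one : ∀ i j,
    pullback.lift (f := graph.src i j) (g := graph.tgt i i)
      (𝟙 (graph.arr i j)) (graph.src i j ≫ one i)
      (by rw [Category.assoc, one_tgt, Category.comp_id, Category.id_comp]) ≫
        mul i i j = 𝟙 (graph.arr i j)
  one_mul : ∀ i j,
    pullback.lift (f := graph.src j j) (g := graph.tgt i j)
      (graph.tgt i j ≫ one j) (𝟙 (graph.arr i j))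
      (by rw [Category.assoc, one_src, Category.comp_id, Category.id_comp]) ≫
        mul i j j = 𝟙 (graph.arr i j)
  mul_assoc : ∀ i j k l,
    pullback.lift (f := graph.src k l) (g := graph.tgt i k)
      (pullback.fst (graph.src k l)
        (pullback.fst (graph.src j k) (graph.tgt i j) ≫ graph.tgt j k))
      (pullback.snd _ _ ≫ mul i j k)
      (by rw [Category.assoc, mul_tgt, pullback.condition]) ≫ mul i k l =
    pullback.lift (f := graph.src j l) (g := graph.tgt i j)
      (pullback.lift (f := graph.src k l) (g := graph.tgt j k)
        (pullback.fst (graph.src k l)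
          (pullback.fst (graph.src j k) (graph.tgt i j) ≫ graph.tgt j k))
        (pullback.snd _ _ ≫ pullback.fst _ _)
        (by rw [Category.assoc, pullback.condition]) ≫ mul j k l)
      (pullback.snd _ _ ≫ pullback.snd _ _)
      (by rw [Category.assoc, mul_src, pullback.lift_snd_assoc, Category.assoc,
            pullback.condition, Category.assoc]) ≫ mul i j l

attribute [local simp] pullback.lift_fst pullback.lift_snd pullback.lift_fst_assoc
  pullback.lift_snd_assoc

namespace PartiteCatOn

variable {I : Type w} {A : I → C} (𝔸 : PartiteCatOn A)

abbrev arr (i j : I) : C := 𝔸.graph.arr i j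
abbrev src (i j : I) : 𝔸.arr i j ⟶ A i := 𝔸.graph.src i j
abbrev tgt (i j : I) : 𝔸.arr i j ⟶ A j := 𝔸.graph.tgt i j

/-- The composite of a generalised composable pair of arrows. -/
noncomputable def cmp {i j k : I} {T : C} (y : T ⟶ 𝔸.arr j k) (x : T ⟶ 𝔸.arr i j)
    (h : y ≫ 𝔸.src j k = x ≫ 𝔸.tgt i j) : T ⟶ 𝔸.arr i k :=
  pullback.lift y x h ≫ 𝔸.mul i j k

instance (i : I) : IsTotal (𝔸.one i) :=
  IsTotal.of_comp _ (𝔸.src i i) (by rw [𝔸.one_src]; infer_instance)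

instance (i j k : I) : IsTotal (𝔸.mul i j k) :=
  IsTotal.of_comp _ (𝔸.src i k) (by rw [𝔸.mul_src]; infer_instance)

section

variable {i j k l : I} {T : C}

theorem comp_cmp {S : C} (r : S ⟶ T) (y : T ⟶ 𝔸.arr j k) (x : T ⟶ 𝔸.arr i j)
    (h : y ≫ 𝔸.src j k = x ≫ 𝔸.tgt i j) :
    r ≫ 𝔸.cmp y x h = 𝔸.cmp (r ≫ y) (r ≫ x) (by rw [Category.assoc, h, Category.assoc]) := by
  unfold cmp
  refine (Category.assoc _ _ _).symm.trans ?_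
  congr 1
  apply pullback.hom_ext <;> simp

theorem cmp_congr {y y' : T ⟶ 𝔸.arr j k} {x x' : T ⟶ 𝔸.arr i j}
    (h : y ≫ 𝔸.src j k = x ≫ 𝔸.tgt i j) (hy : y = y') (hx : x = x') :
    𝔸.cmp y x h = 𝔸.cmp y' x' (by rw [← hy, ← hx, h]) := by
  subst hy hx; rfl

theorem cmp_src (y : T ⟶ 𝔸.arr j k) (x : T ⟶ 𝔸.arr i j)
    (h : y ≫ 𝔸.src j k = x ≫ 𝔸.tgt i j) : 𝔸.cmp y x h ≫ 𝔸.src i k = x ≫ 𝔸.src i j := by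
  unfold cmp
  rw [Category.assoc, 𝔸.mul_src, pullback.lift_snd_assoc]

theorem cmp_tgt (y : T ⟶ 𝔸.arr j k) (x : T ⟶ 𝔸.arr i j)
    (h : y ≫ 𝔸.src j k = x ≫ 𝔸.tgt i j) : 𝔸.cmp y x h ≫ 𝔸.tgt i k = y ≫ 𝔸.tgt j k := by
  unfold cmp
  rw [Category.assoc, 𝔸.mul_tgt, pullback.lift_fst_assoc]

theorem cmp_one (y : T ⟶ 𝔸.arr i j) :
    𝔸.cmp y (y ≫ 𝔸.src i j ≫ 𝔸.one i) (by simp [𝔸.one_tgt]) = y := by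
  have h := 𝔸.mul_one i j
  have h2 := congrArg (fun t => y ≫ t) h
  simp only [Category.comp_id] at h2
  refine Eq.trans ?_ h2
  unfold cmp
  refine Eq.trans ?_ (Category.assoc _ _ _)
  congr 1
  apply pullback.hom_ext <;> simp

theorem one_cmp (x : T ⟶ 𝔸.arr i j) :
    𝔸.cmp (x ≫ 𝔸.tgt i j ≫ 𝔸.one j) x (by simp [𝔸.one_src]) = x := by
  have h := 𝔸.one_mul i j
  have h2 := congrArg (fun t => x ≫ t) h
  simp only [Category.comp_id] at h2
  refine Eq.trans ?_ h2
  unfold cmp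
  refine Eq.trans ?_ (Category.assoc _ _ _)
  congr 1
  apply pullback.hom_ext <;> simp

theorem cmp_assoc (z : T ⟶ 𝔸.arr k l) (y : T ⟶ 𝔸.arr j k) (x : T ⟶ 𝔸.arr i j)
    (h : y ≫ 𝔸.src j k = x ≫ 𝔸.tgt i j) (h' : z ≫ 𝔸.src k l = y ≫ 𝔸.tgt j k) :
    𝔸.cmp z (𝔸.cmp y x h) (by rw [cmp_tgt, h']) =
      𝔸.cmp (𝔸.cmp z y h') x (by rw [cmp_src, h]) := by
  have h0 := 𝔸.mul_assoc i j k l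
  have h2 := congrArg (fun t => pullback.lift (f := 𝔸.src k l)
    (g := pullback.fst (𝔸.src j k) (𝔸.tgt i j) ≫ 𝔸.tgt j k) z (pullback.lift y x h)
      (by rw [pullback.lift_fst_assoc, h']) ≫ t) h0
  refine Eq.trans ?_ (h2.trans ?_)
  · unfold cmp
    refine Eq.trans ?_ (Category.assoc _ _ _)
    congr 1
    apply pullback.hom_ext <;> simp
  · unfold cmp
    refine Eq.trans (Category.assoc _ _ _).symm ?_
    congr 1
    apply pullback.hom_ext
    · simp only [Category.assoc, pullback.lift_fst]
      refine Eq.trans (Category.assoc _ _ _).symm ?_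
      congr 1
      apply pullback.hom_ext <;> simp
    · simp

end

end PartiteCatOn

variable (C) in
/-- A partite internal category in `C`. -/
structure PartiteCat where
  Idx : Type w
  obj : Idx → C
  str : PartiteCatOn obj

namespace PartiteCat

variable (𝔸 : PartiteCat.{w} C)

abbrev arr (i j : 𝔸.Idx) : C := 𝔸.str.arr i j
abbrev src (i j : 𝔸.Idx) : 𝔸.arr i j ⟶ 𝔸.obj i := 𝔸.str.src i j
abbrev tgt (i j : 𝔸.Idx) : 𝔸.arr i j ⟶ 𝔸.obj j := 𝔸.str.tgt i j
abbrev one (i : 𝔸.Idx) : 𝔸.obj i ⟶ 𝔸.arr i i := 𝔸.str.one i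
noncomputable abbrev mul (i j k : 𝔸.Idx) :
    pullback (𝔸.src j k) (𝔸.tgt i j) ⟶ 𝔸.arr i k := 𝔸.str.mul i j k

/-- The partite internal category admits inverses, i.e., is a partite internal groupoid. -/
def IsGroupoid : Prop :=
  ∃ (ι : ∀ i j, 𝔸.arr i j ⟶ 𝔸.arr j i)
    (_ : ∀ i j, IsTotal (ι i j))
    (_ : ∀ i j, ι i j ≫ ι j i = 𝟙 (𝔸.arr i j))
    (hsrc : ∀ i j, ι i j ≫ 𝔸.src j i = 𝔸.tgt i j),
    ∀ i j, pullback.lift (f := 𝔸.src j i) (g := 𝔸.tgt i j) (ι i j) (𝟙 (𝔸.arr i j))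
      (by rw [hsrc, Category.id_comp]) ≫ 𝔸.mul i j i = 𝔸.src i j ≫ 𝔸.one i

/-- Source-étale partite internal categories. -/
def IsSourceEtale : Prop := ∀ i j, IsLocalHomeo (𝔸.src i j)

end PartiteCat

/-- Partite cofunctors.  In `arr_mul`, the fibre product `A_jk ×_{A_j} A_ij ×_{A_i} B_Fi` is
`pullback (src j k) (pullback.fst _ _ ≫ tgt i j)`. -/
structure Cofunctor (𝔸 𝔹 : PartiteCat.{w} C) where
  idx : 𝔸.Idx → 𝔹.Idx
  obj : ∀ i, 𝔹.obj (idx i) ⟶ 𝔸.obj i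
  [obj_total : ∀ i, IsTotal (obj i)]
  arr : ∀ i j, pullback (𝔸.src i j) (obj i) ⟶ 𝔹.arr (idx i) (idx j)
  arr_total : ∀ i j, IsTotal (arr i j)
  arr_src : ∀ i j, arr i j ≫ 𝔹.src (idx i) (idx j) = pullback.snd _ _
  arr_tgt : ∀ i j,
    arr i j ≫ 𝔹.tgt (idx i) (idx j) ≫ obj j = pullback.fst _ _ ≫ 𝔸.tgt i j
  arr_one : ∀ i,
    pullback.lift (f := 𝔸.src i i) (g := obj i) (obj i ≫ 𝔸.one i) (𝟙 (𝔹.obj (idx i)))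
      (by rw [Category.assoc, 𝔸.str.one_src, Category.comp_id, Category.id_comp]) ≫ arr i i =
    𝔹.one (idx i)
  arr_mul : ∀ i j k,
    pullback.lift (f := 𝔸.src i k) (g := obj i)
      (pullback.lift (f := 𝔸.src j k) (g := 𝔸.tgt i j)
        (pullback.fst (𝔸.src j k) (pullback.fst (𝔸.src i j) (obj i) ≫ 𝔸.tgt i j))
        (pullback.snd _ _ ≫ pullback.fst _ _)
        (by rw [Category.assoc, pullback.condition]) ≫ 𝔸.mul i j k)
      (pullback.snd _ _ ≫ pullback.snd _ _)
      (by rw [Category.assoc, 𝔸.str.mul_src, pullback.lift_snd_assoc, Category.assoc,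
            pullback.condition, Category.assoc]) ≫ arr i k =
    pullback.lift (f := 𝔹.src (idx j) (idx k)) (g := 𝔹.tgt (idx i) (idx j))
      (pullback.lift (f := 𝔸.src j k) (g := obj j)
        (pullback.fst (𝔸.src j k) (pullback.fst (𝔸.src i j) (obj i) ≫ 𝔸.tgt i j))
        (pullback.snd _ _ ≫ arr i j ≫ 𝔹.tgt (idx i) (idx j))
        (by rw [Category.assoc, Category.assoc, arr_tgt, pullback.condition]) ≫ arr j k)
      (pullback.snd _ _ ≫ arr i j)
      (by rw [Category.assoc, arr_src, pullback.lift_snd, Category.assoc]) ≫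
        𝔹.mul (idx i) (idx j) (idx k)

attribute [instance] Cofunctor.obj_total Cofunctor.arr_total

namespace Cofunctor

variable {𝔸 𝔹 𝔻 : PartiteCat.{w} C}

section

variable (F : Cofunctor 𝔸 𝔹) {i j k : 𝔸.Idx} {T : C}

/-- The action of a cofunctor on generalised elements. -/
noncomputable def act (x : T ⟶ 𝔸.arr i j) (b : T ⟶ 𝔹.obj (F.idx i))
    (h : x ≫ 𝔸.src i j = b ≫ F.obj i) : T ⟶ 𝔹.arr (F.idx i) (F.idx j) :=
  pullback.lift x b h ≫ F.arr i j

theorem comp_act {S : C} (r : S ⟶ T) (x : T ⟶ 𝔸.arr i j) (b : T ⟶ 𝔹.obj (F.idx i))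
    (h : x ≫ 𝔸.src i j = b ≫ F.obj i) :
    r ≫ F.act x b h = F.act (r ≫ x) (r ≫ b) (by rw [Category.assoc, h, Category.assoc]) := by
  unfold act
  refine (Category.assoc _ _ _).symm.trans ?_
  congr 1
  apply pullback.hom_ext <;> simp

theorem act_congr {x x' : T ⟶ 𝔸.arr i j} {b b' : T ⟶ 𝔹.obj (F.idx i)}
    (h : x ≫ 𝔸.src i j = b ≫ F.obj i) (hx : x = x') (hb : b = b') :
    F.act x b h = F.act x' b' (by rw [← hx, ← hb, h]) := by
  subst hx hb; rfl

theorem act_src (x : T ⟶ 𝔸.arr i j) (b : T ⟶ 𝔹.obj (F.idx i))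
    (h : x ≫ 𝔸.src i j = b ≫ F.obj i) : F.act x b h ≫ 𝔹.src _ _ = b := by
  unfold act
  rw [Category.assoc, F.arr_src, pullback.lift_snd]

theorem act_tgt (x : T ⟶ 𝔸.arr i j) (b : T ⟶ 𝔹.obj (F.idx i))
    (h : x ≫ 𝔸.src i j = b ≫ F.obj i) :
    F.act x b h ≫ 𝔹.tgt _ _ ≫ F.obj j = x ≫ 𝔸.tgt i j := by
  unfold act
  rw [Category.assoc, F.arr_tgt, pullback.lift_fst_assoc]

theorem act_one (b : T ⟶ 𝔹.obj (F.idx i)) :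
    F.act (b ≫ F.obj i ≫ 𝔸.one i) b (by simp [𝔸.str.one_src]) = b ≫ 𝔹.one (F.idx i) := by
  rw [← F.arr_one]
  unfold act
  refine Eq.trans ?_ (Category.assoc _ _ _)
  congr 1
  apply pullback.hom_ext <;> simp

theorem act_cmp (y : T ⟶ 𝔸.arr j k) (x : T ⟶ 𝔸.arr i j) (b : T ⟶ 𝔹.obj (F.idx i))
    (h : y ≫ 𝔸.src j k = x ≫ 𝔸.tgt i j) (h' : x ≫ 𝔸.src i j = b ≫ F.obj i) :
    F.act (𝔸.str.cmp y x h) b (by rw [𝔸.str.cmp_src, h']) =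
      𝔹.str.cmp (F.act y (F.act x b h' ≫ 𝔹.tgt _ _)
        (by rw [Category.assoc, act_tgt, h])) (F.act x b h') (by rw [act_src]) := by
  have h2 := congrArg (fun t => pullback.lift (f := 𝔸.src j k)
    (g := pullback.fst (𝔸.src i j) (F.obj i) ≫ 𝔸.tgt i j) y (pullback.lift x b h')
      (by rw [pullback.lift_fst_assoc, h]) ≫ t) (F.arr_mul i j k)
  refine Eq.trans ?_ (h2.trans ?_)
  · unfold act PartiteCatOn.cmp
    refine Eq.trans ?_ (Category.assoc _ _ _)
    congr 1
    apply pullback.hom_ext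
    · simp only [Category.assoc, pullback.lift_fst]
      refine Eq.trans ?_ (Category.assoc _ _ _)
      congr 1
      apply pullback.hom_ext <;> simp
    · simp
  · unfold act PartiteCatOn.cmp
    refine Eq.trans (Category.assoc _ _ _).symm ?_
    congr 1
    apply pullback.hom_ext
    · simp only [Category.assoc, pullback.lift_fst]
      refine Eq.trans (Category.assoc _ _ _).symm ?_
      congr 1
      apply pullback.hom_ext <;> simp
    · simp

end

theorem ext_aux {idx : 𝔸.Idx → 𝔹.Idx} {o o' : ∀ i, 𝔹.obj (idx i) ⟶ 𝔸.obj i}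
    {t : ∀ i, IsTotal (o i)} {t' : ∀ i, IsTotal (o' i)}
    {a : ∀ i j, pullback (𝔸.src i j) (o i) ⟶ 𝔹.arr (idx i) (idx j)}
    {a' : ∀ i j, pullback (𝔸.src i j) (o' i) ⟶ 𝔹.arr (idx i) (idx j)}
    {p₁ p₂ p₃ p₄ p₅ q₁ q₂ q₃ q₄ q₅}
    (ho : ∀ i, o i = o' i)
    (ha : ∀ i j (T : C) (x : T ⟶ 𝔸.arr i j) (b : T ⟶ 𝔹.obj (idx i))
      (e : x ≫ 𝔸.src i j = b ≫ o i) (e' : x ≫ 𝔸.src i j = b ≫ o' i),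
      pullback.lift x b e ≫ a i j = pullback.lift x b e' ≫ a' i j) :
    (Cofunctor.mk idx o (obj_total := t) a p₁ p₂ p₃ p₄ p₅ : Cofunctor 𝔸 𝔹) =
      Cofunctor.mk idx o' (obj_total := t') a' q₁ q₂ q₃ q₄ q₅ := by
  have ho : o = o' := by
    funext i
    exact ho i
  subst ho
  have ha : a = a' := by
    funext i j
    have := ha i j _ (pullback.fst _ _) (pullback.snd _ _) pullback.condition pullback.condition
    have hid : pullback.lift (pullback.fst (𝔸.src i j) (o i)) (pullback.snd _ _)
      pullback.condition = 𝟙 _ := by apply pullback.hom_ext <;> simp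
    rw [hid, Category.id_comp, Category.id_comp] at this
    exact this
  subst ha
  rfl

variable (𝔸) in
/-- The identity cofunctor. -/
noncomputable def id : Cofunctor 𝔸 𝔸 where
  idx i := i
  obj i := 𝟙 (𝔸.obj i)
  arr i j := pullback.fst (𝔸.src i j) (𝟙 (𝔸.obj i))
  arr_total i j := inferInstance
  arr_src i j := by rw [pullback.condition, Category.comp_id]
  arr_tgt i j := by rw [Category.comp_id]
  arr_one i := by rw [pullback.lift_fst, Category.id_comp]
  arr_mul i j k := by
    rw [pullback.lift_fst]
    congr 1
    apply pullback.hom_ext <;> simp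

theorem id_act {i j : 𝔸.Idx} {T : C} (x : T ⟶ 𝔸.arr i j) (b : T ⟶ 𝔸.obj i)
    (h : x ≫ 𝔸.src i j = b ≫ 𝟙 (𝔸.obj i)) : (id 𝔸).act (i := i) (j := j) x b h = x := by
  unfold act
  exact pullback.lift_fst (f := 𝔸.src i j) (g := 𝟙 (𝔸.obj i)) x b h

/-- The arrow part `A_ij ×_{A_i} D_GFi ≅ (A_ij ×_{A_i} B_Fi) ×_{B_Fi} D_GFi ⟶
B_{Fi,Fj} ×_{B_Fi} D_GFi ⟶ D_{GFi,GFj}` of a composite cofunctor. -/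
noncomputable def compArr (F : Cofunctor 𝔸 𝔹) (G : Cofunctor 𝔹 𝔻) (i j : 𝔸.Idx) :
    pullback (𝔸.src i j) (G.obj (F.idx i) ≫ F.obj i) ⟶
      𝔻.arr (G.idx (F.idx i)) (G.idx (F.idx j)) :=
  G.act (F.act (pullback.fst (𝔸.src i j) (G.obj (F.idx i) ≫ F.obj i))
      (pullback.snd _ _ ≫ G.obj (F.idx i)) (by rw [pullback.condition, Category.assoc]))
    (pullback.snd _ _) (by rw [act_src])

theorem lift_compArr (F : Cofunctor 𝔸 𝔹) (G : Cofunctor 𝔹 𝔻) {i j : 𝔸.Idx} {T : C}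
    (x : T ⟶ 𝔸.arr i j) (c : T ⟶ 𝔻.obj (G.idx (F.idx i)))
    (h : x ≫ 𝔸.src i j = c ≫ G.obj (F.idx i) ≫ F.obj i) :
    pullback.lift x c h ≫ compArr F G i j =
      G.act (F.act x (c ≫ G.obj (F.idx i)) (by rw [h, Category.assoc])) c
        (by rw [act_src]) := by
  unfold compArr
  rw [comp_act]
  apply act_congr
  · rw [comp_act]
    apply act_congr <;> simp
  · simp

theorem compArr_src (F : Cofunctor 𝔸 𝔹) (G : Cofunctor 𝔹 𝔻) (i j : 𝔸.Idx) :
    compArr F G i j ≫ 𝔻.src _ _ = pullback.snd _ _ := by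
  unfold compArr; rw [act_src]

theorem compArr_tgt (F : Cofunctor 𝔸 𝔹) (G : Cofunctor 𝔹 𝔻) (i j : 𝔸.Idx) :
    compArr F G i j ≫ 𝔻.tgt _ _ ≫ G.obj (F.idx j) ≫ F.obj j = pullback.fst _ _ ≫ 𝔸.tgt i j := by
  unfold compArr
  rw [← Category.assoc (𝔻.tgt _ _), ← Category.assoc, Category.assoc, ← Category.assoc,
    ← Category.assoc, Category.assoc _ _ (G.obj _), act_tgt, Category.assoc, act_tgt]

theorem comp_mul_aux (F : Cofunctor 𝔸 𝔹) (G : Cofunctor 𝔹 𝔻) {i j k : 𝔸.Idx} {T : C}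
    (y : T ⟶ 𝔸.arr j k) (x : T ⟶ 𝔸.arr i j) (c : T ⟶ 𝔻.obj (G.idx (F.idx i)))
    (h : y ≫ 𝔸.src j k = x ≫ 𝔸.tgt i j)
    (h' : x ≫ 𝔸.src i j = c ≫ G.obj (F.idx i) ≫ F.obj i)
    (d : T ⟶ 𝔻.arr (G.idx (F.idx i)) (G.idx (F.idx j)))
    (hd : d = pullback.lift x c h' ≫ compArr F G i j)
    (e₁ : 𝔸.str.cmp y x h ≫ 𝔸.src i k = c ≫ G.obj (F.idx i) ≫ F.obj i)
    (e₂ : y ≫ 𝔸.src j k = (d ≫ 𝔻.tgt _ _) ≫ G.obj (F.idx j) ≫ F.obj j)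
    (e₃ : (pullback.lift y (d ≫ 𝔻.tgt _ _) e₂ ≫ compArr F G j k) ≫ 𝔻.src _ _ =
      d ≫ 𝔻.tgt _ _) :
    pullback.lift (𝔸.str.cmp y x h) c e₁ ≫ compArr F G i k =
      𝔻.str.cmp (pullback.lift y (d ≫ 𝔻.tgt _ _) e₂ ≫ compArr F G j k) d e₃ := by
  rw [lift_compArr] at hd
  subst hd
  rw [lift_compArr]
  have hb : x ≫ 𝔸.src i j = (c ≫ G.obj (F.idx i)) ≫ F.obj i := by rw [h', Category.assoc]
  have h1 := F.act_cmp y x (c ≫ G.obj (F.idx i)) h hb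
  refine (G.act_congr _ h1 rfl).trans ?_
  rw [G.act_cmp _ _ c _ (by rw [act_src])]
  apply PartiteCatOn.cmp_congr
  · rw [lift_compArr]
    apply act_congr
    · apply act_congr
      · rfl
      · rw [Category.assoc, act_tgt]
    · rfl
  · rfl

/-- Composition of cofunctors. -/
noncomputable def comp (F : Cofunctor 𝔸 𝔹) (G : Cofunctor 𝔹 𝔻) : Cofunctor 𝔸 𝔻 where
  idx i := G.idx (F.idx i)
  obj i := G.obj (F.idx i) ≫ F.obj i
  arr i j := compArr F G i j
  arr_total i j := IsTotal.of_comp _ (𝔻.src _ _) (by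
    unfold compArr; rw [act_src]; infer_instance)
  arr_src i j := compArr_src F G i j
  arr_tgt i j := compArr_tgt F G i j
  arr_one i := by
    rw [lift_compArr]
    have h1 := G.act_one (i := F.idx i) (𝟙 _)
    rw [Category.id_comp (𝔻.one _)] at h1
    refine Eq.trans ?_ h1
    apply act_congr
    · have h2 := F.act_one (i := i) (G.obj (F.idx i))
      refine Eq.trans ?_ (h2.trans (Category.id_comp _).symm)
      apply act_congr <;> simp
    · rfl
  arr_mul i j k := by
    refine (comp_mul_aux F G (pullback.fst _ _) (pullback.snd _ _ ≫ pullback.fst _ _)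
      (pullback.snd _ _ ≫ pullback.snd _ _) ?_ ?_ (pullback.snd _ _ ≫ compArr F G i j)
      ?_ ?_ ?_ ?_).trans ?_
    · rw [Category.assoc, pullback.condition, ← Category.assoc]
    · congr 1
      apply pullback.hom_ext <;> simp
    · rw [Category.assoc, Category.assoc, compArr_tgt, pullback.condition]
    · rw [Category.assoc, compArr_src, pullback.lift_snd]
    · apply PartiteCatOn.cmp_congr
      · simp only [Category.assoc]
      · rfl

@[simp] theorem comp_idx (F : Cofunctor 𝔸 𝔹) (G : Cofunctor 𝔹 𝔻) (i : 𝔸.Idx) :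
    (comp F G).idx i = G.idx (F.idx i) := rfl

theorem comp_act_apply (F : Cofunctor 𝔸 𝔹) (G : Cofunctor 𝔹 𝔻) {i j : 𝔸.Idx} {T : C}
    (x : T ⟶ 𝔸.arr i j) (c : T ⟶ 𝔻.obj (G.idx (F.idx i)))
    (h : x ≫ 𝔸.src i j = c ≫ G.obj (F.idx i) ≫ F.obj i) :
    (comp F G).act x c h =
      G.act (F.act x (c ≫ G.obj (F.idx i)) (by rw [h, Category.assoc])) c
        (by rw [act_src]) :=
  lift_compArr F G x c h

end Cofunctor

noncomputable instance : Category (PartiteCat.{w} C) where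
  Hom := Cofunctor
  id := Cofunctor.id
  comp := Cofunctor.comp
  id_comp {𝔸 𝔹} F := by
    refine Cofunctor.ext_aux (fun i => ?_) (fun i j T x b e e' => ?_)
    · exact Category.comp_id _
    · refine (Cofunctor.lift_compArr _ _ _ _ _).trans ?_
      apply Cofunctor.act_congr
      · exact Cofunctor.id_act _ _ _
      · rfl
  comp_id {𝔸 𝔹} F := by
    refine Cofunctor.ext_aux (fun i => ?_) (fun i j T x b e e' => ?_)
    · exact Category.id_comp _
    · refine (Cofunctor.lift_compArr _ _ _ _ _).trans ?_
      refine (Cofunctor.id_act _ _ _).trans ?_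
      apply Cofunctor.act_congr
      · rfl
      · exact Category.comp_id _
  assoc {𝔸 𝔹 𝔻 𝔼} F G H := by
    refine Cofunctor.ext_aux (fun i => ?_) (fun i j T x b e e' => ?_)
    · exact (Category.assoc _ _ _).symm
    · refine (Cofunctor.lift_compArr _ _ _ _ _).trans ?_
      refine Eq.trans ?_ (Cofunctor.lift_compArr F (Cofunctor.comp G H) x b e').symm
      refine Eq.trans ?_ (Cofunctor.comp_act_apply G H _ _ _).symm
      apply Cofunctor.act_congr
      · refine (Cofunctor.comp_act_apply _ _ _ _ _).trans ?_
        apply Cofunctor.act_congr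
        · apply Cofunctor.act_congr
          · rfl
          · exact Category.assoc _ _ _
        · rfl
      · rfl

/-! ### Restriction categories over `C` -/

variable (C) in
/-- A restriction category with a restriction functor to `C`. -/
structure RCatOver where
  carrier : Type w
  [cat : Category.{v} carrier]
  [restr : RestrictionCategory carrier]
  proj : carrier ⥤ C
  isRestriction : IsRestrictionFunctor proj

attribute [instance] RCatOver.cat RCatOver.restr

/-- Lax-commutative triangles: a restriction functor `F : P ⟶ Q` together with a natural
transformation `Q ∘ F ⟶ P` with total components. -/
structure RCatOver.Hom (P Q : RCatOver.{w} C) where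
  functor : P.carrier ⥤ Q.carrier
  isRestriction : IsRestrictionFunctor functor
  trans : functor ⋙ Q.proj ⟶ P.proj
  total : ∀ x, IsTotal (trans.app x)

theorem RCatOver.Hom.ext_aux {P Q : RCatOver.{w} C} {F : P.carrier ⥤ Q.carrier} {h h'}
    {t t' : F ⋙ Q.proj ⟶ P.proj} {p p'} (e : ∀ x, t.app x = t'.app x) :
    (RCatOver.Hom.mk F h t p : RCatOver.Hom P Q) = RCatOver.Hom.mk F h' t' p' := by
  have : t = t' := by
    apply NatTrans.ext
    funext x
    exact e x
  subst this
  rfl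

instance : Category (RCatOver.{w} C) where
  Hom := RCatOver.Hom
  id P :=
    { functor := 𝟭 _
      isRestriction := fun _ => rfl
      trans := { app := fun x => 𝟙 (P.proj.obj x) }
      total := fun x => ⟨rest_id _⟩ }
  comp {P Q R} F G :=
    { functor := F.functor ⋙ G.functor
      isRestriction := fun f => by
        rw [Functor.comp_map, F.isRestriction, G.isRestriction, Functor.comp_map]
      trans :=
        { app := fun x => G.trans.app (F.functor.obj x) ≫ F.trans.app x
          naturality := fun x y f => by
            have h1 := G.trans.naturality (F.functor.map f)
            have h2 := F.trans.naturality f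
            simp only [Functor.comp_map] at h1 h2 ⊢
            rw [← Category.assoc, h1, Category.assoc, h2, Category.assoc] }
      total := fun x =>
        haveI := G.total (F.functor.obj x)
        haveI := F.total x
        (inferInstance : IsTotal (G.trans.app (F.functor.obj x) ≫ F.trans.app x)) }
  id_comp F := RCatOver.Hom.ext_aux (fun _ => Category.comp_id _)
  comp_id F := RCatOver.Hom.ext_aux (fun _ => Category.id_comp _)
  assoc F G H := RCatOver.Hom.ext_aux (fun _ => (Category.assoc _ _ _).symm)

/-! ### Externalisation -/

/-- The pullback of a partial section `s` of `q` along `f`, as a map into the pullback. -/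
noncomputable def pullbackSection {E X Y : C} (q : E ⟶ X) (f : Y ⟶ X) [HasPullback q f]
    (s : X ⟶ E) (hs : IsPartialSection q s) : Y ⟶ pullback q f :=
  pullback.lift (f ≫ s) (rest (f ≫ s)) (by rw [Category.assoc, hs, comp_rest])

theorem IsPartialSection.comp_total {E E' X : C} {q : E ⟶ X} {q' : E' ⟶ X} {s : X ⟶ E}
    (hs : IsPartialSection q s) (f : E ⟶ E') [IsTotal f] (hf : f ≫ q' = q) :
    IsPartialSection q' (s ≫ f) := by
  unfold IsPartialSection
  rw [Category.assoc, hf, hs, rest_comp_total]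

theorem PartiteCatOn.rest_cmp {I : Type w} {A : I → C} (𝔸 : PartiteCatOn A) {i j k : I} {T : C}
    (y : T ⟶ 𝔸.arr j k) (x : T ⟶ 𝔸.arr i j) (h : y ≫ 𝔸.src j k = x ≫ 𝔸.tgt i j) :
    rest (𝔸.cmp y x h) = rest y := by
  unfold cmp
  rw [rest_comp_total, ← rest_comp_total _ (pullback.fst (𝔸.src j k) (𝔸.tgt i j)),
    pullback.lift_fst]

namespace PartiteCatOn

variable {I : Type w} {A : I → C} (𝔸 : PartiteCatOn A)

/-- The composite `t ∗ s` of partial sections of the source maps. -/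
noncomputable def secComp {i j k : I} (s : A i ⟶ 𝔸.arr i j) (t : A j ⟶ 𝔸.arr j k)
    (ht : IsPartialSection (𝔸.src j k) t) : A i ⟶ 𝔸.arr i k :=
  s ≫ pullbackSection (𝔸.src j k) (𝔸.tgt i j) t ht ≫ 𝔸.mul i j k

theorem secComp_cond {i j k : I} (s : A i ⟶ 𝔸.arr i j) (t : A j ⟶ 𝔸.arr j k)
    (ht : IsPartialSection (𝔸.src j k) t) :
    (s ≫ 𝔸.tgt i j ≫ t) ≫ 𝔸.src j k = (rest (s ≫ 𝔸.tgt i j ≫ t) ≫ s) ≫ 𝔸.tgt i j := by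
  rw [Category.assoc, Category.assoc, ht, ← Category.assoc s, comp_rest, Category.assoc,
    Category.assoc]

theorem secComp_eq {i j k : I} (s : A i ⟶ 𝔸.arr i j) (t : A j ⟶ 𝔸.arr j k)
    (ht : IsPartialSection (𝔸.src j k) t) :
    𝔸.secComp s t ht =
      𝔸.cmp (s ≫ 𝔸.tgt i j ≫ t) (rest (s ≫ 𝔸.tgt i j ≫ t) ≫ s) (𝔸.secComp_cond s t ht) := by
  unfold secComp cmp pullbackSection
  refine (Category.assoc _ _ _).symm.trans ?_
  congr 1
  apply pullback.hom_ext
  · rw [Category.assoc, pullback.lift_fst, pullback.lift_fst]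
  · rw [Category.assoc, pullback.lift_snd, pullback.lift_snd, comp_rest]

theorem rest_secComp {i j k : I} (s : A i ⟶ 𝔸.arr i j) (t : A j ⟶ 𝔸.arr j k)
    (ht : IsPartialSection (𝔸.src j k) t) :
    rest (𝔸.secComp s t ht) = rest (s ≫ 𝔸.tgt i j ≫ t) := by
  rw [secComp_eq, rest_cmp]

theorem isPartialSection_secComp {i j k : I} (s : A i ⟶ 𝔸.arr i j) (t : A j ⟶ 𝔸.arr j k)
    (hs : IsPartialSection (𝔸.src i j) s) (ht : IsPartialSection (𝔸.src j k) t) :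
    IsPartialSection (𝔸.src i k) (𝔸.secComp s t ht) := by
  unfold IsPartialSection
  rw [rest_secComp, secComp_eq, cmp_src, Category.assoc, hs, rest_comm, rest_comp_le]

theorem secComp_tgt {i j k : I} (s : A i ⟶ 𝔸.arr i j) (t : A j ⟶ 𝔸.arr j k)
    (ht : IsPartialSection (𝔸.src j k) t) :
    𝔸.secComp s t ht ≫ 𝔸.tgt i k = s ≫ 𝔸.tgt i j ≫ t ≫ 𝔸.tgt j k := by
  rw [secComp_eq, cmp_tgt, Category.assoc, Category.assoc]

theorem isPartialSection_one (i : I) : IsPartialSection (𝔸.src i i) (𝔸.one i) := by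
  unfold IsPartialSection
  rw [𝔸.one_src, IsTotal.rest_eq]

theorem rest_one_tgt {i : I} {X : C} (d : A i ⟶ X) :
    (rest (rest d ≫ 𝔸.one i) ≫ 𝔸.one i) ≫ 𝔸.tgt i i = rest d := by
  rw [Category.assoc, 𝔸.one_tgt, Category.comp_id, rest_comp_total, rest_rest]

theorem isPartialSection_rest_one {i : I} {X : C} (f : A i ⟶ X) :
    IsPartialSection (𝔸.src i i) (rest f ≫ 𝔸.one i) := by
  unfold IsPartialSection
  rw [Category.assoc, 𝔸.one_src, rest_comp_total, rest_rest, Category.comp_id]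

theorem rest_one_secComp {i j : I} {X : C} (f : A i ⟶ X) (t : A i ⟶ 𝔸.arr i j)
    (ht : IsPartialSection (𝔸.src i j) t) :
    𝔸.secComp (rest f ≫ 𝔸.one i) t ht = rest f ≫ t := by
  have e : (rest f ≫ 𝔸.one i) ≫ 𝔸.tgt i i ≫ t = rest f ≫ t := by
    rw [Category.assoc, ← Category.assoc (𝔸.one i), 𝔸.one_tgt, Category.id_comp]
  rw [secComp_eq]
  refine Eq.trans ?_ (𝔸.cmp_one (rest f ≫ t))
  apply cmp_congr
  · exact e
  · rw [e, Category.assoc, ← Category.assoc t, ht, ← Category.assoc, ← Category.assoc]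
    congr 1
    rw [rest_rest_comp, Category.assoc, rest_comm t f, ← Category.assoc, rest_idem]

theorem secComp_one {i j : I} (s : A i ⟶ 𝔸.arr i j) :
    𝔸.secComp s (𝔸.one j) (𝔸.isPartialSection_one j) = s := by
  rw [secComp_eq]
  refine Eq.trans ?_ (𝔸.one_cmp s)
  apply cmp_congr
  · rfl
  · rw [rest_comp_total, rest_self]

theorem secComp_rest_one {i j : I} {X : C} (s : A i ⟶ 𝔸.arr i j) (f : A j ⟶ X) :
    𝔸.secComp s (rest f ≫ 𝔸.one j) (𝔸.isPartialSection_rest_one f) =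
      rest (s ≫ 𝔸.tgt i j ≫ f) ≫ s := by
  have h1 : s ≫ 𝔸.tgt i j ≫ rest f ≫ 𝔸.one j =
      (rest (s ≫ 𝔸.tgt i j ≫ f) ≫ s) ≫ 𝔸.tgt i j ≫ 𝔸.one j := by
    rw [← Category.assoc, ← Category.assoc, comp_rest]
    simp only [Category.assoc]
  rw [secComp_eq]
  refine Eq.trans ?_ (𝔸.one_cmp (rest (s ≫ 𝔸.tgt i j ≫ f) ≫ s))
  apply cmp_congr
  · exact h1
  · rw [h1, rest_comp_total, rest_rest_comp, Category.assoc, rest_self]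

theorem secComp_assoc {i j k l : I} (s : A i ⟶ 𝔸.arr i j) (t : A j ⟶ 𝔸.arr j k)
    (r : A k ⟶ 𝔸.arr k l) (ht : IsPartialSection (𝔸.src j k) t)
    (hr : IsPartialSection (𝔸.src k l) r) :
    𝔸.secComp (𝔸.secComp s t ht) r hr =
      𝔸.secComp s (𝔸.secComp t r hr) (𝔸.isPartialSection_secComp t r ht hr) := by
  have e : 𝔸.secComp s t ht ≫ 𝔸.tgt i k ≫ r = s ≫ 𝔸.tgt i j ≫ t ≫ 𝔸.tgt j k ≫ r := by
    rw [← Category.assoc, secComp_tgt]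
    simp only [Category.assoc]
  have e' : rest (s ≫ 𝔸.tgt i j ≫ 𝔸.secComp t r hr) =
      rest (s ≫ 𝔸.tgt i j ≫ t ≫ 𝔸.tgt j k ≫ r) := by
    rw [← Category.assoc, ← rest_comp_rest, rest_secComp, rest_comp_rest, Category.assoc]
  have e'' : rest (s ≫ 𝔸.tgt i j ≫ t ≫ 𝔸.tgt j k ≫ r) ≫ rest (s ≫ 𝔸.tgt i j ≫ t) =
      rest (s ≫ 𝔸.tgt i j ≫ t ≫ 𝔸.tgt j k ≫ r) := by
    rw [rest_comm]
    simpa only [Category.assoc] using rest_comp_le (s ≫ 𝔸.tgt i j ≫ t) (𝔸.tgt j k ≫ r)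
  have ht' := 𝔸.secComp_cond s t ht
  have hr' := 𝔸.secComp_cond t r hr
  set ρ := rest (s ≫ 𝔸.tgt i j ≫ t ≫ 𝔸.tgt j k ≫ r) with hρ
  have c1 : (ρ ≫ s ≫ 𝔸.tgt i j ≫ t) ≫ 𝔸.src j k = (ρ ≫ s) ≫ 𝔸.tgt i j := by
    rw [Category.assoc, ht', ← Category.assoc, ← Category.assoc, e'', Category.assoc]
  have c2 : (s ≫ 𝔸.tgt i j ≫ t ≫ 𝔸.tgt j k ≫ r) ≫ 𝔸.src k l =
      (ρ ≫ s ≫ 𝔸.tgt i j ≫ t) ≫ 𝔸.tgt j k := by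
    have := congrArg (fun z => s ≫ 𝔸.tgt i j ≫ z) hr'
    simp only [Category.assoc] at this ⊢
    rw [this, ← Category.assoc, ← Category.assoc, comp_rest]
    simp only [Category.assoc]
    rfl
  have main := 𝔸.cmp_assoc (s ≫ 𝔸.tgt i j ≫ t ≫ 𝔸.tgt j k ≫ r) (ρ ≫ s ≫ 𝔸.tgt i j ≫ t)
    (ρ ≫ s) c1 c2
  rw [secComp_eq, secComp_eq (s := s) (t := 𝔸.secComp t r hr)]
  refine Eq.trans ?_ (main.trans ?_)
  · apply cmp_congr
    · exact e
    · rw [e, secComp_eq, comp_cmp]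
      apply cmp_congr
      · rfl
      · rw [← Category.assoc, e'']
  · apply cmp_congr
    · rw [secComp_eq, comp_cmp, comp_cmp]
      apply cmp_congr
      · rfl
      · have := comp_rest (s ≫ 𝔸.tgt i j) (t ≫ 𝔸.tgt j k ≫ r)
        have := congrArg (fun z => z ≫ t) this
        simp only [Category.assoc] at this
        exact this.symm
    · rw [e']

end PartiteCatOn

/-- The objects of the externalisation `Φ𝔸` are the components of `𝔸`. -/
structure PhiObj (𝔸 : PartiteCat.{w} C) : Type w where
  idx : 𝔸.Idx

/-- The category `Φ𝔸`: maps `i ⟶ j` are partial sections of `σ_ij`. -/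
noncomputable instance (𝔸 : PartiteCat.{w} C) : Category.{v} (PhiObj 𝔸) where
  Hom i j := { s : 𝔸.obj i.idx ⟶ 𝔸.arr i.idx j.idx // IsPartialSection (𝔸.src i.idx j.idx) s }
  id i := ⟨𝔸.one i.idx, 𝔸.str.isPartialSection_one i.idx⟩
  comp s t := ⟨𝔸.str.secComp s.1 t.1 t.2, 𝔸.str.isPartialSection_secComp s.1 t.1 s.2 t.2⟩
  id_comp {i j} t := Subtype.ext (by
    have := 𝔸.str.rest_one_secComp (𝟙 (𝔸.obj i.idx)) t.1 t.2
    simpa only [rest_id, Category.id_comp] using this)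
  comp_id s := Subtype.ext (𝔸.str.secComp_one s.1)
  assoc s t r := Subtype.ext (𝔸.str.secComp_assoc s.1 t.1 r.1 t.2 r.2)

noncomputable instance (𝔸 : PartiteCat.{w} C) : RestrictionCategory (PhiObj 𝔸) where
  rest {i _} s := ⟨rest s.1 ≫ 𝔸.one i.idx, 𝔸.str.isPartialSection_rest_one s.1⟩
  rest_comp_self f := Subtype.ext
    ((𝔸.str.rest_one_secComp f.1 f.1 f.2).trans (rest_self _))
  rest_comm {i j k} f g := Subtype.ext (by
    refine (𝔸.str.rest_one_secComp f.1 (rest g.1 ≫ 𝔸.one i.idx) _).trans ?_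
    refine Eq.trans ?_ (𝔸.str.rest_one_secComp g.1 (rest f.1 ≫ 𝔸.one i.idx) _).symm
    rw [← Category.assoc, rest_comm, Category.assoc])
  rest_rest_comp {i j k} f g := Subtype.ext (by
    refine Eq.trans ?_ (𝔸.str.rest_one_secComp f.1 (rest g.1 ≫ 𝔸.one i.idx) _).symm
    have h := 𝔸.str.rest_one_secComp f.1 g.1 g.2
    refine (congrArg (fun z => rest z ≫ 𝔸.one i.idx) h).trans ?_
    rw [← Category.assoc, ← rest_rest_comp])
  comp_rest {i j k} f g := Subtype.ext (by
    refine (𝔸.str.secComp_rest_one f.1 g.1).trans ?_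
    refine Eq.trans ?_ (𝔸.str.rest_one_secComp (𝔸.str.secComp f.1 g.1 g.2) f.1 f.2).symm
    rw [𝔸.str.rest_secComp])

/-- The projection `π_𝔸 : Φ𝔸 ⥤ C`. -/
noncomputable def phiProj (𝔸 : PartiteCat.{w} C) : PhiObj 𝔸 ⥤ C where
  obj i := 𝔸.obj i.idx
  map {i j} s := s.1 ≫ 𝔸.tgt i.idx j.idx
  map_id i := 𝔸.str.one_tgt i.idx
  map_comp {i j k} s t := by
    refine (𝔸.str.secComp_tgt s.1 t.1 t.2).trans ?_
    simp only [Category.assoc]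

theorem phi_comp_val {𝔸 : PartiteCat.{w} C} {i j k : PhiObj 𝔸} (s : i ⟶ j) (t : j ⟶ k) :
    (s ≫ t).1 = 𝔸.str.secComp s.1 t.1 t.2 := rfl

theorem phi_id_val {𝔸 : PartiteCat.{w} C} (i : PhiObj 𝔸) :
    (𝟙 i : i ⟶ i).1 = 𝔸.one i.idx := rfl

theorem phi_rest_val {𝔸 : PartiteCat.{w} C} {i j : PhiObj 𝔸} (s : i ⟶ j) :
    (rest s).1 = rest s.1 ≫ 𝔸.one i.idx := rfl

theorem phi_rest_comp_val {𝔸 : PartiteCat.{w} C} {i j k : PhiObj 𝔸} (s : i ⟶ j) (t : i ⟶ k) :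
    (rest s ≫ t).1 = rest s.1 ≫ t.1 :=
  𝔸.str.rest_one_secComp s.1 t.1 t.2

theorem phi_rle_iff {𝔸 : PartiteCat.{w} C} {i j : PhiObj 𝔸} (s t : i ⟶ j) :
    RLe s t ↔ RLe s.1 t.1 := by
  unfold RLe
  rw [← phi_rest_comp_val]
  exact Subtype.ext_iff

theorem phiProj_isRestriction (𝔸 : PartiteCat.{w} C) : IsRestrictionFunctor (phiProj 𝔸) := by
  intro i j s
  change (rest s.1 ≫ 𝔸.one i.idx) ≫ 𝔸.tgt i.idx i.idx = rest (s.1 ≫ 𝔸.tgt i.idx j.idx)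
  rw [Category.assoc, 𝔸.str.one_tgt, Category.comp_id, rest_comp_total]

theorem phi_isJoin_iff {𝔸 : PartiteCat.{w} C} {i j : PhiObj 𝔸} (S : Set (i ⟶ j)) (s : i ⟶ j)
    (h : IsJoin (Subtype.val '' S) s.1) : IsJoin S s := by
  refine ⟨fun f hf => (phi_rle_iff f s).2 (h.1 _ ⟨f, hf, rfl⟩), fun k hk => ?_⟩
  refine (phi_rle_iff s k).2 (h.2 _ ?_)
  rintro _ ⟨f, hf, rfl⟩
  exact (phi_rle_iff f k).1 (hk f hf)

instance [IsJoinRestriction C] (𝔸 : PartiteCat.{w} C) : IsJoinRestriction (PhiObj 𝔸) where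
  exists_join {i j} S hS := by
    obtain ⟨m, hm, -⟩ := IsJoinRestriction.exists_join (Subtype.val '' S) (by
      rintro _ ⟨f, hf, rfl⟩ _ ⟨g, hg, rfl⟩
      have h := congrArg Subtype.val (hS f hf g hg)
      rw [phi_rest_comp_val, phi_rest_comp_val] at h
      exact h)
    have hsec : IsPartialSection (𝔸.src i.idx j.idx) m := by
      have h : RLe (rest m) (m ≫ 𝔸.src i.idx j.idx) := by
        refine hm.rest.2 _ ?_
        rintro _ ⟨_, ⟨f, hf, rfl⟩, rfl⟩
        rw [← f.2]
        exact (hm.1 _ ⟨f, hf, rfl⟩).comp_right _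
      unfold RLe at h
      rw [rest_rest, rest_self_assoc] at h
      exact h.symm
    refine ⟨⟨m, hsec⟩, phi_isJoin_iff S _ hm, ?_⟩
    intro l g
    have hj : IsJoin S ⟨m, hsec⟩ := phi_isJoin_iff S _ hm
    refine ⟨?_, ?_⟩
    · rintro _ ⟨f, hf, rfl⟩
      exact (hj.1 f hf).comp_left g
    · intro k hk
      refine (phi_rle_iff _ _).2 ?_
      have hD := (hm.comp (g.1 ≫ 𝔸.tgt l.idx i.idx)).rest
      rw [Category.assoc, ← 𝔸.str.rest_secComp g.1 m hsec] at hD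
      refine RLe.of_restrictions hD ?_
      rintro _ ⟨_, ⟨_, ⟨f, hf, rfl⟩, rfl⟩, rfl⟩
      have h1 : RLe (g ≫ f).1 (g ≫ (⟨m, hsec⟩ : i ⟶ j)).1 :=
        (phi_rle_iff _ _).1 ((hj.1 f hf).comp_left g)
      unfold RLe at h1
      have h2 : RLe (g ≫ f).1 k.1 := (phi_rle_iff _ _).1 (hk _ ⟨f, hf, rfl⟩)
      rw [h1, phi_comp_val, phi_comp_val, 𝔸.str.rest_secComp] at h2
      rw [Category.assoc]
      exact h2

theorem phiProj_isHyperconnected (𝔸 : PartiteCat.{w} C) : IsHyperconnected (phiProj 𝔸) := by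
  refine ⟨phiProj_isRestriction 𝔸, fun i => ⟨fun e he => ?_, fun e he e' he' h => ?_, ?_⟩⟩
  · exact (phiProj_isRestriction 𝔸 e).symm.trans (congrArg _ he)
  · have key : ∀ d : i ⟶ i, IsRestIdem d → (phiProj 𝔸).map d ≫ 𝔸.one i.idx = d.1 := by
      intro d hd
      have h1 : rest d.1 ≫ 𝔸.one i.idx = d.1 := congrArg Subtype.val hd
      have h2 : (phiProj 𝔸).map d = rest d.1 := by
        change d.1 ≫ 𝔸.tgt i.idx i.idx = rest d.1
        have h3 := congrArg (fun z => z ≫ 𝔸.tgt i.idx i.idx) h1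
        simp only [Category.assoc] at h3
        rw [𝔸.str.one_tgt, Category.comp_id] at h3
        exact h3.symm
      exact (congrArg (fun z => z ≫ 𝔸.one i.idx) h2).trans h1
    apply Subtype.ext
    rw [← key e he, ← key e' he']
    exact congrArg (fun z => z ≫ 𝔸.one i.idx) h
  · intro d hd
    refine ⟨rest (⟨rest d ≫ 𝔸.one i.idx, 𝔸.str.isPartialSection_rest_one d⟩ : i ⟶ i),
      Subtype.ext ?_, ?_⟩
    · rw [phi_rest_val, phi_rest_val]
      rw [rest_comp_total, rest_rest]
    · exact (𝔸.str.rest_one_tgt d).trans hd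

/-- The externalisation of a partite internal category. -/
noncomputable def externalisation (𝔸 : PartiteCat.{w} C) : RCatOver.{w} C where
  carrier := PhiObj 𝔸
  proj := phiProj 𝔸
  isRestriction := phiProj_isRestriction 𝔸

namespace Cofunctor

variable {𝔸 𝔹 : PartiteCat.{w} C} (F : Cofunctor 𝔸 𝔹)

/-- The action of a cofunctor on partial sections: `F_i^* s` followed by `F_ij`. -/
noncomputable def onSec {i j : 𝔸.Idx} (s : 𝔸.obj i ⟶ 𝔸.arr i j)
    (hs : IsPartialSection (𝔸.src i j) s) : 𝔹.obj (F.idx i) ⟶ 𝔹.arr (F.idx i) (F.idx j) :=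
  pullbackSection (𝔸.src i j) (F.obj i) s hs ≫ F.arr i j

theorem onSec_cond {i j : 𝔸.Idx} (s : 𝔸.obj i ⟶ 𝔸.arr i j)
    (hs : IsPartialSection (𝔸.src i j) s) :
    (F.obj i ≫ s) ≫ 𝔸.src i j = rest (F.obj i ≫ s) ≫ F.obj i := by
  rw [Category.assoc, hs, comp_rest]

theorem onSec_eq {i j : 𝔸.Idx} (s : 𝔸.obj i ⟶ 𝔸.arr i j)
    (hs : IsPartialSection (𝔸.src i j) s) :
    F.onSec s hs = F.act (F.obj i ≫ s) (rest (F.obj i ≫ s)) (F.onSec_cond s hs) := rfl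

theorem rest_act {i j : 𝔸.Idx} {T : C} (x : T ⟶ 𝔸.arr i j) (b : T ⟶ 𝔹.obj (F.idx i))
    (h : x ≫ 𝔸.src i j = b ≫ F.obj i) : rest (F.act x b h) = rest b := by
  rw [← rest_comp_total _ (𝔹.src _ _), act_src]

theorem isPartialSection_onSec {i j : 𝔸.Idx} (s : 𝔸.obj i ⟶ 𝔸.arr i j)
    (hs : IsPartialSection (𝔸.src i j) s) :
    IsPartialSection (𝔹.src (F.idx i) (F.idx j)) (F.onSec s hs) := by
  unfold IsPartialSection
  rw [onSec_eq, act_src, rest_act, rest_rest]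

theorem onSec_rest_one {i : 𝔸.Idx} {X : C} (f : 𝔸.obj i ⟶ X) :
    F.onSec (rest f ≫ 𝔸.one i) (𝔸.str.isPartialSection_rest_one f) =
      rest (F.obj i ≫ f) ≫ 𝔹.one (F.idx i) := by
  rw [onSec_eq, ← act_one]
  apply act_congr
  · rw [← Category.assoc, comp_rest, Category.assoc]
  · rw [← Category.assoc, rest_comp_total, rest_comp_rest]

theorem onSec_one (i : 𝔸.Idx) :
    F.onSec (𝔸.one i) (𝔸.str.isPartialSection_one i) = 𝔹.one (F.idx i) := by
  have h : F.act (𝟙 _ ≫ F.obj i ≫ 𝔸.one i) (𝟙 _) _ = _ := F.act_one (𝟙 _)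
  rw [Category.id_comp (𝔹.one _)] at h
  rw [onSec_eq]
  refine Eq.trans ?_ h
  apply act_congr
  · rw [Category.id_comp]
  · rw [IsTotal.rest_eq]

theorem onSec_tgt {i j : 𝔸.Idx} (s : 𝔸.obj i ⟶ 𝔸.arr i j)
    (hs : IsPartialSection (𝔸.src i j) s) :
    F.onSec s hs ≫ 𝔹.tgt _ _ ≫ F.obj j = F.obj i ≫ s ≫ 𝔸.tgt i j := by
  rw [onSec_eq, act_tgt, Category.assoc]

theorem onSec_comp {i j k : 𝔸.Idx} (s : 𝔸.obj i ⟶ 𝔸.arr i j) (t : 𝔸.obj j ⟶ 𝔸.arr j k)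
    (hs : IsPartialSection (𝔸.src i j) s) (ht : IsPartialSection (𝔸.src j k) t) :
    F.onSec (𝔸.str.secComp s t ht) (𝔸.str.isPartialSection_secComp s t hs ht) =
      𝔹.str.secComp (F.onSec s hs) (F.onSec t ht) (F.isPartialSection_onSec t ht) := by
  have e0 : F.onSec s hs ≫ 𝔹.tgt _ _ ≫ F.obj j ≫ t = F.obj i ≫ s ≫ 𝔸.tgt i j ≫ t := by
    have := congrArg (fun z => z ≫ t) (F.onSec_tgt s hs)
    simpa only [Category.assoc] using this
  set ρ := rest (F.obj i ≫ s ≫ 𝔸.tgt i j ≫ t) with hρ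
  have e1 : rest (F.obj i ≫ 𝔸.str.secComp s t ht) = ρ := by
    rw [← rest_comp_rest, 𝔸.str.rest_secComp, rest_comp_rest]
  have e2 : rest (F.onSec s hs ≫ 𝔹.tgt _ _ ≫ F.onSec t ht) = ρ := by
    rw [← Category.assoc, ← rest_comp_rest, onSec_eq (s := t), rest_act, rest_rest, rest_comp_rest,
      Category.assoc, e0]
  have e3 : ρ ≫ rest (F.obj i ≫ s) = ρ := by
    rw [rest_comm]
    simpa only [Category.assoc] using rest_comp_le (F.obj i ≫ s) (𝔸.tgt i j ≫ t)
  have c1 : (F.obj i ≫ s ≫ 𝔸.tgt i j ≫ t) ≫ 𝔸.src j k = (ρ ≫ F.obj i ≫ s) ≫ 𝔸.tgt i j := by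
    have := congrArg (fun z => F.obj i ≫ z) (𝔸.str.secComp_cond s t ht)
    simp only [Category.assoc] at this ⊢
    rw [this, ← Category.assoc, comp_rest, Category.assoc]
  have c2 : (ρ ≫ F.obj i ≫ s) ≫ 𝔸.src i j = ρ ≫ F.obj i := by
    rw [Category.assoc, onSec_cond _ _ hs, ← Category.assoc, e3]
  have main := F.act_cmp (F.obj i ≫ s ≫ 𝔸.tgt i j ≫ t) (ρ ≫ F.obj i ≫ s) ρ c1 c2
  have e4 : F.act (ρ ≫ F.obj i ≫ s) ρ c2 = ρ ≫ F.onSec s hs := by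
    rw [onSec_eq, comp_act]
    apply act_congr
    · rfl
    · rw [e3]
  rw [onSec_eq, 𝔹.str.secComp_eq]
  refine Eq.trans ?_ (main.trans ?_)
  · apply act_congr
    · rw [𝔸.str.secComp_eq, 𝔸.str.comp_cmp]
      apply PartiteCatOn.cmp_congr
      · rfl
      · rw [← Category.assoc, comp_rest, Category.assoc]
    · exact e1
  · apply PartiteCatOn.cmp_congr
    · rw [onSec_eq (s := t), comp_act, comp_act]
      apply act_congr
      · exact e0.symm
      · have := congrArg (fun z => z ≫ 𝔹.tgt _ _)
          (comp_rest (F.onSec s hs) (𝔹.tgt _ _ ≫ F.obj j ≫ t))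
        rw [e0] at this
        rw [e4, comp_rest]
        refine this.symm.trans ?_
        simp only [Category.assoc]
    · rw [e4, e2]

theorem onSec_compCofunctor {𝔻 : PartiteCat.{w} C} (F : Cofunctor 𝔸 𝔹) (G : Cofunctor 𝔹 𝔻)
    {i j : 𝔸.Idx} (s : 𝔸.obj i ⟶ 𝔸.arr i j) (hs : IsPartialSection (𝔸.src i j) s) :
    (comp F G).onSec s hs = G.onSec (F.onSec s hs) (F.isPartialSection_onSec s hs) := by
  have e : rest ((comp F G).obj i ≫ s) = rest (G.obj (F.idx i) ≫ F.onSec s hs) := by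
    rw [← rest_comp_rest (G.obj _), onSec_eq F, rest_act, rest_rest, rest_comp_rest,
      ← Category.assoc]
    rfl
  refine (comp_act_apply F G _ _ _).trans (act_congr G _ ?_ e)
  rw [onSec_eq F, comp_act]
  apply act_congr
  · exact Category.assoc _ _ _
  · rw [comp_rest, ← Category.assoc]
    rfl

/-- The functor `ΦF : Φ𝔸 ⥤ Φ𝔹`. -/
noncomputable def phiFunctor : PhiObj 𝔸 ⥤ PhiObj 𝔹 where
  obj i := ⟨F.idx i.idx⟩
  map s := ⟨F.onSec s.1 s.2, F.isPartialSection_onSec s.1 s.2⟩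
  map_id i := Subtype.ext (F.onSec_one i.idx)
  map_comp s t := Subtype.ext (F.onSec_comp s.1 t.1 s.2 t.2)

end Cofunctor

/-- The map `(ΦF, ϖ^F)` of restriction categories over `C` induced by a cofunctor. -/
noncomputable def externalisationMap {𝔸 𝔹 : PartiteCat.{w} C} (F : 𝔸 ⟶ 𝔹) :
    externalisation 𝔸 ⟶ externalisation 𝔹 :=
  RCatOver.Hom.mk (P := externalisation 𝔸) (Q := externalisation 𝔹)
    (Cofunctor.phiFunctor F)
    (fun {i j} s => Subtype.ext (by
      refine (Cofunctor.onSec_rest_one F s.1).trans ?_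
      refine congrArg (fun z => z ≫ _) ?_
      exact ((Cofunctor.rest_act F _ _ (Cofunctor.onSec_cond F s.1 s.2)).trans
        (rest_rest _)).symm))
    { app := fun i => Cofunctor.obj F i.idx
      naturality := fun i j s => (Category.assoc _ _ _).trans (Cofunctor.onSec_tgt F s.1 s.2) }
    (fun i => Cofunctor.obj_total F i.idx)

theorem RCatOver.Hom.ext' {P Q : RCatOver.{w} C} (F G : P ⟶ Q)
    (ho : ∀ x, F.functor.obj x = G.functor.obj x)
    (hm : ∀ x y (f : x ⟶ y), HEq (F.functor.map f) (G.functor.map f))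
    (ht : ∀ x, HEq (F.trans.app x) (G.trans.app x)) : F = G := by
  obtain ⟨F, hF, t, tF⟩ := F
  obtain ⟨G, hG, t', tG⟩ := G
  obtain rfl : F = G := CategoryTheory.Functor.hext ho hm
  exact RCatOver.Hom.ext_aux (fun x => eq_of_heq (ht x))

theorem RCatOver.Hom.functor_id (P : RCatOver.{w} C) :
    RCatOver.Hom.functor (𝟙 P) = 𝟭 P.carrier := rfl

theorem RCatOver.Hom.functor_comp {P Q R : RCatOver.{w} C} (F : P ⟶ Q) (G : Q ⟶ R) :
    RCatOver.Hom.functor (F ≫ G) = RCatOver.Hom.functor F ⋙ RCatOver.Hom.functor G := rfl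

theorem RCatOver.Hom.trans_comp {P Q R : RCatOver.{w} C} (F : P ⟶ Q) (G : Q ⟶ R)
    (x : P.carrier) : (RCatOver.Hom.trans (F ≫ G)).app x =
      (RCatOver.Hom.trans G).app ((RCatOver.Hom.functor F).obj x) ≫
        (RCatOver.Hom.trans F).app x := rfl

variable (C) in
/-- The externalisation functor `Φ`. -/
noncomputable def Phi : PartiteCat.{w} C ⥤ RCatOver.{w} C where
  obj := externalisation
  map := externalisationMap
  map_id 𝔸 := by
    refine RCatOver.Hom.ext' (externalisationMap (𝟙 𝔸)) (𝟙 (externalisation 𝔸)) (fun x => rfl)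
      (fun i j s => ?_) (fun i => HEq.rfl)
    refine heq_of_eq (Subtype.ext ?_)
    exact (Cofunctor.id_act (𝔸 := 𝔸) _ _ _).trans (Category.id_comp _)
  map_comp {𝔸 𝔹 𝔻} F G := by
    refine RCatOver.Hom.ext' (externalisationMap (F ≫ G))
      (externalisationMap F ≫ externalisationMap G) (fun x => rfl)
      (fun i j s => ?_) (fun i => HEq.rfl)
    refine heq_of_eq (Subtype.ext ?_)
    exact Cofunctor.onSec_compCofunctor F G s.1 s.2

/-! ### The categories in the equivalence -/

variable (C) in
/-- Source-étale partite internal categories. -/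
def isPeCat : ObjectProperty (PartiteCat.{w} C) := fun 𝔸 => 𝔸.IsSourceEtale

variable (C) in
/-- Étale partite internal groupoids. -/
def isPeGpd : ObjectProperty (PartiteCat.{w} C) := fun 𝔸 => 𝔸.IsSourceEtale ∧ 𝔸.IsGroupoid

variable (C) in
/-- Join restriction categories hyperconnected over `C`. -/
def isHCon : ObjectProperty (RCatOver.{w} C) :=
  fun P => IsJoinRestriction P.carrier ∧ IsHyperconnected P.proj

variable (C) in
/-- Étale join restriction categories hyperconnected over `C`. -/
def isHConEj : ObjectProperty (RCatOver.{w} C) :=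
  fun P => (IsJoinRestriction P.carrier ∧ IsHyperconnected P.proj) ∧
    ∀ (x y : P.carrier) (f : x ⟶ y), IsEtaleMap f

variable (C) in
theorem isPeGpd_le : isPeGpd.{w} C ≤ isPeCat.{w} C := fun _ h => h.1

variable (C) in
theorem isHConEj_le : isHConEj.{w} C ≤ isHCon.{w} C := fun _ h => h.1

variable (C) in
abbrev PeCat := (isPeCat.{w} C).FullSubcategory

variable (C) in
abbrev PeGpd := (isPeGpd.{w} C).FullSubcategory

variable (C) in
abbrev HCon := (isHCon.{w} C).FullSubcategory

variable (C) in
abbrev HConEj := (isHConEj.{w} C).FullSubcategory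

variable (C) in
/-- The restriction of `Φ` to source-étale partite internal categories. -/
noncomputable def PhiE [IsJoinRestriction C] : PeCat.{w} C ⥤ HCon.{w} C :=
  (isHCon.{w} C).lift ((isPeCat.{w} C).ι ⋙ Phi.{w} C) (fun 𝔸 =>
    ⟨(inferInstance : IsJoinRestriction (PhiObj 𝔸.obj)), phiProj_isHyperconnected 𝔸.obj⟩)

/-! ### Internalisation -/

theorem RLe.map {A : Type*} [Category A] [RestrictionCategory A] {B : Type*} [Category B]
    [RestrictionCategory B] {F : A ⥤ B} (hF : IsRestrictionFunctor F) {x y : A} {f g : x ⟶ y}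
    (h : RLe f g) : RLe (F.map f) (F.map g) := by
  unfold RLe at h ⊢
  rw [← hF, ← F.map_comp, ← h]

/-- An internalisation of `P`.  Its underlying source maps are glueings of the local atlases
`eqv f g = ⋁ {P e : e ≤ f̄ ḡ, f e = g e}`, with associated basis of partial sections `s f`. -/
structure Internalisation (P : RCatOver.{w} C) where
  str : PartiteCatOn (fun i : P.carrier => P.proj.obj i)
  eqv : ∀ {i j : P.carrier} (_ _ : i ⟶ j), P.proj.obj i ⟶ P.proj.obj i
  isJoin_eqv : ∀ {i j : P.carrier} (f g : i ⟶ j),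
    IsJoin {h | ∃ e : i ⟶ i, IsRestIdem e ∧ RLe e (rest f ≫ rest g) ∧ e ≫ f = e ≫ g ∧
      h = P.proj.map e} (eqv f g)
  p : ∀ {i j : P.carrier} (_ : i ⟶ j), str.arr i j ⟶ P.proj.obj i
  s : ∀ {i j : P.carrier} (_ : i ⟶ j), P.proj.obj i ⟶ str.arr i j
  isGlueing : ∀ i j : P.carrier, IsGlueing (fun f g : i ⟶ j => eqv f g) (str.src i j)
    (fun f => p f) (fun f => s f)
  s_tgt : ∀ {i j : P.carrier} (f : i ⟶ j), s f ≫ str.tgt i j = P.proj.map f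
  one_eq : ∀ i : P.carrier, str.one i = s (𝟙 i)
  isPartialSection_s : ∀ {i j : P.carrier} (f : i ⟶ j), IsPartialSection (str.src i j) (s f)
  s_mul : ∀ {i j k : P.carrier} (f : i ⟶ j) (g : j ⟶ k),
    s f ≫ pullbackSection (str.src j k) (str.tgt i j) (s g) (isPartialSection_s g) ≫
      str.mul i j k = s (f ≫ g)

namespace Internalisation

variable {P : RCatOver.{w} C} (Ψ : Internalisation P)

/-- The partite internal category of an internalisation. -/
def cat : PartiteCat.{w} C where
  Idx := P.carrier
  obj i := P.proj.obj i
  str := Ψ.str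

theorem isSourceEtale : Ψ.cat.IsSourceEtale := fun (i j : P.carrier) =>
  ⟨Ψ.str.graph.src_total i j, Set.range (fun f : i ⟶ j => Ψ.p f), by
    rintro _ ⟨f, rfl⟩
    exact ⟨Ψ.s f, (Ψ.isGlueing i j).inverse f⟩, (Ψ.isGlueing i j).join⟩

theorem s_rest {i j : P.carrier} (f : i ⟶ j) : Ψ.s (rest f) = rest (Ψ.s f) ≫ Ψ.s (𝟙 i) := by
  have inv : ∀ {j} (g : i ⟶ j), IsPartialInverse (Ψ.p g) (Ψ.s g) :=
    fun {j} g => (Ψ.isGlueing i j).inverse g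
  have e1 : ∀ {j} (g : i ⟶ j), Ψ.eqv g g = P.proj.map (rest g) := fun g =>
    (Ψ.isJoin_eqv g g).unique (isJoin_of_mem
      ⟨rest g, rest_rest g, by rw [rest_idem]; exact RLe.refl _, rfl, rfl⟩ (by
        rintro _ ⟨e, -, he, -, rfl⟩
        rw [rest_idem] at he
        exact he.map P.isRestriction))
  have e2 : Ψ.eqv (rest f) (𝟙 i) = P.proj.map (rest f) :=
    (Ψ.isJoin_eqv _ _).unique (isJoin_of_mem
      ⟨rest f, rest_rest f, by rw [rest_rest, rest_id, Category.comp_id]; exact RLe.refl _,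
        by rw [rest_idem, Category.comp_id], rfl⟩ (by
        rintro _ ⟨e, -, he, -, rfl⟩
        rw [rest_rest, rest_id, Category.comp_id] at he
        exact he.map P.isRestriction))
  have r1 : ∀ {j} (g : i ⟶ j), rest (Ψ.s g) = P.proj.map (rest g) := fun {j} g =>
    (inv g).2.symm.trans (((Ψ.isGlueing i j).atlas g g).trans (e1 g))
  have r2 : Ψ.s (rest f) ≫ Ψ.p (𝟙 i) = P.proj.map (rest f) :=
    ((Ψ.isGlueing i i).atlas (rest f) (𝟙 i)).trans e2
  have h1 : (Ψ.s (rest f) ≫ Ψ.p (𝟙 i)) ≫ Ψ.s (𝟙 i) = Ψ.s (rest f) := by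
    rw [Category.assoc, (inv (𝟙 i)).1, comp_rest, r2]
    have r3 := r1 (rest f)
    rw [rest_rest] at r3
    rw [← r3, rest_rest, rest_self]
  rw [r1, ← r2, h1]

/-- The unit map from `P` to the externalisation of its internalisation. -/
noncomputable def unit : P ⟶ (Phi.{w} C).obj Ψ.cat :=
  RCatOver.Hom.mk (P := P) (Q := externalisation Ψ.cat)
    { obj := fun i => (⟨i⟩ : PhiObj Ψ.cat)
      map := fun f => ⟨Ψ.s f, Ψ.isPartialSection_s f⟩
      map_id := fun i => Subtype.ext (Ψ.one_eq i).symm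
      map_comp := fun f g => Subtype.ext (Ψ.s_mul f g).symm }
    (fun f => Subtype.ext ((Ψ.s_rest f).trans
      (congrArg (fun z => rest (Ψ.s f) ≫ z) (Ψ.one_eq _).symm)))
    { app := fun i => 𝟙 (P.proj.obj i)
      naturality := fun _ _ f => (Category.comp_id _).trans
        ((Ψ.s_tgt f).trans (Category.id_comp _).symm) }
    (fun _ => ⟨rest_id _⟩)

end Internalisation

variable (C) in
/-- An internalisation functor `Ψ`: a choice of internalisations, together with the unique
functorial action on maps for which the unit maps are natural. -/
structure InternalisationFunctor where
  obj : ∀ P : HCon.{w} C, Internalisation P.obj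
  map : ∀ {P Q : HCon.{w} C} (_ : P ⟶ Q), (obj P).cat ⟶ (obj Q).cat
  map_id : ∀ P : HCon.{w} C, map (𝟙 P) = 𝟙 (obj P).cat
  map_comp : ∀ {P Q R : HCon.{w} C} (F : P ⟶ Q) (G : Q ⟶ R), map (F ≫ G) = map F ≫ map G
  unit_naturality : ∀ {P Q : HCon.{w} C} (F : P ⟶ Q),
    (obj P).unit ≫ (Phi.{w} C).map (map F) = F.hom ≫ (obj Q).unit

/-- The functor `Ψ` from join restriction categories hyperconnected over `C` to source-étale
partite internal categories. -/
noncomputable def InternalisationFunctor.functor (Ψ : InternalisationFunctor.{w} C) :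
    HCon.{w} C ⥤ PeCat.{w} C where
  obj P := ⟨(Ψ.obj P).cat, (Ψ.obj P).isSourceEtale⟩
  map F := ObjectProperty.homMk (Ψ.map F)
  map_id P := by rw [Ψ.map_id]; rfl
  map_comp F G := by rw [Ψ.map_comp]; rfl

end Partite

end EtaleGpd

namespace EtaleGpd

/-! ### Restriction idempotents, joins and agreement -/

section Joins

variable {C : Type u} [Category.{v} C] [RestrictionCategory C]

/-! A local homeomorphism `q : A ⟶ X` is covered by partial isomorphisms `p i`, and the inverses `s
i` of these are partial sections of `q`. Hence the `s i` are jointly epic (`IsGlueing.hom_ext`), and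
a map out of `A` is the same as a family of maps out of `X`, one for each `i`, that match on the
overlaps `φ i j` (`IsGlueing.exists_desc`). Both facts survive pullback along total maps
(`IsGlueing.pullback`), so they also apply to the fibre products on which compositions and
cofunctors live. Every construction below is glued from partial sections, and every identity is
checked on them.

Full faithfulness of `Φ`. For a local homeomorphism the basis `s i` may be taken to be the family of
all partial sections (`isGlueing_sections`). A map between externalisations is an action on
precisely these sections. Preservation of restrictions makes the action match on overlaps, so it
glues to maps `F_ij`, and functoriality becomes the cofunctor laws (`cofunctorOfHom`). Joint
epicness makes `F_ij` unique (`externalisationMap_injective`).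

Essential surjectivity. Given `P`, the arrows `i ⟶ j` are glued along the idempotents on which they
agree, giving an object of germs over `P i`. Right multiplication by a map of `P` is well defined on
germs and glues to a composition (`GlueingFamily.mul`). Pullbacks along total maps exist because the
pulled-back atlas can itself be glued (`IsGlueing.hasPullback`). Hyperconnectedness is what makes
the unit `f ↦ s f` invertible. Injectivity on idempotents turns `s f = s g` into agreement on the
full domains (`s_injective`). Surjectivity lifts the local pieces of an arbitrary partial section to
compatible maps of the domain of `P`, whose join gives that section (`exists_s_eq`). The action of
`Ψ` on maps is then conjugation by the units followed by full faithfulness.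

Groupoids. If `s` is a partial section with `τ s` partially inverse to `t`, then `ι s t` is
partially inverse to `s` in `Φ𝔸`; étale maps are reflected piece by piece. In the étale case `τ s =
σ ι s` is a partial isomorphism followed by a local homeomorphism, so every map of `Φ𝔸` is étale.
Conversely, if every map over `C` is étale, germs of partial isomorphisms already cover the objects
of arrows, and inverting them germwise defines `ι` (`exists_inv`, `GlueingFamily.isGroupoid`). -/

theorem isRestIdem_rest {A B : C} (f : A ⟶ B) : IsRestIdem (rest f) := rest_rest f

theorem IsRestIdem.eq {A : C} {e : A ⟶ A} (h : IsRestIdem e) : rest e = e := h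

theorem IsRestIdem.comp_self {A : C} {e : A ⟶ A} (h : IsRestIdem e) : e ≫ e = e := by
  rw [← h.eq, rest_idem]

theorem IsRestIdem.comm {A : C} {e d : A ⟶ A} (h : IsRestIdem e) (h' : IsRestIdem d) :
    e ≫ d = d ≫ e := by
  rw [← h.eq, ← h'.eq, rest_comm]

theorem IsRestIdem.rest_comp {A B : C} {e : A ⟶ A} (h : IsRestIdem e) (f : A ⟶ B) :
    rest (e ≫ f) = e ≫ rest f := by
  conv_lhs => rw [← h.eq]
  rw [rest_rest_comp, h.eq]

theorem IsRestIdem.comp {A : C} {e d : A ⟶ A} (h : IsRestIdem e) (h' : IsRestIdem d) :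
    IsRestIdem (e ≫ d) := by
  unfold IsRestIdem
  rw [h.rest_comp, h'.eq]

theorem IsRestIdem.rle {A B : C} {e : A ⟶ A} (h : IsRestIdem e) (f : A ⟶ B) :
    RLe (e ≫ f) f := by
  unfold RLe
  rw [h.rest_comp, Category.assoc, rest_self]

theorem RLe.isRestIdem {A : C} {e d : A ⟶ A} (hd : IsRestIdem d) (h : RLe e d) :
    IsRestIdem e := by
  refine RLe.rest_of_le_id (h.trans ?_)
  rw [← hd.eq]
  exact rest_rle_id d

theorem RLe.comp_eq {A : C} {e d : A ⟶ A} (hd : IsRestIdem d) (h : RLe e d) : e ≫ d = e := by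
  have he := h.isRestIdem hd
  unfold RLe at h
  rw [he.eq] at h
  exact h.symm

theorem IsRestIdem.rle_of_comp_eq {A B : C} {e : A ⟶ A} {f : A ⟶ B} (he : IsRestIdem e)
    {g : A ⟶ B} (h : e ≫ g = f) : RLe f g := h ▸ he.rle g

theorem rest_comp_cancel {A B B' : C} (f : A ⟶ B) (g : A ⟶ B') : rest f ≫ rest f ≫ g =
    rest f ≫ g := by
  rw [← Category.assoc, rest_idem]

theorem rest_rle_rest_comp {A B B' : C} (f : A ⟶ B) (g : B ⟶ B') :
    RLe (rest (f ≫ g)) (rest f) := by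
  unfold RLe
  rw [rest_rest, rest_comm, rest_comp_le]

theorem rle_of_rest_eq {A B : C} {f g : A ⟶ B} (h : RLe f g) (e : rest f = rest g) : f = g := by
  unfold RLe at h
  rw [h, e, rest_self]

/-! ### Partial inverses -/

theorem IsPartialInverse.symm {A B : C} {s : A ⟶ B} {t : B ⟶ A} (h : IsPartialInverse s t) :
    IsPartialInverse t s := ⟨h.2, h.1⟩

theorem IsPartialInverse.comp_rest {A B : C} {s : A ⟶ B} {t : B ⟶ A}
    (h : IsPartialInverse s t) : s ≫ rest t = s := by
  rw [← h.2, ← Category.assoc, h.1, rest_self]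

theorem IsPartialInverse.comp {A B B' : C} {s : A ⟶ B} {t : B ⟶ A} {s' : B ⟶ B'} {t' : B' ⟶ B}
    (h : IsPartialInverse s t) (h' : IsPartialInverse s' t') :
    IsPartialInverse (s ≫ s') (t' ≫ t) := by
  have key : ∀ {A B B' : C} {s : A ⟶ B} {t : B ⟶ A} {s' : B ⟶ B'} {t' : B' ⟶ B},
      IsPartialInverse s t → IsPartialInverse s' t' →
      (s ≫ s') ≫ t' ≫ t = rest (s ≫ s') := by
    intro A B B' s t s' t' h h'
    rw [Category.assoc, ← Category.assoc s', h'.1, ← Category.assoc, EtaleGpd.comp_rest,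
      Category.assoc, h.1, rest_comm, rest_comp_le]
  exact ⟨key h h', key h'.symm h.symm⟩

/-- The inverse-semigroup argument: precomposing `t'` with `t ≫ s` gives `t`, so `t ≤ t'`, and the
situation is symmetric. -/
theorem IsPartialInverse.unique {A B : C} {s : A ⟶ B} {t t' : B ⟶ A}
    (h : IsPartialInverse s t) (h' : IsPartialInverse s t') : t = t' := by
  have key : ∀ {t t' : B ⟶ A}, IsPartialInverse s t → IsPartialInverse s t' →
      RLe t t' := by
    intro t t' h h'
    refine (isRestIdem_rest t).rle_of_comp_eq ?_
    rw [← h.2, Category.assoc, h'.1, ← h.1, ← Category.assoc, h.2, rest_self]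
  exact (key h h').antisymm (key h' h)

theorem IsPartialInverse.restrict {A B : C} {s : A ⟶ B} {t : B ⟶ A}
    (h : IsPartialInverse s t) {e : A ⟶ A} (he : IsRestIdem e) :
    IsPartialInverse (e ≫ s) (t ≫ e) :=
  IsPartialInverse.comp ⟨by rw [he.comp_self, he.eq], by rw [he.comp_self, he.eq]⟩ h

theorem IsPartialIso.comp {A B B' : C} {s : A ⟶ B} {s' : B ⟶ B'}
    (h : IsPartialIso s) (h' : IsPartialIso s') : IsPartialIso (s ≫ s') := by
  obtain ⟨t, ht⟩ := h
  obtain ⟨t', ht'⟩ := h'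
  exact ⟨t' ≫ t, ht.comp ht'⟩

theorem isPartialInverse_of_inv {A B : C} {s : A ⟶ B} {t : B ⟶ A} (h : s ≫ t = 𝟙 A)
    (h' : t ≫ s = 𝟙 B) : IsPartialInverse s t := by
  have hs : IsTotal s := IsTotal.of_comp s t (by rw [h]; infer_instance)
  have ht : IsTotal t := IsTotal.of_comp t s (by rw [h']; infer_instance)
  exact ⟨by rw [h, hs.rest_eq], by rw [h', ht.rest_eq]⟩

theorem IsJoin.rle {A B : C} {S : Set (A ⟶ B)} {j f : A ⟶ B} (h : IsJoin S j) (hf : f ∈ S) :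
    RLe f j := h.1 f hf

theorem isJoin_image_eq {A B : C} {S T : Set (A ⟶ B)} {j : A ⟶ B} (h : IsJoin S j)
    (e : T = S) : IsJoin T j := e ▸ h

variable [IsJoinRestriction C]

/-- A map is the join of its restrictions to a cover of its domain of definition. -/
theorem IsJoin.restrict {A B : C} {m : A ⟶ B} {D : Set (A ⟶ A)} (hD : IsJoin D (EtaleGpd.rest m)) :
    IsJoin {h | ∃ d ∈ D, h = d ≫ m} m := by
  refine ⟨?_, fun k hk => RLe.of_restrictions hD fun d hd => hk _ ⟨d, hd, rfl⟩⟩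
  rintro _ ⟨d, hd, rfl⟩
  exact ((hD.1 d hd).isRestIdem (isRestIdem_rest m)).rle m

/-- Joins are preserved by postcomposition. -/
theorem IsJoin.postcomp {A B B' : C} {S : Set (A ⟶ B)} {j : A ⟶ B} (hj : IsJoin S j)
    (g : B ⟶ B') : IsJoin {h | ∃ f ∈ S, h = f ≫ g} (j ≫ g) := by
  -- Only precomposition preserves joins by axiom. Postcomposition is reduced to it: the domain of
  -- `j ≫ g` is covered by its meets with the domains of the `f ∈ S`, and on each of these `j ≫ g`
  -- is `f ≫ g`.
  have h1 : IsJoin {h | ∃ d ∈ {h | ∃ f ∈ S, h = EtaleGpd.rest f}, h = EtaleGpd.rest (j ≫ g) ≫ d}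
      (EtaleGpd.rest (j ≫ g)) := by
    have := hj.rest.comp (EtaleGpd.rest (j ≫ g))
    rwa [rest_comm, rest_comp_le] at this
  refine isJoin_image_eq h1.restrict ?_
  have key : ∀ f ∈ S, (EtaleGpd.rest (j ≫ g) ≫ EtaleGpd.rest f) ≫ j ≫ g = f ≫ g := by
    intro f hf
    rw [rest_comm, Category.assoc, rest_self, ← Category.assoc]
    congr 1
    exact (hj.1 f hf).symm
  ext h
  constructor
  · rintro ⟨f, hf, rfl⟩
    exact ⟨_, ⟨_, ⟨f, hf, rfl⟩, rfl⟩, (key f hf).symm⟩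
  · rintro ⟨_, ⟨_, ⟨f, hf, rfl⟩, rfl⟩, rfl⟩
    exact ⟨f, hf, key f hf⟩

/-- Two maps agreeing on a cover of their domains of definition are equal. -/
theorem IsJoin.hom_ext {A B Z : C} {S : Set (A ⟶ B)} {j : A ⟶ B} (hj : IsJoin S j)
    {a b : A ⟶ Z} (ha : EtaleGpd.rest j ≫ a = a) (hb : EtaleGpd.rest j ≫ b = b)
    (h : ∀ f ∈ S, EtaleGpd.rest f ≫ a = EtaleGpd.rest f ≫ b) : a = b := by
  have h1 := hj.rest.postcomp a
  have h2 := hj.rest.postcomp b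
  rw [ha] at h1
  rw [hb] at h2
  refine h1.unique (isJoin_image_eq h2 ?_)
  ext k
  constructor
  · rintro ⟨_, ⟨f, hf, rfl⟩, rfl⟩
    exact ⟨_, ⟨f, hf, rfl⟩, h f hf⟩
  · rintro ⟨_, ⟨f, hf, rfl⟩, rfl⟩
    exact ⟨_, ⟨f, hf, rfl⟩, (h f hf).symm⟩

/-! ### The locus where two maps agree -/

theorem exists_agreement {A B : C} (f g : A ⟶ B) :
    ∃ e : A ⟶ A, IsJoin {e | IsRestIdem e ∧ RLe e (rest f ≫ rest g) ∧ e ≫ f = e ≫ g} e := by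
  obtain ⟨e, he, -⟩ := IsJoinRestriction.exists_join
    {e | IsRestIdem e ∧ RLe e (rest f ≫ rest g) ∧ e ≫ f = e ≫ g}
    (IsJoin.compatible (j := 𝟙 A) (by
      rintro d ⟨hd, -, -⟩
      rw [← hd.eq]
      exact rest_rle_id d))
  exact ⟨e, he⟩

/-- The largest restriction idempotent on which both `f` and `g` are defined and agree. -/
noncomputable def agreement {A B : C} (f g : A ⟶ B) : A ⟶ A := (exists_agreement f g).choose

theorem isJoin_agreement {A B : C} (f g : A ⟶ B) :
    IsJoin {e | IsRestIdem e ∧ RLe e (rest f ≫ rest g) ∧ e ≫ f = e ≫ g} (agreement f g) :=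
  (exists_agreement f g).choose_spec

theorem agreement_rle {A B : C} (f g : A ⟶ B) : RLe (agreement f g) (rest f ≫ rest g) :=
  (isJoin_agreement f g).2 _ fun _ h => h.2.1

theorem isRestIdem_agreement {A B : C} (f g : A ⟶ B) : IsRestIdem (agreement f g) :=
  (agreement_rle f g).isRestIdem ((isRestIdem_rest f).comp (isRestIdem_rest g))

theorem agreement_comp_rest_left {A B : C} (f g : A ⟶ B) :
    agreement f g ≫ rest f = agreement f g :=
  ((agreement_rle f g).trans (by rw [rest_comm]; exact (isRestIdem_rest g).rle _)).comp_eq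
    (isRestIdem_rest f)

theorem agreement_comp_rest_right {A B : C} (f g : A ⟶ B) :
    agreement f g ≫ rest g = agreement f g :=
  ((agreement_rle f g).trans ((isRestIdem_rest f).rle _)).comp_eq (isRestIdem_rest g)

/-- Postcomposing the join with `f` and with `g` gives joins of one and the same family. So the
supremum of the idempotents of agreement is itself such an idempotent, that is, a maximum. -/
theorem agreement_comp {A B : C} (f g : A ⟶ B) : agreement f g ≫ f = agreement f g ≫ g := by
  have h1 := (isJoin_agreement f g).postcomp f
  have h2 := (isJoin_agreement f g).postcomp g
  refine h1.unique (isJoin_image_eq h2 ?_)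
  ext k
  constructor
  · rintro ⟨e, he, rfl⟩
    exact ⟨e, he, he.2.2⟩
  · rintro ⟨e, he, rfl⟩
    exact ⟨e, he, he.2.2.symm⟩

theorem rle_agreement {A B : C} {f g : A ⟶ B} {e : A ⟶ A} (he : IsRestIdem e)
    (hf : e ≫ rest f = e) (hg : e ≫ rest g = e) (h : e ≫ f = e ≫ g) :
    RLe e (agreement f g) :=
  (isJoin_agreement f g).1 e ⟨he, he.rle_of_comp_eq (by rw [← Category.assoc, hf, hg]), h⟩

theorem agreement_symm {A B : C} (f g : A ⟶ B) : agreement f g = agreement g f := by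
  have key : ∀ f g : A ⟶ B, RLe (agreement f g) (agreement g f) := fun f g =>
    rle_agreement (isRestIdem_agreement f g) (agreement_comp_rest_right f g)
      (agreement_comp_rest_left f g) (agreement_comp f g).symm
  exact (key f g).antisymm (key g f)

theorem agreement_self {A B : C} (f : A ⟶ B) : agreement f f = rest f :=
  (by simpa only [rest_idem] using agreement_rle f f : RLe (agreement f f) (rest f)).antisymm
    (rle_agreement (isRestIdem_rest f) (rest_idem f) (rest_idem f) rfl)

/-- Together with symmetry this says that the agreement idempotents of a hom-set form a local atlas.
-/
theorem agreement_trans {A B : C} (f g h : A ⟶ B) :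
    RLe (agreement f g ≫ agreement g h) (agreement f h) := by
  have c := (isRestIdem_agreement f g).comm (isRestIdem_agreement g h)
  refine rle_agreement ((isRestIdem_agreement f g).comp (isRestIdem_agreement g h)) ?_ ?_ ?_
  · rw [c, Category.assoc, agreement_comp_rest_left]
  · rw [Category.assoc, agreement_comp_rest_right]
  · rw [Category.assoc _ _ h, ← agreement_comp g h, ← Category.assoc, c, Category.assoc,
      Category.assoc, agreement_comp f g]

end Joins

/-! ### Glueings -/

theorem hasPullback_of_exists_lift {C : Type u} [Category.{v} C] {A X Y E : C} {q : A ⟶ X} {f : Y ⟶ X} (a : E ⟶ A) (b : E ⟶ Y)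
    (w : a ≫ q = b ≫ f)
    (h : ∀ (T : C) (x : T ⟶ A) (y : T ⟶ Y), x ≫ q = y ≫ f →
      ∃ t : T ⟶ E, t ≫ a = x ∧ t ≫ b = y ∧ ∀ t', t' ≫ a = x → t' ≫ b = y → t' = t) :
    HasPullback q f :=
  HasLimit.mk ⟨PullbackCone.mk a b w, PullbackCone.IsLimit.mk w
    (fun c => (h _ c.fst c.snd c.condition).choose)
    (fun c => (h _ c.fst c.snd c.condition).choose_spec.1)
    (fun c => (h _ c.fst c.snd c.condition).choose_spec.2.1)
    (fun c m h₁ h₂ => (h _ c.fst c.snd c.condition).choose_spec.2.2 m h₁ h₂)⟩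

section Glueing

variable {C : Type u} [Category.{v} C] [RestrictionCategory C]

namespace IsGlueing

variable {A X : C} {K : Type v} {φ : K → K → (X ⟶ X)} {q : A ⟶ X} {p : K → (A ⟶ X)}
  {s : K → (X ⟶ A)} (h : IsGlueing φ q p s)

include h

theorem p_rle (i : K) : RLe (p i) q := h.join.1 _ ⟨i, rfl⟩

theorem rest_p_comp (i : K) : rest (p i) ≫ q = p i := (h.p_rle i).symm

theorem s_comp (i : K) : s i ≫ q = rest (s i) := by
  conv_lhs =>
    rw [← (h.inverse i).symm.comp_rest, Category.assoc, h.rest_p_comp, (h.inverse i).2]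

theorem isPartialSection (i : K) : IsPartialSection q (s i) := h.s_comp i

theorem rest_s (i : K) : rest (s i) = φ i i := by rw [← h.atlas, (h.inverse i).2]

theorem isRestIdem_atlas (i j : K) : IsRestIdem (φ i j) := by
  refine RLe.isRestIdem (isRestIdem_rest (s i)) ?_
  rw [← h.atlas, ← h.s_comp]
  exact (h.p_rle j).comp_left _

/-- Restricting `s i` to `φ i j` amounts to postcomposing it with `rest (p j) = p j ≫ s j`, and `s i
≫ p j ≫ s j` is `φ i j ≫ s j`. -/
theorem atlas_comp_s (i j : K) : φ i j ≫ s i = φ i j ≫ s j := by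
  have e : rest (s i ≫ p j) = s i ≫ p j := by
    rw [h.atlas, (h.isRestIdem_atlas i j).eq]
  have e' := comp_rest (s i) (p j)
  rw [e, ← (h.inverse j).1, ← Category.assoc, h.atlas] at e'
  exact e'.symm

theorem atlas_comp_atlas (i j k : K) : φ i j ≫ φ j k = φ i j ≫ φ i k := by
  rw [← h.atlas j k, ← h.atlas i k, ← Category.assoc, ← h.atlas_comp_s, Category.assoc]

theorem atlas_comp_self (i j : K) : φ i j ≫ φ i i = φ i j := by
  refine RLe.comp_eq (h.isRestIdem_atlas i i) ?_
  rw [← h.rest_s, ← h.atlas, ← h.s_comp]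
  exact (h.p_rle j).comp_left _

/-- An induced matrix satisfies the atlas conditions automatically: the restriction of `s i` to `φ i
j` equals that of `s j`, whence `φ i j ≤ φ j i`. -/
theorem atlas_symm (i j : K) : φ i j = φ j i := by
  have key : ∀ i j, φ i j ≫ φ j i = φ i j := fun i j => by
    rw [h.atlas_comp_atlas, h.atlas_comp_self]
  rw [← key i j, (h.isRestIdem_atlas i j).comm (h.isRestIdem_atlas j i), key]

theorem p_comp_atlas_eq (i j : K) : p i ≫ φ i j = rest (p i) ≫ p j := by
  rw [← h.atlas, ← Category.assoc, (h.inverse i).1]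

theorem p_comp_atlas (i j : K) : p i ≫ φ i j = p j ≫ φ j i := by
  rw [h.p_comp_atlas_eq, h.p_comp_atlas_eq]
  conv_lhs => rw [← h.rest_p_comp j, ← Category.assoc, rest_comm, Category.assoc, h.rest_p_comp]

/-- A generalised element of the total space of a glueing is locally given by basic sections. -/
theorem rest_comp_p_comp {T : C} (x : T ⟶ A) (i : K) :
    rest (x ≫ p i) ≫ x = x ≫ p i ≫ s i := by
  rw [← comp_rest, (h.inverse i).1]

variable [IsJoinRestriction C]

/-- Maps out of the total space of a glueing are determined on the basic sections. -/
theorem hom_ext {Z : C} {a b : A ⟶ Z} (hab : ∀ i, s i ≫ a = s i ≫ b) : a = b := by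
  refine h.join.hom_ext (by rw [h.total.rest_eq, Category.id_comp])
    (by rw [h.total.rest_eq, Category.id_comp]) ?_
  rintro _ ⟨i, rfl⟩
  rw [← (h.inverse i).1, Category.assoc, hab, Category.assoc]

/-- The map is the join of the `p i ≫ g i`; the matching condition `h₂` makes these compatible.
Precomposing with `s i` gives the join over `j` of `φ i j ≫ g i`, whose largest member is the one
with `j = i`, namely `g i` by `h₁`. -/
theorem exists_desc {Z : C} (g : K → (X ⟶ Z)) (h₁ : ∀ i, φ i i ≫ g i = g i)
    (h₂ : ∀ i j, φ i j ≫ g i = φ i j ≫ g j) : ∃ a : A ⟶ Z, ∀ i, s i ≫ a = g i := by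
  have key : ∀ i j, rest (p j ≫ g j) ≫ p i ≫ g i = p j ≫ φ j i ≫ g j := by
    intro i j
    have e : rest (p j ≫ g j) = rest (p j ≫ g j) ≫ p j ≫ s j := by
      rw [(h.inverse j).1, rest_comm, rest_comp_le]
    rw [e, Category.assoc, Category.assoc, ← Category.assoc (s j), h.atlas, ← Category.assoc,
      ← comp_rest, Category.assoc, ← h₂ j i, ← Category.assoc (rest (g j)),
      (isRestIdem_rest (g j)).comm (h.isRestIdem_atlas j i), Category.assoc, rest_self]
  obtain ⟨a, ha, -⟩ := IsJoinRestriction.exists_join (Set.range fun i => p i ≫ g i) (by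
    rintro _ ⟨i, rfl⟩ _ ⟨j, rfl⟩
    unfold Compatible
    dsimp only
    rw [key, key, h₂, ← Category.assoc, h.p_comp_atlas, Category.assoc])
  refine ⟨a, fun i => (ha.comp (s i)).unique ?_⟩
  have e : ∀ j, s i ≫ p j ≫ g j = φ i j ≫ g i := fun j => by
    rw [← Category.assoc, h.atlas, h₂]
  refine isJoin_of_mem ⟨_, ⟨i, rfl⟩, ?_⟩ ?_
  · rw [e, h₁]
  · rintro _ ⟨_, ⟨j, rfl⟩, rfl⟩
    dsimp only
    rw [e]
    exact (h.isRestIdem_atlas i j).rle _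

/-- The map out of the total space of a glueing given by a compatible family. -/
noncomputable def desc {Z : C} (g : K → (X ⟶ Z)) (h₁ : ∀ i, φ i i ≫ g i = g i)
    (h₂ : ∀ i j, φ i j ≫ g i = φ i j ≫ g j) : A ⟶ Z := (h.exists_desc g h₁ h₂).choose

theorem s_desc {Z : C} (g : K → (X ⟶ Z)) (h₁ : ∀ i, φ i i ≫ g i = g i)
    (h₂ : ∀ i j, φ i j ≫ g i = φ i j ≫ g j) (i : K) : s i ≫ h.desc g h₁ h₂ = g i :=
  (h.exists_desc g h₁ h₂).choose_spec i

theorem isTotal_of_rest_eq {Z : C} {a : A ⟶ Z} (ha : ∀ i, rest (s i ≫ a) = rest (s i)) :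
    IsTotal a :=
  ⟨h.hom_ext fun i => by rw [comp_rest, ha, rest_self, Category.comp_id]⟩

/-- As `q` is total, `x` has the domain of `x ≫ q`, which is the join of the `x ≫ p i`. Thus every
generalised element lies locally in a single sheet. -/
theorem isJoin_rest_comp {T : C} (x : T ⟶ A) :
    IsJoin {e | ∃ i, e = rest (x ≫ p i)} (rest x) := by
  have := h.total
  have hj := (h.join.comp x).rest
  rw [rest_comp_total] at hj
  refine isJoin_image_eq hj ?_
  ext e
  constructor
  · rintro ⟨i, rfl⟩
    exact ⟨_, ⟨_, ⟨i, rfl⟩, rfl⟩, rfl⟩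
  · rintro ⟨_, ⟨_, ⟨i, rfl⟩, rfl⟩, rfl⟩
    exact ⟨i, rfl⟩

/-- The form in which that cover is used: an equation between maps out of `T` may be checked where
`x` lies in the sheet of `p i`. -/
theorem gen_ext {T Z : C} (x : T ⟶ A) {a b : T ⟶ Z} (ha : rest x ≫ a = a)
    (hb : rest x ≫ b = b) (hab : ∀ i, rest (x ≫ p i) ≫ a = rest (x ≫ p i) ≫ b) : a = b := by
  have hj := h.isJoin_rest_comp x
  refine hj.hom_ext (by rwa [rest_rest]) (by rwa [rest_rest]) ?_
  rintro _ ⟨i, rfl⟩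
  rw [rest_rest, hab]

end IsGlueing

theorem IsPartialSection.rest_comp_eq {A X : C} {q : A ⟶ X} {s : X ⟶ A}
    (h : IsPartialSection q s) : s ≫ q = rest s := h

theorem pullbackSection_fst {E X Y : C} (q : E ⟶ X) (f : Y ⟶ X) [HasPullback q f]
    (s : X ⟶ E) (hs : IsPartialSection q s) :
    pullbackSection q f s hs ≫ pullback.fst q f = f ≫ s := pullback.lift_fst _ _ _

theorem pullbackSection_snd {E X Y : C} (q : E ⟶ X) (f : Y ⟶ X) [HasPullback q f]
    (s : X ⟶ E) (hs : IsPartialSection q s) :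
    pullbackSection q f s hs ≫ pullback.snd q f = rest (f ≫ s) := pullback.lift_snd _ _ _

theorem rest_pullbackSection {E X Y : C} (q : E ⟶ X) (f : Y ⟶ X) [HasPullback q f] [IsTotal q]
    [IsTotal f] (s : X ⟶ E) (hs : IsPartialSection q s) :
    rest (pullbackSection q f s hs) = rest (f ≫ s) := by
  rw [← rest_comp_total _ (pullback.fst q f), pullbackSection_fst]

/-- A pair of generalised elements whose first component is given by a partial section. -/
theorem lift_eq_comp_pullbackSection {E X Y T : C} (q : E ⟶ X) (f : Y ⟶ X) [HasPullback q f]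
    [IsTotal q] [IsTotal f] (s : X ⟶ E) (hs : IsPartialSection q s) (y : T ⟶ E) (x : T ⟶ Y)
    (h : y ≫ q = x ≫ f) (e : y = x ≫ f ≫ s) :
    pullback.lift y x h = x ≫ pullbackSection q f s hs := by
  apply pullback.hom_ext
  · rw [pullback.lift_fst, Category.assoc, pullbackSection_fst, e]
  · rw [pullback.lift_snd, Category.assoc, pullbackSection_snd, comp_rest, ← e,
      ← rest_comp_total y q, h, rest_comp_total, rest_self]

theorem comp_isRestIdem {A B : C} (f : A ⟶ B) {e : B ⟶ B} (he : IsRestIdem e) :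
    rest (f ≫ e) ≫ f = f ≫ e := by
  rw [← comp_rest, he.eq]

variable [IsJoinRestriction C]

/-- Glueings are stable under pullback along total maps. -/
theorem IsGlueing.pullback {A X : C} {K : Type v} {φ : K → K → (X ⟶ X)} {q : A ⟶ X}
    {p : K → (A ⟶ X)} {s : K → (X ⟶ A)} (h : IsGlueing φ q p s) {Y : C} (f : Y ⟶ X)
    [IsTotal f] [IsTotal q] [HasPullback q f] :
    IsGlueing (fun i j => rest (f ≫ φ i j)) (pullback.snd q f)
      (fun i => rest (pullback.fst q f ≫ p i) ≫ pullback.snd q f)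
      (fun i => pullbackSection q f (s i) (h.isPartialSection i)) where
  total := inferInstance
  inverse i := by
    constructor
    · rw [rest_comp_total _ (CategoryTheory.Limits.pullback.snd q f), rest_rest]
      have e : (rest (pullback.fst q f ≫ p i) ≫ pullback.snd q f) ≫ f ≫ s i =
          rest (pullback.fst q f ≫ p i) ≫ pullback.fst q f := by
        rw [Category.assoc, ← Category.assoc (pullback.snd q f), ← pullback.condition,
          Category.assoc, ← Category.assoc, h.rest_comp_p_comp]
        simp only [Category.assoc]
        rw [← Category.assoc (s i), h.s_comp, rest_self]
      apply pullback.hom_ext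
      · rw [Category.assoc, pullbackSection_fst, e]
      · rw [Category.assoc, pullbackSection_snd, comp_rest, e, rest_comp_total _ (CategoryTheory.Limits.pullback.fst q f), rest_rest,
          rest_comp_cancel]
    · rw [rest_pullbackSection, ← Category.assoc, comp_rest, ← Category.assoc,
        pullbackSection_fst, Category.assoc, Category.assoc, (h.inverse i).2, rest_comp_rest,
        pullbackSection_snd, rest_idem]
  join := by
    -- The sheets of the pullback are the preimages of the sheets of `A` under the first projection;
    -- since both projections are total, these cover the domain of the second.
    have hj := h.isJoin_rest_comp (pullback.fst q f)
    rw [(isTotal_fst q f).rest_eq, ← (isTotal_snd q f).rest_eq] at hj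
    refine isJoin_image_eq hj.restrict ?_
    ext k
    constructor
    · rintro ⟨i, rfl⟩
      exact ⟨_, ⟨i, rfl⟩, rfl⟩
    · rintro ⟨_, ⟨i, rfl⟩, rfl⟩
      exact ⟨i, rfl⟩
  atlas i j := by
    rw [← Category.assoc, comp_rest, ← Category.assoc, pullbackSection_fst, Category.assoc,
      Category.assoc, h.atlas, pullbackSection_snd]
    refine (RLe.comp_eq (isRestIdem_rest _) ?_)
    rw [← rest_comp_rest f (s i), h.rest_s, ← h.atlas_comp_self i j, (h.isRestIdem_atlas i j).comm
      (h.isRestIdem_atlas i i), ← Category.assoc]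
    exact rest_rle_rest_comp _ _

/-- Local homeomorphisms have pullbacks along total maps. -/
theorem IsGlueing.hasPullback (hC : HasLocalGlueings C) {A X : C} {K : Type v}
    {φ : K → K → (X ⟶ X)} {q : A ⟶ X} {p : K → (A ⟶ X)} {s : K → (X ⟶ A)}
    (h : IsGlueing φ q p s) {Y : C} (f : Y ⟶ X) [IsTotal f] : HasPullback q f := by
  have := h.total
  -- The candidate for the pullback is a glueing over `Y` of the atlas pulled back along `f`.
  obtain ⟨E, b, p', s', h'⟩ := hC Y K
    { φ := fun i j => rest (f ≫ φ i j)
      isRestIdem := fun i j => isRestIdem_rest _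
      symm := fun i j => by rw [h.atlas_symm]
      trans := fun i j k => by
        have e : rest (f ≫ φ i j) ≫ rest (f ≫ φ j k) =
            rest (f ≫ φ i j) ≫ rest (f ≫ φ i k) := by
          rw [← rest_rest_comp, ← rest_rest_comp, ← Category.assoc, ← Category.assoc,
            comp_isRestIdem f (h.isRestIdem_atlas i j), Category.assoc, h.atlas_comp_atlas,
            Category.assoc]
        rw [e]
        exact (isRestIdem_rest _).rle _ }
  have h' : IsGlueing (fun i j => rest (f ≫ φ i j)) b p' s' := h'
  have := h'.total
  have hf : ∀ i j, rest (f ≫ φ i j) ≫ f = f ≫ φ i j :=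
    fun i j => comp_isRestIdem f (h.isRestIdem_atlas i j)
  have rest_s' : ∀ i, rest (s' i) = rest (f ≫ s i) := fun i => by
    rw [h'.rest_s, ← h.rest_s, rest_comp_rest]
  -- The projection to `A` carries the basic section `s' i` to `f ≫ s i`.
  obtain ⟨a, ha⟩ := h'.exists_desc (fun i => f ≫ s i)
    (fun i => by rw [← Category.assoc, hf, Category.assoc, ← h.rest_s, rest_self])
    (fun i j => by
      rw [← Category.assoc, ← Category.assoc, hf, Category.assoc, Category.assoc,
        h.atlas_comp_s])
  have ha_total : IsTotal a := h'.isTotal_of_rest_eq fun i => by rw [ha, rest_s']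
  have w : a ≫ q = b ≫ f := h'.hom_ext fun i => by
    rw [← Category.assoc, ha, Category.assoc, h.s_comp, h.rest_s, ← Category.assoc, h'.s_comp,
      h'.rest_s, hf]
  -- The sheet `p' i` is the preimage of the sheet `p i` under `a`; this is what makes lifts unique.
  have hap : ∀ i, rest (a ≫ p i) = rest (p' i) := fun i => h'.hom_ext fun j => by
    rw [comp_rest, comp_rest, ← Category.assoc, ha, Category.assoc, h.atlas, h'.atlas, rest_rest]
  refine hasPullback_of_exists_lift a b w fun T x y hxy => ?_
  have hx : ∀ i, rest (x ≫ p i) ≫ rest x = rest (x ≫ p i) := fun i => by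
    rw [rest_comm, rest_comp_le]
  have rest_xy : rest x = rest y := by
    rw [← rest_comp_total x q, hxy, rest_comp_total]
  have e1 : ∀ i j, rest (y ≫ f ≫ φ i j) = rest (x ≫ q ≫ φ i j) := fun i j => by
    rw [← Category.assoc, ← hxy, Category.assoc]
  have e2 : ∀ i, rest (x ≫ p i) ≫ x ≫ q = x ≫ p i := fun i => by
    rw [← Category.assoc, ← comp_rest, Category.assoc, h.rest_p_comp]
  have hy : ∀ i, rest (rest (x ≫ p i) ≫ y ≫ s' i) = rest (x ≫ p i) := fun i => by
    rw [rest_rest_comp, ← rest_comp_rest y, h'.rest_s, rest_comp_rest, e1, ← rest_rest_comp,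
      ← Category.assoc x, ← Category.assoc, e2, Category.assoc, ← h.rest_s, ← Category.assoc,
      rest_comp_rest, Category.assoc, (h.inverse i).1, rest_comp_rest]
  -- Where `x` lies in sheet `i`, a lift of `(x, y)` can only be `y ≫ s' i`; the lift is the join of
  -- these pieces. Where `x` lies in two sheets `i` and `j`, the map `y ≫ f` lands in `φ i j`, and
  -- there `s' i` and `s' j` coincide.
  obtain ⟨t, ht, -⟩ := IsJoinRestriction.exists_join
    (Set.range fun i => rest (x ≫ p i) ≫ y ≫ s' i) (by
      have key : ∀ i j, rest (x ≫ p j) ≫ rest (x ≫ p i) ≫ y ≫ s' i =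
          (rest (x ≫ p j) ≫ rest (x ≫ p i)) ≫ y ≫ rest (f ≫ φ i j) ≫ s' i := by
        intro i j
        have e3 : (rest (x ≫ p j) ≫ rest (x ≫ p i)) ≫ rest (y ≫ f ≫ φ i j) =
            rest (x ≫ p j) ≫ rest (x ≫ p i) := by
          rw [e1, Category.assoc, ← rest_rest_comp (x ≫ p i), ← Category.assoc x,
            ← Category.assoc (rest (x ≫ p i)), e2, Category.assoc, h.p_comp_atlas_eq,
            ← Category.assoc x, comp_rest x, Category.assoc (rest _) x, rest_rest_comp,
            rest_comm (x ≫ p i), rest_comp_cancel]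
        rw [← Category.assoc y, comp_rest y, Category.assoc (rest _) y,
          ← Category.assoc (_ ≫ _) (rest (y ≫ f ≫ φ i j)), e3, Category.assoc]
      rintro _ ⟨i, rfl⟩ _ ⟨j, rfl⟩
      unfold Compatible
      dsimp only
      rw [hy, hy, key, key, rest_comm (x ≫ p j), h.atlas_symm j i, h'.atlas_comp_s i j])
  have ht' : ∀ i, rest (x ≫ p i) ≫ rest x ≫ t = rest (x ≫ p i) ≫ y ≫ s' i := fun i => by
    rw [← Category.assoc, hx]
    have := ht.rle ⟨i, rfl⟩
    unfold RLe at this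
    rw [hy] at this
    exact this.symm
  -- Precomposing with `rest x` puts the lift visibly inside the domain of `x`, as `gen_ext`
  -- requires.
  refine ⟨rest x ≫ t, ?_, ?_, fun t' h₁ h₂ => ?_⟩
  · refine h.gen_ext x (by rw [Category.assoc, rest_comp_cancel]) (rest_self x) fun i => ?_
    rw [← Category.assoc, ht', Category.assoc, Category.assoc, ha, ← Category.assoc y, ← hxy,
      h.rest_comp_p_comp, ← Category.assoc x, ← Category.assoc, e2, Category.assoc]
  · refine h.gen_ext x (by rw [Category.assoc, rest_comp_cancel])
      (by rw [rest_xy, rest_self]) fun i => ?_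
    rw [← Category.assoc, ht', Category.assoc, Category.assoc, h'.s_comp, comp_rest,
      ← Category.assoc, ← rest_rest_comp, hy]
  · have rest_t' : rest t' = rest x := by rw [← h₁, rest_comp_total]
    refine h.gen_ext x (by rw [← rest_t', rest_self]) (rest_comp_cancel _ _) fun i => ?_
    rw [ht']
    -- Over sheet `i` an arbitrary lift factors through the basic section `s' i`, so it is
    -- determined by its projection to `Y`.
    have e4 : rest (x ≫ p i) ≫ t' = t' ≫ p' i ≫ s' i := by
      rw [← h₁, Category.assoc, ← comp_rest, hap, (h'.inverse i).1]
    rw [← h₂, Category.assoc, ← Category.assoc _ t', e4, Category.assoc, Category.assoc,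
      ← Category.assoc (s' i), h'.s_comp, rest_self]

end Glueing

/-! ### The glueing of a local homeomorphism by all of its partial sections -/

section Sections

variable {C : Type u} [Category.{v} C] [RestrictionCategory C]

theorem IsLocalHomeo.exists_isGlueing {A X : C} {q : A ⟶ X} (hq : IsLocalHomeo q) :
    ∃ (K : Type v) (p : K → (A ⟶ X)) (s : K → (X ⟶ A)),
      IsGlueing (fun i j => s i ≫ p j) q p s := by
  obtain ⟨hq, S, hS, hj⟩ := hq
  choose t ht using hS
  exact ⟨S, fun i => i.1, fun i => t i.1 i.2,
    { total := hq
      inverse := fun i => ht i.1 i.2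
      join := by rwa [Subtype.range_coe]
      atlas := fun i j => rfl }⟩

variable [IsJoinRestriction C]

/-- The partial inverse of a partial section `s` of `q`. -/
noncomputable def sectionInv {A X : C} (q : A ⟶ X) (s : X ⟶ A) : A ⟶ X :=
  agreement (q ≫ s) (𝟙 A) ≫ q

theorem rest_sectionInv {A X : C} (q : A ⟶ X) [IsTotal q] (s : X ⟶ A) :
    rest (sectionInv q s) = agreement (q ≫ s) (𝟙 A) := by
  unfold sectionInv
  rw [rest_comp_total, (isRestIdem_agreement _ _).eq]

/-- The inverse of a partial section `s` is `q` restricted to the locus where `q ≫ s` is the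
identity, i.e. to the image of `s`. Being a local homeomorphism enters by making this locus large
enough. All sections are needed, rather than a chosen basis, because maps between externalisations
act on all of them. -/
theorem isGlueing_sections {A X : C} {q : A ⟶ X} (hq : IsLocalHomeo q) :
    IsGlueing (fun s t : {s : X ⟶ A // IsPartialSection q s} => s.1 ≫ sectionInv q t.1) q
      (fun s => sectionInv q s.1) (fun s => s.1) := by
  have := hq.1
  obtain ⟨K, p, s, h⟩ := hq.exists_isGlueing
  -- The idempotent `t ≫ p i` is the part of `X` on which `t` agrees with `s i`. A point of sheet
  -- `i` lying over that part is recovered from its image in `X` by `s i`, hence also by `t`.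
  have key : ∀ (t : X ⟶ A) (_ : IsPartialSection q t) (i : K),
      RLe (rest (p i ≫ t ≫ p i)) (agreement (q ≫ t) (𝟙 A)) := by
    intro t ht i
    have e1 : rest (t ≫ p i) = t ≫ p i := by
      refine RLe.isRestIdem (isRestIdem_rest t) ?_
      rw [← ht.rest_comp_eq]
      exact (h.p_rle i).comp_left t
    have e2 : rest (p i ≫ t ≫ p i) ≫ q ≫ t = rest (p i ≫ t ≫ p i) := by
      have e3 : (t ≫ p i) ≫ t = (t ≫ p i) ≫ s i := by
        rw [← e1, ← comp_rest, e1, Category.assoc, (h.inverse i).1]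
      have e4 : rest (p i ≫ t ≫ p i) ≫ q = p i ≫ t ≫ p i := by
        rw [← rest_comp_le, rest_comm, Category.assoc, h.rest_p_comp, ← comp_rest, e1]
      rw [← Category.assoc, e4, Category.assoc, e3, ← Category.assoc, ← e1, comp_rest,
        Category.assoc, (h.inverse i).1, rest_comm, rest_comp_le, rest_rest_comp, rest_comm,
        rest_comp_le]
    refine rle_agreement (isRestIdem_rest _) ?_ (by rw [rest_id, Category.comp_id])
      (by rw [e2, Category.comp_id])
    rw [← rest_rest_comp, e2, rest_rest]
  refine ⟨this, fun t => ⟨?_, ?_⟩, ⟨?_, fun k hk => h.join.2 k ?_⟩, fun _ _ => rfl⟩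
  · rw [rest_sectionInv]
    unfold sectionInv
    rw [Category.assoc, agreement_comp, Category.comp_id]
  · have ht := t.2.rest_comp_eq
    -- It has to be seen that `t` lands in its own locus; this is local, so it is checked where `t`
    -- lies in sheet `i`, using `key`.
    refine h.gen_ext t.1 ?_ (rest_idem _) fun i => ?_
    · rw [rest_self_assoc]
    have e1 : rest (t.1 ≫ p i) = t.1 ≫ p i := by
      refine RLe.isRestIdem (isRestIdem_rest t.1) ?_
      rw [← ht]
      exact (h.p_rle i).comp_left t.1
    have e5 : rest (t.1 ≫ p i ≫ t.1 ≫ p i) = rest (t.1 ≫ p i) := by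
      rw [← Category.assoc, ← e1, rest_idem, e1]
    have e6 := (key t.1 t.2 i).comp_eq (isRestIdem_agreement _ _)
    have e7 : rest (t.1 ≫ p i) ≫ t.1 = t.1 ≫ rest (p i ≫ t.1 ≫ p i) := by
      rw [comp_rest, e5]
    unfold sectionInv
    rw [← Category.assoc, e7, Category.assoc, ← Category.assoc (rest _), e6, ← Category.assoc,
      ← e7, Category.assoc, ht]
  · rintro _ ⟨t, rfl⟩
    exact (isRestIdem_agreement _ _).rle q
  · rintro _ ⟨i, rfl⟩
    -- Each `p i` lies below the inverse of the section `s i`, so the enlarged family still has join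
    -- `q`.
    refine RLe.trans ?_ (hk _ ⟨⟨s i, h.isPartialSection i⟩, rfl⟩)
    have e := key (s i) (h.isPartialSection i) i
    rw [(h.inverse i).2, (h.inverse i).symm.symm.comp_rest] at e
    have e' := e.comp_right q
    rwa [h.rest_p_comp] at e'

end Sections

/-! ### Externalisation is fully faithful on source-étale partite internal categories -/

theorem comp_pullback_lift {C : Type u} [Category.{v} C] {A X Y T S : C} {q : A ⟶ X} {f : Y ⟶ X}
    [HasPullback q f] (r : S ⟶ T) (y : T ⟶ A) (x : T ⟶ Y) (h : y ≫ q = x ≫ f) :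
    r ≫ pullback.lift y x h =
      pullback.lift (r ≫ y) (r ≫ x) (by rw [Category.assoc, h, Category.assoc]) := by
  apply pullback.hom_ext
  · rw [Category.assoc, pullback.lift_fst, pullback.lift_fst]
  · rw [Category.assoc, pullback.lift_snd, pullback.lift_snd]

section FullyFaithful

variable {C : Type u} [Category.{v} C] [RestrictionCategory C]

theorem RCatOver.Hom.heq_map_of_eq {P Q : RCatOver.{w} C} {F G : P ⟶ Q} (h : F = G)
    {x y : P.carrier} (f : x ⟶ y) :
    HEq ((RCatOver.Hom.functor F).map f) ((RCatOver.Hom.functor G).map f) := by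
  subst h; rfl

theorem RCatOver.Hom.heq_app_of_eq {P Q : RCatOver.{w} C} {F G : P ⟶ Q} (h : F = G)
    (x : P.carrier) :
    HEq ((RCatOver.Hom.trans F).app x) ((RCatOver.Hom.trans G).app x) := by
  subst h; rfl

/-! #### The cofunctor associated to a map of externalisations -/

section OfHom

variable {𝔸 𝔹 : PartiteCat.{w} C} (H : externalisation 𝔸 ⟶ externalisation 𝔹)

/-- The object part of a map between externalisations. -/
def homIdx (H : externalisation 𝔸 ⟶ externalisation 𝔹) (i : 𝔸.Idx) : 𝔹.Idx :=
  ((RCatOver.Hom.functor H).obj (⟨i⟩ : PhiObj 𝔸) : PhiObj 𝔹).idx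

/-- The components of the 2-cell of a map between externalisations. -/
def homObj (H : externalisation 𝔸 ⟶ externalisation 𝔹) (i : 𝔸.Idx) :
    𝔹.obj (homIdx H i) ⟶ 𝔸.obj i :=
  (RCatOver.Hom.trans H).app (⟨i⟩ : PhiObj 𝔸)

instance (i : 𝔸.Idx) : IsTotal (homObj H i) := RCatOver.Hom.total H _

/-- The action of a map between externalisations, as a map on partial sections. -/
def homSec (H : externalisation 𝔸 ⟶ externalisation 𝔹) {i j : 𝔸.Idx} (s : 𝔸.obj i ⟶ 𝔸.arr i j)
    (hs : IsPartialSection (𝔸.src i j) s) :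
    𝔹.obj (homIdx H i) ⟶ 𝔹.arr (homIdx H i) (homIdx H j) :=
  ((RCatOver.Hom.functor H).map (⟨s, hs⟩ : (⟨i⟩ : PhiObj 𝔸) ⟶ ⟨j⟩)).1

theorem isPartialSection_homSec {i j : 𝔸.Idx} (s : 𝔸.obj i ⟶ 𝔸.arr i j)
    (hs : IsPartialSection (𝔸.src i j) s) :
    IsPartialSection (𝔹.src (homIdx H i) (homIdx H j)) (homSec H s hs) :=
  ((RCatOver.Hom.functor H).map (⟨s, hs⟩ : (⟨i⟩ : PhiObj 𝔸) ⟶ ⟨j⟩)).2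

theorem homSec_congr {i j : 𝔸.Idx} {s t : 𝔸.obj i ⟶ 𝔸.arr i j}
    (hs : IsPartialSection (𝔸.src i j) s) (e : s = t) :
    homSec H s hs = homSec H t (e ▸ hs) := by subst e; rfl

theorem homSec_tgt {i j : 𝔸.Idx} (s : 𝔸.obj i ⟶ 𝔸.arr i j)
    (hs : IsPartialSection (𝔸.src i j) s) :
    homSec H s hs ≫ 𝔹.tgt _ _ ≫ homObj H j = homObj H i ≫ s ≫ 𝔸.tgt i j :=
  (Category.assoc _ _ _).symm.trans
    ((RCatOver.Hom.trans H).naturality (⟨s, hs⟩ : (⟨i⟩ : PhiObj 𝔸) ⟶ ⟨j⟩))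

theorem homSec_one (i : 𝔸.Idx) :
    homSec H (𝔸.one i) (𝔸.str.isPartialSection_one i) = 𝔹.one (homIdx H i) :=
  congrArg Subtype.val ((RCatOver.Hom.functor H).map_id (⟨i⟩ : PhiObj 𝔸))

theorem homSec_comp {i j k : 𝔸.Idx} (s : 𝔸.obj i ⟶ 𝔸.arr i j) (t : 𝔸.obj j ⟶ 𝔸.arr j k)
    (hs : IsPartialSection (𝔸.src i j) s) (ht : IsPartialSection (𝔸.src j k) t) :
    homSec H (𝔸.str.secComp s t ht) (𝔸.str.isPartialSection_secComp s t hs ht) =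
      𝔹.str.secComp (homSec H s hs) (homSec H t ht) (isPartialSection_homSec H t ht) :=
  congrArg Subtype.val ((RCatOver.Hom.functor H).map_comp
    (⟨s, hs⟩ : (⟨i⟩ : PhiObj 𝔸) ⟶ ⟨j⟩) (⟨t, ht⟩ : (⟨j⟩ : PhiObj 𝔸) ⟶ ⟨k⟩))

/-- The 2-cell has total components, so naturality fixes the domain of the image of a section. -/
theorem rest_homSec {i j : 𝔸.Idx} (s : 𝔸.obj i ⟶ 𝔸.arr i j)
    (hs : IsPartialSection (𝔸.src i j) s) :
    rest (homSec H s hs) = rest (homObj H i ≫ s) := by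
  rw [← rest_comp_total _ (𝔹.tgt _ _ ≫ homObj H j), homSec_tgt, ← Category.assoc,
    rest_comp_total]

theorem IsPartialSection.rest_comp {A X Y : C} {q : A ⟶ X} {s : X ⟶ A}
    (hs : IsPartialSection q s) (d : X ⟶ Y) : IsPartialSection q (rest d ≫ s) := by
  unfold IsPartialSection
  rw [Category.assoc, hs, rest_rest_comp]

/-- In `Φ𝔸` the section `rest d ≫ s` is the composite of the restriction idempotent `rest d ≫ one i`
with `s`. A restriction functor sends this idempotent to a restriction idempotent, whose domain is
given by `rest_homSec`. -/
theorem homSec_rest_comp {i j : 𝔸.Idx} {X : C} (d : 𝔸.obj i ⟶ X) (s : 𝔸.obj i ⟶ 𝔸.arr i j)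
    (hs : IsPartialSection (𝔸.src i j) s) :
    homSec H (rest d ≫ s) (hs.rest_comp d) = rest (homObj H i ≫ d) ≫ homSec H s hs := by
  let d' : (⟨i⟩ : PhiObj 𝔸) ⟶ ⟨i⟩ := ⟨rest d ≫ 𝔸.one i, 𝔸.str.isPartialSection_rest_one d⟩
  have e1 : d' = rest d' := by
    apply Subtype.ext
    rw [phi_rest_val, rest_comp_total, rest_rest]
  have e2 : homSec H (rest d ≫ 𝔸.one i) (𝔸.str.isPartialSection_rest_one d) =
      rest (homObj H i ≫ d) ≫ 𝔹.one (homIdx H i) := by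
    refine (congrArg (fun z => ((RCatOver.Hom.functor H).map z).1) e1).trans ?_
    refine (congrArg Subtype.val (RCatOver.Hom.isRestriction H d')).trans ?_
    refine congrArg (fun z => z ≫ 𝔹.one (homIdx H i)) ?_
    refine (rest_homSec H (rest d ≫ 𝔸.one i) (𝔸.str.isPartialSection_rest_one d)).trans ?_
    rw [← Category.assoc, rest_comp_total, rest_comp_rest]
  have e3 := homSec_comp H (rest d ≫ 𝔸.one i) s (𝔸.str.isPartialSection_rest_one d) hs
  rw [homSec_congr H _ (𝔸.str.rest_one_secComp d s hs)] at e3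
  rw [e3]
  refine Eq.trans ?_ (𝔹.str.rest_one_secComp (homObj H i ≫ d) (homSec H s hs)
    (isPartialSection_homSec H s hs))
  congr 1

variable [IsJoinRestriction C]

theorem pullback_hom_ext_of_isLocalHomeo {A X Y Z : C} {q : A ⟶ X} (hq : IsLocalHomeo q)
    {f : Y ⟶ X} [IsTotal f] [HasPullback q f] {a b : pullback q f ⟶ Z}
    (h : ∀ s hs, pullbackSection q f s hs ≫ a = pullbackSection q f s hs ≫ b) : a = b := by
  have := hq.1
  exact ((isGlueing_sections hq).pullback f).hom_ext fun s => h s.1 s.2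

/-- The index function and the `F_i` can be read off from the functor and its 2-cell. The `F_ij` are
determined by their composites with pulled-back sections, and these composites are the action on
sections. -/
theorem externalisationMap_injective {𝔸 𝔹 : PartiteCat.{w} C} (h𝔸 : 𝔸.IsSourceEtale)
    {F G : Cofunctor 𝔸 𝔹} (h : externalisationMap F = externalisationMap G) : F = G := by
  obtain ⟨idx, o, a, p₁, p₂, p₃, p₄, p₅⟩ := F
  obtain ⟨idx', o', a', q₁, q₂, q₃, q₄, q₅⟩ := G
  obtain rfl : idx = idx' := by
    funext i
    have := congrArg (fun H => ((RCatOver.Hom.functor H).obj (⟨i⟩ : PhiObj 𝔸) : PhiObj 𝔹).idx) h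
    exact this
  obtain rfl : o = o' := by
    funext i
    exact eq_of_heq (RCatOver.Hom.heq_app_of_eq h (⟨i⟩ : PhiObj 𝔸))
  obtain rfl : a = a' := by
    funext i j
    refine pullback_hom_ext_of_isLocalHomeo (h𝔸 i j) fun s hs => ?_
    have := eq_of_heq (RCatOver.Hom.heq_map_of_eq h (x := (⟨i⟩ : PhiObj 𝔸))
      (y := (⟨j⟩ : PhiObj 𝔸)) (⟨s, hs⟩ : (⟨i⟩ : PhiObj 𝔸) ⟶ ⟨j⟩))
    exact congrArg Subtype.val this
  rfl

/-- The pulled-back sections exhibit the fibre product as a glueing over `𝔹.obj (homIdx H i)`. The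
images under `H` form a matching family because two sections have the same restriction to their
overlap and `H` commutes with restriction. -/
theorem exists_homArr (h𝔸 : 𝔸.IsSourceEtale) (i j : 𝔸.Idx) :
    ∃ a : pullback (𝔸.src i j) (homObj H i) ⟶ 𝔹.arr (homIdx H i) (homIdx H j),
      ∀ s hs, pullbackSection (𝔸.src i j) (homObj H i) s hs ≫ a = homSec H s hs := by
  have h := isGlueing_sections (h𝔸 i j)
  obtain ⟨a, ha⟩ := (h.pullback (homObj H i)).exists_desc (fun s => homSec H s.1 s.2)
    (fun s => by
      rw [← h.rest_s, rest_comp_rest, ← rest_homSec H s.1 s.2, rest_self])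
    (fun s t => by
      rw [← (h.isRestIdem_atlas s t).eq, rest_comp_rest, ← homSec_rest_comp, ← homSec_rest_comp]
      apply homSec_congr
      rw [(h.isRestIdem_atlas s t).eq, h.atlas_comp_s])
  exact ⟨a, fun s hs => ha ⟨s, hs⟩⟩

/-- The arrow part of the cofunctor associated to a map of externalisations. -/
noncomputable def homArr (h𝔸 : 𝔸.IsSourceEtale) (i j : 𝔸.Idx) :
    pullback (𝔸.src i j) (homObj H i) ⟶ 𝔹.arr (homIdx H i) (homIdx H j) :=
  (exists_homArr H h𝔸 i j).choose

theorem pullbackSection_homArr (h𝔸 : 𝔸.IsSourceEtale) {i j : 𝔸.Idx} (s : 𝔸.obj i ⟶ 𝔸.arr i j)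
    (hs : IsPartialSection (𝔸.src i j) s) :
    pullbackSection (𝔸.src i j) (homObj H i) s hs ≫ homArr H h𝔸 i j = homSec H s hs :=
  (exists_homArr H h𝔸 i j).choose_spec s hs

theorem comp_homArr (h𝔸 : 𝔸.IsSourceEtale) {i j : 𝔸.Idx} {T : C} (s : 𝔸.obj i ⟶ 𝔸.arr i j)
    (hs : IsPartialSection (𝔸.src i j) s) (y : T ⟶ 𝔸.arr i j) (x : T ⟶ 𝔹.obj (homIdx H i))
    (h : y ≫ 𝔸.src i j = x ≫ homObj H i) (e : y = x ≫ homObj H i ≫ s) :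
    pullback.lift y x h ≫ homArr H h𝔸 i j = x ≫ homSec H s hs := by
  rw [lift_eq_comp_pullbackSection _ _ s hs y x h e, Category.assoc, pullbackSection_homArr]

/-- The cofunctor associated to a map of externalisations. -/
noncomputable def cofunctorOfHom (h𝔸 : 𝔸.IsSourceEtale) : Cofunctor 𝔸 𝔹 where
  idx := homIdx H
  obj := homObj H
  arr := homArr H h𝔸
  arr_total i j := ⟨pullback_hom_ext_of_isLocalHomeo (h𝔸 i j) fun s hs => by
    rw [comp_rest, pullbackSection_homArr, Category.comp_id, rest_homSec,
      ← rest_pullbackSection _ _ _ hs, rest_self]⟩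
  arr_src i j := pullback_hom_ext_of_isLocalHomeo (h𝔸 i j) fun s hs => by
    rw [← Category.assoc, pullbackSection_homArr, pullbackSection_snd,
      (isPartialSection_homSec H s hs).rest_comp_eq, rest_homSec]
  arr_tgt i j := pullback_hom_ext_of_isLocalHomeo (h𝔸 i j) fun s hs => by
    rw [← Category.assoc, pullbackSection_homArr, homSec_tgt, ← Category.assoc,
      ← Category.assoc, pullbackSection_fst]
  arr_one i := by
    rw [comp_homArr H h𝔸 (𝔸.one i) (𝔸.str.isPartialSection_one i) _ _ _
      (Category.id_comp _).symm, homSec_one, Category.id_comp]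
  arr_mul i j k := by
    -- The triple fibre product is the pullback of `src j k` along a map from the double one, so it
    -- is tested first on sections `t` of `src j k`, then on sections `s` of `src i j`.
    refine pullback_hom_ext_of_isLocalHomeo (h𝔸 j k) fun t ht =>
      pullback_hom_ext_of_isLocalHomeo (h𝔸 i j) fun s hs => ?_
    -- `r` is the resulting generalised composable triple and `ρ` its domain. Both are introduced
    -- through equations, which keeps them opaque to rewriting.
    obtain ⟨r, hr⟩ : ∃ r, r = pullbackSection (𝔸.src i j) (homObj H i) s hs ≫ pullbackSection (𝔸.src j k)
      (pullback.fst (𝔸.src i j) (homObj H i) ≫ 𝔸.tgt i j) t ht := ⟨_, rfl⟩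
    obtain ⟨ρ, hρ⟩ : ∃ ρ, ρ = rest (homObj H i ≫ s ≫ 𝔸.tgt i j ≫ t) := ⟨_, rfl⟩
    have r_fst : r ≫ pullback.fst _ _ = homObj H i ≫ s ≫ 𝔸.tgt i j ≫ t := by
      rw [hr, Category.assoc, pullbackSection_fst, ← Category.assoc, ← Category.assoc,
        pullbackSection_fst]
      simp only [Category.assoc]
    have r_snd : r ≫ pullback.snd _ _ = ρ ≫ pullbackSection _ _ s hs := by
      rw [hr, Category.assoc, pullbackSection_snd, comp_rest, ← Category.assoc, ← Category.assoc,
        pullbackSection_fst, hρ]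
      simp only [Category.assoc]
    have e0 : homSec H s hs ≫ 𝔹.tgt _ _ ≫ homObj H j ≫ t = homObj H i ≫ s ≫ 𝔸.tgt i j ≫ t := by
      have := congrArg (fun z => z ≫ t) (homSec_tgt H s hs)
      simpa only [Category.assoc] using this
    have e1 : rest (homSec H s hs ≫ 𝔹.tgt _ _ ≫ homSec H t ht) = ρ := by
      rw [hρ, ← e0, ← Category.assoc, ← rest_comp_rest, rest_homSec, rest_comp_rest,
        Category.assoc]
    have e2 : rest (homObj H i ≫ 𝔸.str.secComp s t ht) = ρ := by
      rw [← rest_comp_rest, 𝔸.str.rest_secComp, rest_comp_rest, hρ]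
    have e3 : ρ ≫ rest (homObj H i ≫ s) = ρ := by
      rw [hρ, rest_comm]
      simpa only [Category.assoc] using rest_comp_le (homObj H i ≫ s) (𝔸.tgt i j ≫ t)
    have r_snd_snd : r ≫ pullback.snd _ _ ≫ pullback.snd _ _ = ρ := by
      rw [← Category.assoc, r_snd, Category.assoc, pullbackSection_snd, e3]
    have r_snd_tgt : r ≫ pullback.snd _ _ ≫ homArr H h𝔸 i j ≫ 𝔹.tgt _ _ =
        ρ ≫ homSec H s hs ≫ 𝔹.tgt _ _ := by
      rw [← Category.assoc, r_snd, Category.assoc, ← Category.assoc (pullbackSection _ _ s hs),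
        pullbackSection_homArr]
    refine Eq.trans (Category.assoc _ _ _).symm (Eq.trans ?_ (Category.assoc _ _ _))
    rw [← hr]
    -- Evaluated at `r`, the side that multiplies in `𝔸` is the image of the composite section and
    -- the side that multiplies in `𝔹` is the composite of the images; functoriality of `H` equates
    -- them.
    refine Eq.trans (b := 𝔹.str.secComp (homSec H s hs) (homSec H t ht)
      (isPartialSection_homSec H t ht)) ?_ ?_
    · refine (Category.assoc _ _ _).symm.trans ?_
      rw [← homSec_comp _ _ _ hs, comp_pullback_lift]
      refine (comp_homArr H h𝔸 _ (𝔸.str.isPartialSection_secComp s t hs ht) _ _ _ ?_).trans ?_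
      · rw [r_snd_snd, ← e2, rest_self, 𝔸.str.secComp_eq]
        refine (𝔸.str.comp_cmp _ _ _ _).trans (Eq.trans ?_ (𝔸.str.comp_cmp _ _ _ _).symm)
        apply 𝔸.str.cmp_congr
        · exact r_fst
        · rw [← Category.assoc, r_snd, Category.assoc, pullbackSection_fst, ← Category.assoc,
            ← Category.assoc, comp_rest, hρ]
      · rw [r_snd_snd, ← e2, ← rest_homSec, rest_self]
    · rw [𝔹.str.secComp_eq]
      refine Eq.trans ?_ (𝔹.str.comp_cmp _ _ _ _).symm
      apply 𝔹.str.cmp_congr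
      · refine Eq.trans ?_ (Category.assoc _ _ _)
        rw [comp_pullback_lift]
        refine Eq.trans ?_ (comp_homArr H h𝔸 t ht _ _ _ ?_).symm
        · rw [r_snd_tgt, Category.assoc, ← e1, Category.assoc]
          exact (rest_self _).symm
        · rw [r_snd_tgt, r_fst, Category.assoc, Category.assoc, e0, hρ, rest_self]
      · refine Eq.trans ?_ (Category.assoc _ _ _)
        rw [r_snd, Category.assoc, pullbackSection_homArr, ← e1]

theorem externalisationMap_cofunctorOfHom (h𝔸 : 𝔸.IsSourceEtale) :
    externalisationMap (cofunctorOfHom H h𝔸) = H :=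
  RCatOver.Hom.ext' _ _ (fun _ => rfl)
    (fun _ _ s => heq_of_eq (Subtype.ext (pullbackSection_homArr H h𝔸 s.1 s.2)))
    (fun _ => HEq.rfl)

end OfHom

end FullyFaithful

/-! ### Construction of internalisations -/

section Internalise

variable {C : Type u} [Category.{v} C] [RestrictionCategory C]

theorem IsRestIdem.map {A : Type*} [Category A] [RestrictionCategory A] {B : Type*}
    [Category B] [RestrictionCategory B] {F : A ⥤ B} (hF : IsRestrictionFunctor F) {x : A}
    {e : x ⟶ x} (h : IsRestIdem e) : IsRestIdem (F.map e) := by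
  unfold IsRestIdem
  rw [← hF, h.eq]

/-- A choice of glueings for the local atlases induced by the hom-sets of `P`. -/
structure GlueingFamily (P : RCatOver.{w} C) [IsJoinRestriction P.carrier] where
  arr : P.carrier → P.carrier → C
  src : ∀ i j, arr i j ⟶ P.proj.obj i
  p : ∀ {i j : P.carrier} (_ : i ⟶ j), arr i j ⟶ P.proj.obj i
  s : ∀ {i j : P.carrier} (_ : i ⟶ j), P.proj.obj i ⟶ arr i j
  isGlueing : ∀ i j : P.carrier, IsGlueing (fun f g : i ⟶ j => P.proj.map (agreement f g))
    (src i j) (fun f => p f) (fun f => s f)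
  hasPullback : ∀ i j {Y : C} (f : Y ⟶ P.proj.obj i), IsTotal f → HasPullback (src i j) f

/-- Agreement idempotents form a local atlas on `i`, and restriction functors preserve the order and
restriction idempotents, hence atlases. The hom-sets of `P.carrier` lie in `Type v`, as an indexing
set of an atlas must. -/
theorem GlueingFamily.nonempty [IsJoinRestriction C] (hC : HasLocalGlueings C)
    (P : RCatOver.{w} C) [IsJoinRestriction P.carrier] : Nonempty (GlueingFamily P) := by
  have key : ∀ i j : P.carrier, ∃ (A : C) (q : A ⟶ P.proj.obj i)
      (p : (i ⟶ j) → (A ⟶ P.proj.obj i)) (s : (i ⟶ j) → (P.proj.obj i ⟶ A)),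
      IsGlueing (fun f g : i ⟶ j => P.proj.map (agreement f g)) q p s := fun i j =>
    hC (P.proj.obj i) (i ⟶ j)
      { φ := fun f g => P.proj.map (agreement f g)
        isRestIdem := fun f g => (isRestIdem_agreement f g).map P.isRestriction
        symm := fun f g => by rw [agreement_symm]
        trans := fun f g h => by
          rw [← P.proj.map_comp]
          exact (agreement_trans f g h).map P.isRestriction }
  choose A q p s h using key
  exact ⟨⟨A, q, fun {i j} => p i j, fun {i j} => s i j, h,
    fun i j _ f _ => (h i j).hasPullback hC f⟩⟩

namespace GlueingFamily

variable {P : RCatOver.{w} C} [IsJoinRestriction P.carrier] (G : GlueingFamily P)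

instance (i j : P.carrier) : IsTotal (G.src i j) := (G.isGlueing i j).total

instance (i j : P.carrier) {Y : C} (f : Y ⟶ P.proj.obj i) [h : IsTotal f] :
    HasPullback (G.src i j) f := G.hasPullback i j f h

/-! ### Basic sections of the objects of germs -/

theorem rest_s {i j : P.carrier} (f : i ⟶ j) : rest (G.s f) = P.proj.map (rest f) := by
  rw [(G.isGlueing i j).rest_s, agreement_self]

theorem isPartialSection_s {i j : P.carrier} (f : i ⟶ j) :
    IsPartialSection (G.src i j) (G.s f) := (G.isGlueing i j).isPartialSection f

theorem s_src {i j : P.carrier} (f : i ⟶ j) : G.s f ≫ G.src i j = P.proj.map (rest f) := by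
  rw [← rest_s]
  exact G.isPartialSection_s f

theorem map_agreement_comp_s {i j : P.carrier} (f g : i ⟶ j) :
    P.proj.map (agreement f g) ≫ G.s f = P.proj.map (agreement f g) ≫ G.s g :=
  (G.isGlueing i j).atlas_comp_s f g

/-- `e ≫ f` and `f` agree on the whole domain of `e ≫ f`, so the atlas relation identifies their
sections there. This is how equations in `P` become equations of sections. -/
theorem map_comp_s {i j : P.carrier} {e : i ⟶ i} (he : IsRestIdem e) (f : i ⟶ j) :
    P.proj.map e ≫ G.s f = G.s (e ≫ f) := by
  have e1 : agreement (e ≫ f) f = rest (e ≫ f) := by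
    refine ((agreement_rle _ _).trans ?_).antisymm (rle_agreement (isRestIdem_rest _)
      (rest_idem _) ?_ ?_)
    · rw [rest_comm]
      exact (isRestIdem_rest f).rle _
    · rw [he.rest_comp, Category.assoc, rest_idem]
    · rw [rest_self, he.rest_comp, Category.assoc, rest_self]
  have e2 := G.map_agreement_comp_s (e ≫ f) f
  rw [e1, ← rest_s, rest_self, rest_s, he.rest_comp, P.proj.map_comp, ← rest_s,
    Category.assoc, rest_self] at e2
  exact e2.symm

/-- Where `f` lands in the locus on which `g` and `h` agree, `f ≫ g` and `f ≫ h` agree. This is the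
matching condition for the composition of germs. -/
theorem s_comp_map_agreement {i j k : P.carrier} (f : i ⟶ j) {g h : j ⟶ k} :
    rest (P.proj.map f ≫ P.proj.map (agreement g h)) ≫ G.s (f ≫ g) =
      rest (P.proj.map f ≫ P.proj.map (agreement g h)) ≫ G.s (f ≫ h) := by
  rw [← P.proj.map_comp, ← P.isRestriction, G.map_comp_s (isRestIdem_rest _),
    G.map_comp_s (isRestIdem_rest _)]
  congr 1
  rw [← Category.assoc, ← Category.assoc, comp_isRestIdem f (isRestIdem_agreement g h),
    Category.assoc, agreement_comp, Category.assoc]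

variable [IsJoinRestriction C]

theorem hom_ext {i j : P.carrier} {Z : C} {a b : G.arr i j ⟶ Z}
    (h : ∀ f : i ⟶ j, G.s f ≫ a = G.s f ≫ b) : a = b := (G.isGlueing i j).hom_ext h

/-! ### The structure maps of the category of germs -/

/-- The target maps. -/
noncomputable def tgt (i j : P.carrier) : G.arr i j ⟶ P.proj.obj j :=
  (G.isGlueing i j).desc (fun f => P.proj.map f)
    (fun f => by rw [agreement_self, ← P.proj.map_comp, rest_self])
    (fun f g => by rw [← P.proj.map_comp, ← P.proj.map_comp, agreement_comp])

theorem s_tgt {i j : P.carrier} (f : i ⟶ j) : G.s f ≫ G.tgt i j = P.proj.map f :=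
  (G.isGlueing i j).s_desc _ _ _ f

instance (i j : P.carrier) : IsTotal (G.tgt i j) :=
  (G.isGlueing i j).isTotal_of_rest_eq fun f => by rw [s_tgt, rest_s, P.isRestriction]

/-- Composition with a fixed map of `P`, as an operation on germs. -/
noncomputable def mulRight (i : P.carrier) {j k : P.carrier} (g : j ⟶ k) :
    G.arr i j ⟶ G.arr i k :=
  (G.isGlueing i j).desc (fun f => G.s (f ≫ g))
    (fun f => by
      rw [agreement_self, G.map_comp_s (isRestIdem_rest f), rest_self_assoc])
    (fun f f' => by
      rw [G.map_comp_s (isRestIdem_agreement f f'), G.map_comp_s (isRestIdem_agreement f f'),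
        ← Category.assoc, agreement_comp, Category.assoc])

theorem s_mulRight {i j k : P.carrier} (f : i ⟶ j) (g : j ⟶ k) :
    G.s f ≫ G.mulRight i g = G.s (f ≫ g) :=
  (G.isGlueing i j).s_desc _ _ _ f

/-- A germ can be composed with `g` exactly when its target lies in the domain of `g`. -/
theorem rest_mulRight (i : P.carrier) {j k : P.carrier} (g : j ⟶ k) :
    rest (G.mulRight i g) = rest (G.tgt i j ≫ G.s g) := by
  refine G.hom_ext fun f => ?_
  rw [comp_rest, comp_rest, s_mulRight, rest_s, ← Category.assoc, s_tgt,
    ← rest_comp_rest (P.proj.map f), rest_s, ← P.proj.map_comp, ← P.isRestriction,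
    rest_comp_rest]

theorem mulRight_tgt (i : P.carrier) {j k : P.carrier} (g : j ⟶ k) :
    G.mulRight i g ≫ G.tgt i k = G.tgt i j ≫ P.proj.map g := by
  refine G.hom_ext fun f => ?_
  rw [← Category.assoc, s_mulRight, s_tgt, ← Category.assoc, s_tgt, P.proj.map_comp]

theorem mulRight_mulRight (i : P.carrier) {j k l : P.carrier} (g : j ⟶ k) (h : k ⟶ l) :
    G.mulRight i g ≫ G.mulRight i h = G.mulRight i (g ≫ h) := by
  refine G.hom_ext fun f => ?_
  rw [← Category.assoc, s_mulRight, s_mulRight, s_mulRight, Category.assoc]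

theorem mulRight_id (i j : P.carrier) : G.mulRight i (𝟙 j) = 𝟙 _ := by
  refine G.hom_ext fun f => ?_
  rw [s_mulRight, Category.comp_id, Category.comp_id]

theorem mulRight_src (i : P.carrier) {j k : P.carrier} (g : j ⟶ k) :
    G.mulRight i g ≫ G.src i k = rest (G.tgt i j ≫ G.s g) ≫ G.src i j := by
  refine G.hom_ext fun f => ?_
  rw [← rest_mulRight, ← Category.assoc, s_mulRight, ← Category.assoc, comp_rest, s_mulRight,
    Category.assoc, s_src, s_src, rest_s, ← P.proj.map_comp, rest_comm, rest_comp_le]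

/-- The underlying graph of an internalisation. -/
noncomputable def graph : PartiteGraph (fun i : P.carrier => P.proj.obj i) where
  arr := G.arr
  src := G.src
  tgt := G.tgt
  src_total := inferInstance
  tgt_total := inferInstance
  src_hasPullback := G.hasPullback

theorem pullback_hom_ext {j k : P.carrier} {Y Z : C} {f : Y ⟶ P.proj.obj j} [IsTotal f]
    {a b : pullback (G.src j k) f ⟶ Z}
    (h : ∀ g : j ⟶ k, pullbackSection (G.src j k) f (G.s g) (G.isPartialSection_s g) ≫ a =
      pullbackSection (G.src j k) f (G.s g) (G.isPartialSection_s g) ≫ b) : a = b :=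
  ((G.isGlueing j k).pullback f).hom_ext h

/-- The composition maps. -/
noncomputable def mul (i j k : P.carrier) : pullback (G.src j k) (G.tgt i j) ⟶ G.arr i k :=
  -- The fibre product is a glueing over `G.arr i j` by the pullbacks of the sections `s g`; on the
  -- sheet of `g` the left factor is a germ of `g`, so composition is right multiplication by `g`.
  ((G.isGlueing j k).pullback (G.tgt i j)).desc (fun g => G.mulRight i g)
    (fun g => by
      rw [← (G.isGlueing j k).rest_s, rest_comp_rest, ← rest_mulRight, rest_self])
    (fun g h => G.hom_ext fun f => by
      rw [← Category.assoc, ← Category.assoc, comp_rest, ← Category.assoc, s_tgt, Category.assoc,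
        Category.assoc, s_mulRight, s_mulRight, s_comp_map_agreement])

theorem pullbackSection_mul (i : P.carrier) {j k : P.carrier} (g : j ⟶ k) :
    pullbackSection (G.src j k) (G.tgt i j) (G.s g) (G.isPartialSection_s g) ≫ G.mul i j k =
      G.mulRight i g :=
  ((G.isGlueing j k).pullback (G.tgt i j)).s_desc _ _ _ g

theorem lift_mul {i j k : P.carrier} {T : C} (g : j ⟶ k) (y : T ⟶ G.arr j k) (x : T ⟶ G.arr i j)
    (h : y ≫ G.src j k = x ≫ G.tgt i j) (e : y = x ≫ G.tgt i j ≫ G.s g) :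
    pullback.lift y x h ≫ G.mul i j k = x ≫ G.mulRight i g := by
  rw [lift_eq_comp_pullbackSection _ _ (G.s g) (G.isPartialSection_s g) y x h e, Category.assoc,
    pullbackSection_mul]

theorem mul_src (i j k : P.carrier) :
    G.mul i j k ≫ G.src i k = pullback.snd _ _ ≫ G.src i j :=
  G.pullback_hom_ext fun g => by
    rw [← Category.assoc, ← Category.assoc, pullbackSection_mul, pullbackSection_snd,
      mulRight_src]

theorem mul_tgt (i j k : P.carrier) :
    G.mul i j k ≫ G.tgt i k = pullback.fst _ _ ≫ G.tgt j k :=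
  G.pullback_hom_ext fun g => by
    rw [← Category.assoc, ← Category.assoc, pullbackSection_mul, pullbackSection_fst,
      mulRight_tgt, Category.assoc, s_tgt]

theorem mul_one (i j : P.carrier) (h) :
    pullback.lift (f := G.src i j) (g := G.tgt i i) (𝟙 (G.arr i j)) (G.src i j ≫ G.s (𝟙 i)) h ≫
      G.mul i i j = 𝟙 (G.arr i j) := G.hom_ext fun f => by
  have e : G.s f ≫ G.src i j ≫ G.s (𝟙 i) = G.s (rest f) := by
    rw [← Category.assoc, s_src, G.map_comp_s (isRestIdem_rest f), Category.comp_id]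
  rw [← Category.assoc, comp_pullback_lift, G.lift_mul f, e, s_mulRight, rest_self,
    Category.comp_id]
  rw [e, Category.comp_id, ← Category.assoc, s_tgt, G.map_comp_s (isRestIdem_rest f), rest_self]

theorem one_mul (i j : P.carrier) (h) :
    pullback.lift (f := G.src j j) (g := G.tgt i j) (G.tgt i j ≫ G.s (𝟙 j)) (𝟙 (G.arr i j)) h ≫
      G.mul i j j = 𝟙 (G.arr i j) := by
  rw [G.lift_mul (𝟙 j), mulRight_id, Category.comp_id]
  rw [Category.id_comp]

/-- When the two outer factors are germs of `h` and `g`, one side is multiplication by `g` then by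
`h`, the other is multiplication by `g ≫ h`. Associativity thus reduces to `mulRight_mulRight`, both
sides being cut down to the same domain `ρ`. -/
theorem mul_assoc (i j k l : P.carrier) (h₁ h₂ h₃) :
    pullback.lift (f := G.src k l) (g := G.tgt i k)
      (pullback.fst (G.src k l) (pullback.fst (G.src j k) (G.tgt i j) ≫ G.tgt j k))
      (pullback.snd _ _ ≫ G.mul i j k) h₁ ≫ G.mul i k l =
    pullback.lift (f := G.src j l) (g := G.tgt i j)
      (pullback.lift (f := G.src k l) (g := G.tgt j k)
        (pullback.fst (G.src k l) (pullback.fst (G.src j k) (G.tgt i j) ≫ G.tgt j k))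
        (pullback.snd _ _ ≫ pullback.fst _ _) h₂ ≫ G.mul j k l)
      (pullback.snd _ _ ≫ pullback.snd _ _) h₃ ≫ G.mul i j l := by
  refine G.pullback_hom_ext fun h => G.pullback_hom_ext fun g => ?_
  obtain ⟨r, hr⟩ : ∃ r, r = pullbackSection (G.src j k) (G.tgt i j) (G.s g)
      (G.isPartialSection_s g) ≫ pullbackSection (G.src k l)
      (pullback.fst (G.src j k) (G.tgt i j) ≫ G.tgt j k) (G.s h) (G.isPartialSection_s h) :=
    ⟨_, rfl⟩
  obtain ⟨ρ, hρ⟩ : ∃ ρ, ρ = rest (G.tgt i j ≫ G.s g ≫ G.tgt j k ≫ G.s h) := ⟨_, rfl⟩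
  have hρ' : ρ ≫ G.tgt i j ≫ G.s g ≫ G.tgt j k ≫ G.s h =
      G.tgt i j ≫ G.s g ≫ G.tgt j k ≫ G.s h := by rw [hρ, rest_self]
  have r_fst : r ≫ pullback.fst _ _ = G.tgt i j ≫ G.s g ≫ G.tgt j k ≫ G.s h := by
    rw [hr, Category.assoc, pullbackSection_fst, ← Category.assoc, ← Category.assoc,
      pullbackSection_fst]
    simp only [Category.assoc]
  have r_snd : r ≫ pullback.snd _ _ =
      ρ ≫ pullbackSection _ _ (G.s g) (G.isPartialSection_s g) := by
    rw [hr, Category.assoc, pullbackSection_snd, comp_rest, ← Category.assoc, ← Category.assoc,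
      pullbackSection_fst, hρ]
    simp only [Category.assoc]
  have r_snd_snd : r ≫ pullback.snd _ _ ≫ pullback.snd _ _ = ρ := by
    rw [← Category.assoc, r_snd, Category.assoc, pullbackSection_snd, hρ, rest_comm]
    simpa only [Category.assoc] using rest_comp_le (G.tgt i j ≫ G.s g) (G.tgt j k ≫ G.s h)
  have r_snd_fst : r ≫ pullback.snd _ _ ≫ pullback.fst _ _ = ρ ≫ G.tgt i j ≫ G.s g := by
    rw [← Category.assoc, r_snd, Category.assoc, pullbackSection_fst]
  have r_snd_mul : r ≫ pullback.snd _ _ ≫ G.mul i j k = ρ ≫ G.mulRight i g := by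
    rw [← Category.assoc, r_snd, Category.assoc, pullbackSection_mul]
  rw [← Category.assoc, ← Category.assoc (pullbackSection _ _ (G.s g) _), ← hr,
    ← Category.assoc, ← Category.assoc r, comp_pullback_lift, comp_pullback_lift, G.lift_mul h,
    G.lift_mul (g ≫ h), r_snd_mul, r_snd_snd, Category.assoc, mulRight_mulRight]
  · rw [r_snd_snd, ← Category.assoc, comp_pullback_lift, G.lift_mul h, r_snd_fst, Category.assoc,
      Category.assoc, s_mulRight]
    rw [r_fst, r_snd_fst, Category.assoc, Category.assoc, hρ']
  · rw [r_fst, r_snd_mul, Category.assoc, ← Category.assoc (G.mulRight i g), mulRight_tgt,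
      ← G.s_tgt g]
    simp only [Category.assoc]
    exact hρ'.symm

/-- The partite internal category of germs of maps of `P`. -/
noncomputable def partiteCatOn : PartiteCatOn (fun i : P.carrier => P.proj.obj i) where
  graph := G.graph
  one i := G.s (𝟙 i)
  one_src i := (G.s_src (𝟙 i)).trans (by rw [rest_id, P.proj.map_id])
  one_tgt i := (G.s_tgt (𝟙 i)).trans (P.proj.map_id i)
  mul := G.mul
  mul_src := G.mul_src
  mul_tgt := G.mul_tgt
  mul_one i j := G.mul_one i j _
  one_mul i j := G.one_mul i j _
  mul_assoc i j k l := G.mul_assoc i j k l _ _ _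

/-- The internalisation given by a choice of glueings. -/
noncomputable def internalisation : Internalisation P where
  str := G.partiteCatOn
  eqv f g := P.proj.map (agreement f g)
  -- The join is attained, so `P.proj` only has to preserve the order and need not preserve joins.
  isJoin_eqv f g := isJoin_of_mem
    ⟨_, isRestIdem_agreement f g, agreement_rle f g, agreement_comp f g, rfl⟩ (by
      rintro _ ⟨e, he, hle, h, rfl⟩
      exact RLe.map P.isRestriction ((isJoin_agreement f g).1 e ⟨he, hle, h⟩))
  p := G.p
  s := G.s
  isGlueing := G.isGlueing
  s_tgt := G.s_tgt
  one_eq _ := rfl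
  isPartialSection_s := G.isPartialSection_s
  s_mul {i j k} f g := (congrArg (fun z => G.s f ≫ z) (G.pullbackSection_mul i g)).trans
    (G.s_mulRight f g)

end GlueingFamily

end Internalise

/-! ### The unit of the equivalence -/

section Unit

variable {C : Type u} [Category.{v} C] [RestrictionCategory C]

theorem IsHyperconnected.injective {A : Type*} [Category A] [RestrictionCategory A] {B : Type*}
    [Category B] [RestrictionCategory B] {F : A ⥤ B} (hF : IsHyperconnected F) {x : A}
    {e d : x ⟶ x} (he : IsRestIdem e) (hd : IsRestIdem d) (h : F.map e = F.map d) : e = d :=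
  (hF.2 x).injOn he hd h

theorem IsHyperconnected.exists_map_eq {A : Type*} [Category A] [RestrictionCategory A]
    {B : Type*} [Category B] [RestrictionCategory B] {F : A ⥤ B} (hF : IsHyperconnected F)
    {x : A} {d : F.obj x ⟶ F.obj x} (hd : IsRestIdem d) :
    ∃ e : x ⟶ x, IsRestIdem e ∧ F.map e = d :=
  (hF.2 x).surjOn hd

namespace GlueingFamily

variable {P : RCatOver.{w} C} [IsJoinRestriction P.carrier] (G : GlueingFamily P)

/-- If `s f = s g` then `s f ≫ p g` is the domain of `s g`, that is, `P` sends the agreement of `f`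
and `g` to the image of `rest g`; likewise for `rest f`. Injectivity on idempotents lifts this, so
`f` and `g` agree on their whole domains. -/
theorem s_injective (hP : IsHyperconnected P.proj) {i j : P.carrier} {f g : i ⟶ j}
    (h : G.s f = G.s g) : f = g := by
  have hG := G.isGlueing i j
  have e1 : agreement f g = rest g := hP.injective (isRestIdem_agreement f g)
    (isRestIdem_rest g) (by
      rw [← G.rest_s, hG.rest_s, ← hG.atlas, ← hG.atlas]
      exact congrArg (fun z => z ≫ G.p g) h)
  have e2 : agreement f g = rest f := by
    rw [agreement_symm]
    refine hP.injective (isRestIdem_agreement g f) (isRestIdem_rest f) ?_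
    rw [← G.rest_s, hG.rest_s, ← hG.atlas, ← hG.atlas]
    exact congrArg (fun z => z ≫ G.p f) h.symm
  rw [← rest_self f, ← e2, agreement_comp, e1, rest_self]

theorem s_mono {i j : P.carrier} {f g : i ⟶ j} (h : RLe f g) : RLe (G.s f) (G.s g) := by
  unfold RLe at h ⊢
  rw [rest_s, G.map_comp_s (isRestIdem_rest f), ← h]

/-- On the idempotent `t ≫ p f` the section `t` coincides with `s f`. Lifting these idempotents
along `P` yields restrictions `e f ≫ f` of maps of `P.carrier`, whose join is the required map. -/
theorem exists_s_eq [IsJoinRestriction C] (hP : IsHyperconnected P.proj) {i j : P.carrier}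
    (t : P.proj.obj i ⟶ G.arr i j) (ht : IsPartialSection (G.src i j) t) :
    ∃ f : i ⟶ j, G.s f = t := by
  have hG := G.isGlueing i j
  have idem : ∀ f : i ⟶ j, rest (t ≫ G.p f) = t ≫ G.p f := fun f => by
    refine RLe.isRestIdem (isRestIdem_rest t) ?_
    rw [← ht.rest_comp_eq]
    exact (hG.p_rle f).comp_left t
  choose e he hPe using fun f : i ⟶ j => hP.exists_map_eq (isRestIdem_rest (t ≫ G.p f))
  have se : ∀ f, G.s (e f ≫ f) = rest (t ≫ G.p f) ≫ t := fun f => by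
    rw [← G.map_comp_s (he f), hPe, idem, Category.assoc, ← hG.rest_comp_p_comp, idem]
  have se_rle : ∀ f, RLe (G.s (e f ≫ f)) t := fun f => by
    rw [se]
    exact (isRestIdem_rest _).rle t
  -- The images under `s` are all below `t`, hence compatible; injectivity of `s` reflects
  -- compatibility.
  obtain ⟨F, hF, -⟩ := IsJoinRestriction.exists_join (Set.range fun f : i ⟶ j => e f ≫ f) (by
    rintro _ ⟨f, rfl⟩ _ ⟨g, rfl⟩
    refine G.s_injective hP ?_
    rw [← G.map_comp_s (isRestIdem_rest _), ← G.map_comp_s (isRestIdem_rest _), ← rest_s,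
      ← rest_s]
    exact IsJoin.compatible (S := Set.range fun f => G.s (e f ≫ f)) (j := t)
      (by rintro _ ⟨f, rfl⟩; exact se_rle f) _ ⟨f, rfl⟩ _ ⟨g, rfl⟩)
  refine ⟨F, ?_⟩
  -- Preservation of joins by `s` has not been established, so only this inequality is immediate;
  -- equality follows by comparing domains.
  have h1 : RLe t (G.s F) := by
    refine (hG.isJoin_rest_comp t).restrict.2 _ ?_
    rintro _ ⟨_, ⟨f, rfl⟩, rfl⟩
    rw [← se]
    exact G.s_mono (hF.rle ⟨f, rfl⟩)
  obtain ⟨d, hd, hPd⟩ := hP.exists_map_eq (isRestIdem_rest t)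
  -- With `d` lifting the domain of `t`, every piece of `F` is defined inside `d`, so `F` is too.
  -- Hence `s F` is defined no further than `t`.
  have h2 : RLe F (d ≫ F) := by
    refine hF.2 _ ?_
    rintro _ ⟨f, rfl⟩
    have h3 : rest (e f ≫ f) ≫ d = rest (e f ≫ f) := by
      refine hP.injective ((isRestIdem_rest _).comp hd) (isRestIdem_rest _) ?_
      rw [P.proj.map_comp, hPd, ← rest_s]
      exact (se_rle f).rest.comp_eq (isRestIdem_rest t)
    unfold RLe
    rw [← Category.assoc, h3]
    exact hF.rle ⟨f, rfl⟩
  have h4 := (G.s_mono h2).rest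
  rw [← G.map_comp_s hd, hPd, rest_rest_comp] at h4
  refine (rle_of_rest_eq h1 (h1.rest.antisymm (h4.trans ?_))).symm
  rw [rest_comm]
  exact (isRestIdem_rest _).rle _

variable [IsJoinRestriction C]

/-- The functor underlying the unit map. -/
noncomputable def unitFunctor : P.carrier ⥤ PhiObj G.internalisation.cat :=
  RCatOver.Hom.functor G.internalisation.unit

theorem unitFunctor_faithful (hP : IsHyperconnected P.proj) : G.unitFunctor.Faithful :=
  ⟨fun h => G.s_injective hP (congrArg Subtype.val h)⟩

theorem exists_unitFunctor_map_eq (hP : IsHyperconnected P.proj) (i j : P.carrier)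
    (t : G.unitFunctor.obj i ⟶ G.unitFunctor.obj j) :
    ∃ f : i ⟶ j, G.unitFunctor.map f = t := by
  obtain ⟨f, hf⟩ := G.exists_s_eq hP t.1 t.2
  exact ⟨f, Subtype.ext hf⟩

/-- The unit is bijective on objects, full and faithful, with identity 2-cell, so it has a strict
inverse, whose 2-cell is again the identity. Faithfulness transfers functoriality and preservation
of restrictions to the chosen preimages. -/
theorem isIso_unit (hP : IsHyperconnected P.proj) : IsIso G.internalisation.unit := by
  have := G.unitFunctor_faithful hP
  choose pre hpre using G.exists_unitFunctor_map_eq hP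
  let o : PhiObj G.internalisation.cat → P.carrier := fun i => i.idx
  let inv : PhiObj G.internalisation.cat ⥤ P.carrier :=
    { obj := o
      map := fun {i j} t => pre (o i) (o j) t
      map_id := fun i => G.unitFunctor.map_injective
        ((hpre _ _ _).trans (G.unitFunctor.map_id (o i)).symm)
      map_comp := fun {i j k} t t' => G.unitFunctor.map_injective
        ((hpre _ _ _).trans (((G.unitFunctor.map_comp _ _).trans
          (congrArg₂ CategoryStruct.comp (hpre _ _ t) (hpre _ _ t'))).symm)) }
  have hinv : ∀ {i j : PhiObj G.internalisation.cat} (t : i ⟶ j),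
      G.unitFunctor.map (inv.map t) = t := fun t => hpre _ _ _
  have hU : IsRestrictionFunctor G.unitFunctor :=
    RCatOver.Hom.isRestriction G.internalisation.unit
  let invHom : (Phi.{w} C).obj G.internalisation.cat ⟶ P :=
    RCatOver.Hom.mk (P := externalisation G.internalisation.cat) (Q := P) inv
      (fun {i j} t => G.unitFunctor.map_injective (by
        refine (hinv (rest t)).trans ?_
        rw [hU]
        exact congrArg rest (hinv t).symm))
      { app := fun i => 𝟙 (P.proj.obj i.idx)
        naturality := fun i j t => (Category.comp_id _).trans (Eq.trans
          ((G.s_tgt (inv.map t)).symm.trans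
            (congrArg (fun z => (phiProj G.internalisation.cat).map z) (hinv t)))
          (Category.id_comp _).symm) }
      (fun _ => ⟨rest_id _⟩)
  refine ⟨invHom, ?_, ?_⟩
  · refine RCatOver.Hom.ext' _ _ (fun _ => rfl) (fun i j f => heq_of_eq ?_)
      (fun i => heq_of_eq (Category.comp_id _))
    exact G.unitFunctor.map_injective (hinv _)
  · refine RCatOver.Hom.ext' _ _ (fun _ => rfl) (fun i j t => heq_of_eq ?_)
      (fun i => heq_of_eq (Category.comp_id _))
    exact hinv t

end GlueingFamily

end Unit

/-! ### Partite internal groupoids -/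

section Groupoid

variable {C : Type u} [Category.{v} C] [RestrictionCategory C]

namespace PartiteCat

variable {𝔸 : PartiteCat.{w} C}

/-- The law for targets follows from that for sources because `ι` is an involution. The inverse law
is stated for generalised elements, with `y` given by an equation so that it applies before the two
arguments have been simplified. -/
theorem IsGroupoid.exists_inverse (h𝔸 : 𝔸.IsGroupoid) :
    ∃ ι : ∀ i j, 𝔸.arr i j ⟶ 𝔸.arr j i, (∀ i j, IsTotal (ι i j)) ∧
      (∀ i j, ι i j ≫ ι j i = 𝟙 (𝔸.arr i j)) ∧ (∀ i j, ι i j ≫ 𝔸.src j i = 𝔸.tgt i j) ∧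
      (∀ i j, ι i j ≫ 𝔸.tgt j i = 𝔸.src i j) ∧
      ∀ {i j} {T : C} (x : T ⟶ 𝔸.arr i j) (y : T ⟶ 𝔸.arr j i) (_ : y = x ≫ ι i j)
        (h : y ≫ 𝔸.src j i = x ≫ 𝔸.tgt i j), 𝔸.str.cmp y x h = x ≫ 𝔸.src i j ≫ 𝔸.one i := by
  obtain ⟨ι, h₁, h₂, h₃, h₄⟩ := h𝔸
  refine ⟨ι, h₁, h₂, h₃, fun i j => ?_, fun {i j T} x y e h => ?_⟩
  · rw [← h₃ j i, ← Category.assoc, h₂, Category.id_comp]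
  · subst e
    rw [← h₄]
    unfold PartiteCatOn.cmp
    rw [← Category.assoc, comp_pullback_lift]
    congr 1
    apply pullback.hom_ext
    · rw [pullback.lift_fst, pullback.lift_fst]
    · rw [pullback.lift_snd, pullback.lift_snd, Category.comp_id]

/-- If `t` is partially inverse to `s ≫ tgt`, the partial inverse of `s` sends a point to the
inverse of the arrow that `s` assigns to its image under `t`. No étaleness is involved. -/
theorem IsGroupoid.isPartialIso_of_map (h𝔸 : 𝔸.IsGroupoid) {i j : PhiObj 𝔸} (f : i ⟶ j)
    (hf : IsPartialIso ((phiProj 𝔸).map f)) : IsPartialIso f := by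
  obtain ⟨ι, hι, hιι, hsrc, htgt, hcmp⟩ := h𝔸.exists_inverse
  obtain ⟨i⟩ := i
  obtain ⟨j⟩ := j
  obtain ⟨(t : 𝔸.obj j ⟶ 𝔸.obj i), ht⟩ := hf
  obtain ⟨s, hs⟩ := f
  have ht' : IsPartialInverse (s ≫ 𝔸.tgt i j) t := ht
  have ht1 : s ≫ 𝔸.tgt i j ≫ t = rest s := by
    rw [← Category.assoc, ht'.1, rest_comp_total]
  have ht2 : t ≫ s ≫ 𝔸.tgt i j = rest t := ht'.2
  have hsrc' := hs.rest_comp_eq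
  have rest_ts : rest (t ≫ s) = rest t := by
    rw [← rest_comp_total (t ≫ s) (𝔸.tgt i j), Category.assoc, ht2, rest_rest]
  have rest_g : rest (t ≫ s ≫ ι i j) = rest t := by
    rw [← Category.assoc, rest_comp_total, rest_ts]
  have hg : IsPartialSection (𝔸.src j i) (t ≫ s ≫ ι i j) := by
    unfold IsPartialSection
    rw [rest_g, Category.assoc, Category.assoc, hsrc, ht2]
  refine ⟨⟨t ≫ s ≫ ι i j, hg⟩, Subtype.ext ?_, Subtype.ext ?_⟩
  · refine (𝔸.str.secComp_eq _ _ _).trans ?_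
    have e1 : s ≫ 𝔸.tgt i j ≫ t ≫ s ≫ ι i j = s ≫ ι i j := by
      have := congrArg (fun z => z ≫ s ≫ ι i j) ht1
      simpa only [Category.assoc, rest_self_assoc] using this
    have e2 : rest (s ≫ 𝔸.tgt i j ≫ t ≫ s ≫ ι i j) ≫ s = s := by
      rw [e1, rest_comp_total, rest_self]
    refine (hcmp _ _ ?_ _).trans ?_
    · exact e1.trans (congrArg (fun z => z ≫ _) e2.symm)
    · rw [phi_rest_val]
      refine (congrArg (fun z => z ≫ 𝔸.src i j ≫ 𝔸.one i) e2).trans ?_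
      dsimp only
      rw [← Category.assoc, hsrc']
  · refine (𝔸.str.secComp_eq _ _ _).trans ?_
    have e1 : (t ≫ s ≫ ι i j) ≫ 𝔸.tgt j i ≫ s = t ≫ s := by
      rw [Category.assoc, Category.assoc, ← Category.assoc (ι i j), htgt,
        ← Category.assoc s, hsrc', rest_self]
    have e2 : rest ((t ≫ s ≫ ι i j) ≫ 𝔸.tgt j i ≫ s) ≫ t ≫ s ≫ ι i j =
        t ≫ s ≫ ι i j := by
      rw [e1, rest_ts, rest_self_assoc]
    refine (hcmp _ _ ?_ _).trans ?_
    · refine e1.trans ?_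
      refine Eq.trans ?_ (congrArg (fun z => z ≫ _) e2.symm)
      simp only [Category.assoc]
      rw [hιι, Category.comp_id]
    · rw [phi_rest_val]
      refine (congrArg (fun z => z ≫ 𝔸.src j i ≫ 𝔸.one j) e2).trans ?_
      dsimp only
      rw [rest_g, ← Category.assoc, hg.rest_comp_eq, rest_g]

variable [IsJoinRestriction C]

/-- Restricting `f` to the domains of the partial isomorphisms that cover its image under the
projection gives maps lying over them. These are partial isomorphisms by reflection, and they cover
`f` because target maps are total, so that `f` and its image have the same domain. -/
theorem IsGroupoid.isEtaleMap_of_map (h𝔸 : 𝔸.IsGroupoid) {i j : PhiObj 𝔸} (f : i ⟶ j)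
    (hf : IsEtaleMap ((phiProj 𝔸).map f)) : IsEtaleMap f := by
  obtain ⟨S, hS, hj⟩ := hf
  have e : ∀ g ∈ S, rest g ≫ f.1 ≫ 𝔸.tgt i.idx j.idx = g := fun g hg => (hj.rle hg).symm
  refine ⟨{k | ∃ g ∈ S, k = ⟨rest g ≫ f.1, f.2.rest_comp g⟩}, ?_, phi_isJoin_iff _ _ ?_⟩
  · rintro _ ⟨g, hg, rfl⟩
    refine h𝔸.isPartialIso_of_map _ ?_
    have : (phiProj 𝔸).map (⟨rest g ≫ f.1, f.2.rest_comp g⟩ : i ⟶ j) = g :=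
      (Category.assoc _ _ _).trans (e g hg)
    rw [this]
    exact hS g hg
  · have h1 : IsJoin {h | ∃ g ∈ S, h = rest g} (rest f.1) := by
      have h2 := hj.rest
      have h3 : rest ((phiProj 𝔸).map f) = rest f.1 :=
        rest_comp_total f.1 (𝔸.tgt i.idx j.idx)
      rwa [h3] at h2
    refine isJoin_image_eq h1.restrict ?_
    ext k
    constructor
    · rintro ⟨_, ⟨g, hg, rfl⟩, rfl⟩
      exact ⟨_, ⟨g, hg, rfl⟩, rfl⟩
    · rintro ⟨_, ⟨g, hg, rfl⟩, rfl⟩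
      exact ⟨_, ⟨g, hg, rfl⟩, rfl⟩

end PartiteCat

end Groupoid

/-! ### Étale join restriction categories and étale groupoids -/

section EtaleGroupoid

variable {C : Type u} [Category.{v} C] [RestrictionCategory C]

namespace GlueingFamily

variable {P : RCatOver.{w} C} [IsJoinRestriction P.carrier] (G : GlueingFamily P)

/-- Both sides are partially inverse to `s g`, the restriction of `s f`. -/
theorem p_eq_of_rle {i j : P.carrier} {f g : i ⟶ j} (h : RLe g f) :
    G.p g = G.p f ≫ P.proj.map (rest g) := by
  have h1 := ((G.isGlueing i j).inverse f).symm.restrict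
    ((isRestIdem_rest g).map P.isRestriction)
  have e : P.proj.map (rest g) ≫ G.s f = G.s g := by
    rw [G.map_comp_s (isRestIdem_rest g), ← h]
  rw [e] at h1
  exact ((G.isGlueing i j).inverse g).symm.unique h1

/-- The germwise inverse of `g`, restricted to `e`, is the germwise inverse of `e ≫ g`; this makes
inversion compatible with agreement. -/
theorem map_comp_map_comp_s {i j : P.carrier} {g : i ⟶ j} {g' : j ⟶ i}
    (h : IsPartialInverse g g') {e : i ⟶ i} (he : IsRestIdem e) :
    P.proj.map e ≫ P.proj.map g ≫ G.s g' = P.proj.map (e ≫ g) ≫ G.s (g' ≫ e) := by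
  have e1 : g' ≫ e = rest (g' ≫ e) ≫ g' := (comp_isRestIdem g' he).symm
  have e2 : (e ≫ g) ≫ rest (g' ≫ e) = e ≫ g := (h.restrict he).comp_rest
  rw [e1, ← G.map_comp_s (isRestIdem_rest _), ← Category.assoc (P.proj.map (e ≫ g)),
    ← P.proj.map_comp, e2, P.proj.map_comp, Category.assoc]

end GlueingFamily

variable [IsJoinRestriction C]

theorem IsEtaleMap.precomp {A B D : C} {f : B ⟶ D} (hf : IsEtaleMap f) {g : A ⟶ B}
    (hg : IsPartialIso g) : IsEtaleMap (g ≫ f) := by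
  obtain ⟨S, hS, hj⟩ := hf
  refine ⟨_, ?_, hj.comp g⟩
  rintro _ ⟨k, hk, rfl⟩
  exact hg.comp (hS k hk)

/-- The projection of `f` is `f`, then `ι`, then a source map. A partial section of a local
homeomorphism is a partial isomorphism, `ι` is invertible and the source map is étale, so the
composite is étale, and the projection reflects this. -/
theorem PartiteCat.IsGroupoid.isEtaleMap {𝔸 : PartiteCat.{w} C} (h𝔸 : 𝔸.IsGroupoid)
    (hs : 𝔸.IsSourceEtale) {i j : PhiObj 𝔸} (f : i ⟶ j) : IsEtaleMap f := by
  refine h𝔸.isEtaleMap_of_map f ?_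
  obtain ⟨ι, -, hιι, hsrc, -, -⟩ := h𝔸.exists_inverse
  have e : (phiProj 𝔸).map f = (f.1 ≫ ι i.idx j.idx) ≫ 𝔸.src j.idx i.idx := by
    rw [Category.assoc, hsrc]
    rfl
  rw [e]
  have h1 : IsPartialIso f.1 :=
    ⟨_, ((isGlueing_sections (hs i.idx j.idx)).inverse ⟨f.1, f.2⟩).symm⟩
  exact (hs j.idx i.idx).2.precomp
    (h1.comp ⟨_, isPartialInverse_of_inv (hιι i.idx j.idx) (hιι j.idx i.idx)⟩)

/-- The join of the images lifts to a restriction idempotent `d`. Injectivity on idempotents shows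
that `d` bounds the domains of the members of `S`, hence the domain of `f`. -/
theorem IsHyperconnected.isJoin_map_rest {A : Type*} [Category A] [RestrictionCategory A]
    [IsJoinRestriction A] {F : A ⥤ C} (hF : IsHyperconnected F) {x y : A} {S : Set (x ⟶ y)}
    {f : x ⟶ y} (hf : IsJoin S f) :
    IsJoin {h | ∃ g ∈ S, h = F.map (rest g)} (F.map (rest f)) := by
  have hle : ∀ k ∈ {h | ∃ g ∈ S, h = F.map (rest g)}, RLe k (F.map (rest f)) := by
    rintro _ ⟨g, hg, rfl⟩
    exact (hf.rle hg).rest.map hF.1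
  obtain ⟨m, hm, -⟩ := IsJoinRestriction.exists_join _ (IsJoin.compatible hle)
  have hmf := hm.2 _ hle
  have hmi : IsRestIdem m := hmf.isRestIdem ((isRestIdem_rest f).map hF.1)
  obtain ⟨d, hd, rfl⟩ := hF.exists_map_eq hmi
  refine ⟨hle, fun k hk => RLe.trans (RLe.map hF.1 ?_) (hm.2 k hk)⟩
  refine hf.rest.2 _ ?_
  rintro _ ⟨g, hg, rfl⟩
  refine (isRestIdem_rest g).rle_of_comp_eq (g := d) ?_
  refine hF.injective ((isRestIdem_rest g).comp hd) (isRestIdem_rest g) ?_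
  rw [F.map_comp]
  exact (hm.rle ⟨g, hg, rfl⟩).comp_eq hmi

namespace GlueingFamily

variable {P : RCatOver.{w} C} [IsJoinRestriction P.carrier] (G : GlueingFamily P)

/-- If all maps are étale then the partial isomorphisms suffice to cover the source maps. -/
theorem isGlueing_partialIso (hP : IsHyperconnected P.proj)
    (hE : ∀ (x y : P.carrier) (f : x ⟶ y), IsEtaleMap f) (i j : P.carrier) :
    IsGlueing (fun f g : {f : i ⟶ j // IsPartialIso f} => P.proj.map (agreement f.1 g.1))
      (G.src i j) (fun f => G.p f.1) (fun f => G.s f.1) where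
  total := inferInstance
  inverse f := (G.isGlueing i j).inverse f.1
  atlas f g := (G.isGlueing i j).atlas f.1 g.1
  join := by
    refine ⟨?_, fun k hk => (G.isGlueing i j).join.2 k ?_⟩
    · rintro _ ⟨f, rfl⟩
      exact (G.isGlueing i j).p_rle f.1
    · rintro _ ⟨f, rfl⟩
      obtain ⟨S, hS, hj⟩ := hE i j f
      -- If partial isomorphisms `g` cover `f`, their domains cover that of `f`; restricting `p f`
      -- along this cover gives the `p g`.
      have h1 := (hP.isJoin_map_rest hj).comp (G.p f)
      rw [← G.p_eq_of_rle (RLe.refl f)] at h1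
      refine h1.2 k ?_
      rintro _ ⟨_, ⟨g, hg, rfl⟩, rfl⟩
      rw [← G.p_eq_of_rle (hj.rle hg)]
      exact hk _ ⟨⟨g, hS g hg⟩, rfl⟩

/-- On the section of a partial isomorphism `g` the map is forced to be the germ of the partial
inverse, taken at the image point. Where two partial isomorphisms agree, so do their inverses by
uniqueness, and the family glues. -/
theorem exists_inv (hP : IsHyperconnected P.proj)
    (hE : ∀ (x y : P.carrier) (f : x ⟶ y), IsEtaleMap f) (i j : P.carrier) :
    ∃ ι : G.arr i j ⟶ G.arr j i, ∀ (g : i ⟶ j) (g' : j ⟶ i), IsPartialInverse g g' →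
      G.s g ≫ ι = P.proj.map g ≫ G.s g' := by
  choose inv hinv using fun g : {f : i ⟶ j // IsPartialIso f} => g.2
  obtain ⟨ι, hι⟩ := (G.isGlueing_partialIso hP hE i j).exists_desc
    (fun g => P.proj.map g.1 ≫ G.s (inv g))
    (fun g => by
      rw [agreement_self, ← Category.assoc, ← P.proj.map_comp, rest_self])
    (fun f g => by
      have hfg := agreement_comp f.1 g.1
      have he := isRestIdem_agreement f.1 g.1
      rw [G.map_comp_map_comp_s (hinv f) he, G.map_comp_map_comp_s (hinv g) he, hfg]
      have h1 := (hinv f).restrict he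
      rw [hfg] at h1
      rw [h1.unique ((hinv g).restrict he)])
  refine ⟨ι, fun g g' h => ?_⟩
  rw [hι ⟨g, g', h⟩, (hinv ⟨g, g', h⟩).unique h]

/-- Each law is checked on sections of partial isomorphisms, where it becomes one of the equations
expressing that `g` and `g'` are partially inverse. -/
theorem isGroupoid (hP : IsHyperconnected P.proj)
    (hE : ∀ (x y : P.carrier) (f : x ⟶ y), IsEtaleMap f) :
    G.internalisation.cat.IsGroupoid := by
  choose ι hι using G.exists_inv hP hE
  have ext : ∀ {i j : P.carrier} {Z : C} {a b : G.arr i j ⟶ Z},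
      (∀ (g : i ⟶ j) (g' : j ⟶ i), IsPartialInverse g g' → G.s g ≫ a = G.s g ≫ b) → a = b :=
    fun {i j Z a b} h => (G.isGlueing_partialIso hP hE i j).hom_ext fun g => by
      obtain ⟨g, g', hg⟩ := g
      exact h g g' hg
  have total : ∀ i j, IsTotal (ι i j) := fun i j => ⟨ext fun g g' h => by
    rw [comp_rest, hι i j g g' h, ← rest_comp_rest, rest_s, ← P.proj.map_comp, h.comp_rest,
      ← P.isRestriction, ← rest_s, rest_self, Category.comp_id]⟩
  have ι_ι : ∀ i j, ι i j ≫ ι j i = 𝟙 (G.arr i j) := fun i j => ext fun g g' h => by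
    rw [← Category.assoc, hι i j g g' h, Category.assoc, hι j i g' g h.symm, ← Category.assoc,
      ← P.proj.map_comp, h.1, ← rest_s, rest_self, Category.comp_id]
  have ι_src : ∀ i j, ι i j ≫ G.src j i = G.tgt i j := fun i j => ext fun g g' h => by
    rw [← Category.assoc, hι i j g g' h, Category.assoc, s_src, s_tgt, ← P.proj.map_comp,
      h.comp_rest]
  have key : ∀ i j, pullback.lift (f := G.src j i) (g := G.tgt i j) (ι i j) (𝟙 (G.arr i j))
      (by rw [ι_src, Category.id_comp]) ≫ G.mul i j i = G.src i j ≫ G.s (𝟙 i) :=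
    fun i j => ext fun g g' h => by
      rw [← Category.assoc, comp_pullback_lift, G.lift_mul g', Category.comp_id, s_mulRight, h.1,
        ← Category.assoc, s_src, G.map_comp_s (isRestIdem_rest g), Category.comp_id]
      rw [Category.comp_id, hι i j g g' h, ← Category.assoc, s_tgt]
  exact ⟨ι, total, ι_ι, ι_src, key⟩

end GlueingFamily

end EtaleGroupoid

/-! ### The equivalences of categories -/

section Equivalence

/-- An equivalence between full subcategories restricts to smaller full subcategories which
correspond to each other. -/
def equivalenceOfLE {D : Type*} [Category D] {E : Type*} [Category E] {P P' : ObjectProperty D}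
    {Q Q' : ObjectProperty E} (hP : P ≤ P') (hQ : Q ≤ Q')
    (e : P'.FullSubcategory ≌ Q'.FullSubcategory)
    (hF : ∀ X : P.FullSubcategory, Q (e.functor.obj ⟨X.1, hP _ X.2⟩).obj)
    (hG : ∀ Y : Q.FullSubcategory, P (e.inverse.obj ⟨Y.1, hQ _ Y.2⟩).obj) :
    P.FullSubcategory ≌ Q.FullSubcategory :=
  CategoryTheory.Equivalence.mk
    -- Both functors are lifts of composites with inclusions, so the restricted equivalence commutes
    -- with the inclusions strictly and not merely up to isomorphism.
    (Q.lift (ObjectProperty.ιOfLE hP ⋙ e.functor ⋙ Q'.ι) hF)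
    (P.lift (ObjectProperty.ιOfLE hQ ⋙ e.inverse ⋙ P'.ι) hG)
    (NatIso.ofComponents
      (fun X => P.isoMk (P'.ι.mapIso (e.unitIso.app ⟨X.1, hP _ X.2⟩)))
      (fun f => ObjectProperty.hom_ext _
        (P'.ι.congr_map (e.unitIso.hom.naturality ((ObjectProperty.ιOfLE hP).map f)))))
    (NatIso.ofComponents
      (fun Y => Q.isoMk (Q'.ι.mapIso (e.counitIso.app ⟨Y.1, hQ _ Y.2⟩)))
      (fun f => ObjectProperty.hom_ext _
        (Q'.ι.congr_map (e.counitIso.hom.naturality ((ObjectProperty.ιOfLE hQ).map f)))))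

variable {C : Type u} [Category.{v} C] [RestrictionCategory C]

theorem externalisationMap_id (𝔸 : PartiteCat.{w} C) :
    externalisationMap (𝟙 𝔸) = 𝟙 (externalisation 𝔸) := (Phi.{w} C).map_id 𝔸

theorem externalisationMap_comp {𝔸 𝔹 𝔻 : PartiteCat.{w} C} (F : 𝔸 ⟶ 𝔹) (G : 𝔹 ⟶ 𝔻) :
    externalisationMap (F ≫ G) = externalisationMap F ≫ externalisationMap G :=
  (Phi.{w} C).map_comp F G

variable [IsJoinRestriction C]

/-- Externalisation is fully faithful on source-étale partite internal categories. -/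
noncomputable def fullyFaithfulPhiE : (PhiE.{w} C).FullyFaithful where
  preimage {𝔸 _} H := ObjectProperty.homMk (cofunctorOfHom H.hom 𝔸.property)
  map_preimage {𝔸 _} H :=
    ObjectProperty.hom_ext _ (externalisationMap_cofunctorOfHom H.hom 𝔸.property)
  preimage_map {𝔸 _} _ := ObjectProperty.hom_ext _
    (externalisationMap_injective 𝔸.property (externalisationMap_cofunctorOfHom _ 𝔸.property))

instance (P : HCon.{w} C) : IsJoinRestriction P.obj.carrier := P.property.1

section Psi

variable (G : ∀ P : HCon.{w} C, GlueingFamily P.obj)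

/-- The action of `Ψ` on maps, transported along the unit maps. -/
noncomputable def psiHom {P Q : HCon.{w} C} (F : P ⟶ Q) :
    (Phi.{w} C).obj (G P).internalisation.cat ⟶ (Phi.{w} C).obj (G Q).internalisation.cat :=
  haveI := (G P).isIso_unit P.property.2
  inv (G P).internalisation.unit ≫ F.hom ≫ (G Q).internalisation.unit

theorem unit_psiHom {P Q : HCon.{w} C} (F : P ⟶ Q) :
    (G P).internalisation.unit ≫ psiHom G F = F.hom ≫ (G Q).internalisation.unit := by
  have := (G P).isIso_unit P.property.2
  unfold psiHom
  rw [IsIso.hom_inv_id_assoc]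

theorem psiHom_id (P : HCon.{w} C) : psiHom G (𝟙 P) = 𝟙 _ := by
  have := (G P).isIso_unit P.property.2
  unfold psiHom
  rw [IsIso.inv_comp_eq, Category.comp_id]
  exact Category.id_comp _

theorem psiHom_comp {P Q R : HCon.{w} C} (F : P ⟶ Q) (F' : Q ⟶ R) :
    psiHom G (F ≫ F') = psiHom G F ≫ psiHom G F' := by
  have := (G P).isIso_unit P.property.2
  rw [← cancel_epi (G P).internalisation.unit, unit_psiHom, ← Category.assoc, unit_psiHom,
    Category.assoc, unit_psiHom]
  exact Category.assoc _ _ _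

/-- The internalisation functor given by a choice of glueings. -/
noncomputable def psi : InternalisationFunctor.{w} C where
  obj P := (G P).internalisation
  -- Fullness supplies the cofunctor lying over the transported map; faithfulness turns
  -- functoriality of the transport into functoriality of `Ψ`.
  map {P _} F := cofunctorOfHom (psiHom G F) (G P).internalisation.isSourceEtale
  map_id P := externalisationMap_injective (G P).internalisation.isSourceEtale
    ((externalisationMap_cofunctorOfHom _ _).trans
      ((psiHom_id G P).trans (externalisationMap_id _).symm))
  map_comp {P _ _} F F' := externalisationMap_injective (G P).internalisation.isSourceEtale
    ((externalisationMap_cofunctorOfHom _ _).trans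
      ((psiHom_comp G F F').trans (Eq.trans
        (congrArg₂ CategoryStruct.comp (externalisationMap_cofunctorOfHom _ _).symm
          (externalisationMap_cofunctorOfHom _ _).symm) (externalisationMap_comp _ _).symm)))
  unit_naturality {P _} F :=
    (congrArg (fun z => (G P).internalisation.unit ≫ z)
      (externalisationMap_cofunctorOfHom (psiHom G F) _)).trans (unit_psiHom G F)

/-- The unit maps, as a natural isomorphism. -/
noncomputable def unitNatIso : 𝟭 (HCon.{w} C) ≅ (psi G).functor ⋙ PhiE.{w} C :=
  NatIso.ofComponents
    (fun P => (isHCon.{w} C).isoMk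
      (@asIso _ _ _ _ (G P).internalisation.unit ((G P).isIso_unit P.property.2)))
    (fun F => ObjectProperty.hom_ext _ ((psi G).unit_naturality F).symm)

/-- The equivalence between source-étale partite internal categories and join restriction
categories hyperconnected over `C`. -/
noncomputable def phiEquivalence : PeCat.{w} C ≌ HCon.{w} C :=
  CategoryTheory.Equivalence.mk (PhiE.{w} C) (psi G).functor
    (NatIso.ofComponents
      -- The isomorphism of `𝔸` with the internalisation of its externalisation is the one that `Φ`
      -- sends to the unit map at `Φ𝔸`.
      (fun 𝔸 => fullyFaithfulPhiE.preimageIso ((unitNatIso G).app ((PhiE.{w} C).obj 𝔸)))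
      (fun F => fullyFaithfulPhiE.map_injective (by
        refine ((PhiE.{w} C).map_comp _ _).trans (Eq.trans ?_ ((PhiE.{w} C).map_comp _ _).symm)
        rw [Functor.FullyFaithful.preimageIso_hom, Functor.FullyFaithful.preimageIso_hom,
          fullyFaithfulPhiE.map_preimage, fullyFaithfulPhiE.map_preimage]
        exact (unitNatIso G).hom.naturality ((PhiE.{w} C).map F))))
    (unitNatIso G).symm

/-- The equivalence between étale partite internal groupoids and étale join restriction
categories hyperconnected over `C`. -/
noncomputable def phiEquivalenceGpd : PeGpd.{w} C ≌ HConEj.{w} C :=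
  equivalenceOfLE (isPeGpd_le.{w} C) (isHConEj_le.{w} C) (phiEquivalence G)
    (fun 𝔸 => ⟨((PhiE.{w} C).obj ⟨𝔸.obj, 𝔸.property.1⟩).property,
      fun _ _ f => PartiteCat.IsGroupoid.isEtaleMap 𝔸.property.2 𝔸.property.1 f⟩)
    (fun P => ⟨(G ⟨P.obj, P.property.1⟩).internalisation.isSourceEtale,
      (G ⟨P.obj, P.property.1⟩).isGroupoid P.property.1.2 P.property.2⟩)

end Psi

end Equivalence

end EtaleGpd

theorem mainTheorem4 (C : Type u) [Category.{v} C] [EtaleGpd.RestrictionCategory C]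
    [EtaleGpd.IsJoinRestriction C] (hC : EtaleGpd.HasLocalGlueings C) :
    (∃ (Ψ : EtaleGpd.InternalisationFunctor.{w} C)
        (e : EtaleGpd.PeCat.{w} C ≌ EtaleGpd.HCon.{w} C)
        (e' : EtaleGpd.PeGpd.{w} C ≌ EtaleGpd.HConEj.{w} C),
      e.functor = EtaleGpd.PhiE.{w} C ∧
      e.inverse = Ψ.functor ∧
      (∀ P : EtaleGpd.HCon.{w} C, IsIso (Ψ.obj P).unit) ∧
      e'.functor ⋙ ObjectProperty.ιOfLE (EtaleGpd.isHConEj_le.{w} C) =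
        ObjectProperty.ιOfLE (EtaleGpd.isPeGpd_le.{w} C) ⋙ EtaleGpd.PhiE.{w} C ∧
      e'.inverse ⋙ ObjectProperty.ιOfLE (EtaleGpd.isPeGpd_le.{w} C) =
        ObjectProperty.ιOfLE (EtaleGpd.isHConEj_le.{w} C) ⋙ Ψ.functor) ∧
    (∀ 𝔸 : EtaleGpd.PartiteCat.{w} C, 𝔸.IsGroupoid →
      ∀ {i j : EtaleGpd.PhiObj 𝔸} (f : i ⟶ j),
        (EtaleGpd.IsPartialIso ((EtaleGpd.phiProj 𝔸).map f) → EtaleGpd.IsPartialIso f) ∧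
        (EtaleGpd.IsEtaleMap ((EtaleGpd.phiProj 𝔸).map f) → EtaleGpd.IsEtaleMap f)) := by
  refine ⟨?_, fun 𝔸 h𝔸 i j f => ⟨h𝔸.isPartialIso_of_map f, h𝔸.isEtaleMap_of_map f⟩⟩
  have G : ∀ P : EtaleGpd.HCon.{w} C, EtaleGpd.GlueingFamily P.obj :=
    fun P => (EtaleGpd.GlueingFamily.nonempty hC P.obj).some
  -- The equivalences were built from `PhiE` and `Ψ` themselves, so the equalities of functors hold
  -- by definition.
  exact ⟨EtaleGpd.psi G, EtaleGpd.phiEquivalence G, EtaleGpd.phiEquivalenceGpd G, rfl, rfl,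
    fun P => (G P).isIso_unit P.property.2, rfl, rfl⟩
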